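/- **Setting.** Let $d\ge 0$ and let $\mathcal K$ be a complex Hilbert space. Words are taken in the letters $z_1,\dots,z_d,z_1^*,\dots,z_d^*$; $\emptyset$ is the empty word and $\alpha\mapsto\alpha^*$ reverses a word and exchanges $z_i$ with $z_i^*$. A word is *analytic* if it contains only letters $z_i$, and *coanalytic* if it contains only letters $z_i^*$. For a $d$-tuple $Z$ of complex $n\times n$ matrices, $Z^\alpha$ denotes the value of $\alpha$ at $Z$ (with $z_i^*$ evaluated at $Z_i^*$), and $\|Z\|=\max_i\|Z_i\|$ (operator norm). A family $a=(a_\alpha)$ of bounded operators $\mathcal E\to\mathcal F$ between Hilbert spaces defines the nc power series $a(Z)=\sum_\alpha a_\alpha Z^\alpha=\sum_\alpha Z^\alpha\otimes a_\alpha$, whose values are operators $\mathbb C^n\otimes\mathcal E\to\mathbb C^n\otimes\mathcal F$. The series is *analytic* (*coanalytic*) if only analytic (coanalytic) words have nonzero coefficients. It *converges on a uniform neighborhood of $0$* if there is $r>0$ such that for all $n$ and all $Z$ with $\|Z\|<r$ the family $(a_\alpha Z^\alpha)_\alpha$ is summable. Let $f(Z)=\sum_\alpha c_\alpha Z^\alpha$,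 with $c_\alpha\in\mathcal B(\mathcal K)$, be an nc power series converging on a uniform neighborhood of $0$. Suppose that $f$ is plurisubharmonic near $0$: for each $n$, for all $n\times n$ tuples $Z$ close enough to $0$, $f(Z)$ is self-adjoint and, for every direction $H$, the complex Hessian $\frac{\partial^2}{\partial\bar z\,\partial z}f(Z+zH)\big|_{z=0}$ is positive semidefinite. **Conclusion.** The infinite block matrices $$C^+=[c_{\alpha^*z_i^*z_j\beta}]_{z_i\alpha,\,z_j\beta},\qquad C^-=[c_{\alpha^*z_iz_j^*\beta}]_{z_i^*\alpha,\,z_j^*\beta}$$ are positive semidefinite. Let $\mathcal H^+$ (resp. $\mathcal H^-$) be the Hilbert space obtained by separating and completing the span of symbols $[\alpha\otimes w]$, where $w\in\mathcal K$ and $\alpha$ is a word starting with some $z_i$ (resp. some $z_i^*$), for the semi-inner product determined by $\langle[\beta\otimes w],[\alpha\otimes u]\rangle=\langle c_{\alpha^*\beta}w,u\rangle$. For every nonempty analytic word $\alpha$ there is a unique bounded operator $T_\alpha:\mathcal H^-\to\mathcal H^+$ with $T_\alpha[\beta\otimes w]=[\alpha\beta\otimes w]$ for all $w\in\mathcal K$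 and all words $\beta$ starting with some $z_i^*$. Put $Q_\alpha w=[\alpha\otimes w]$ and $$T(Z)=\sum_\alpha T_\alpha Z^\alpha,\quad v^+(Z)=\sum_\alpha Q_\alpha Z^\alpha,\quad v^-(Z)=\sum_\alpha Q_{\alpha^*}Z^{\alpha^*},\quad g(Z)=c_\emptyset+2\sum_\alpha c_\alpha Z^\alpha,$$ all sums over nonempty analytic words $\alpha$. Then: 1. $T_\alpha^*[\beta\otimes w]=[\alpha^*\beta\otimes w]$ for all nonempty analytic $\alpha$, all words $\beta$ starting with some $z_i$, and all $w\in\mathcal K$. 2. $\sup_\alpha\|T_\alpha\|^{1/|\alpha|}<\infty$, over nonempty analytic $\alpha$. 3. $T,v^+,v^-,g$ converge on a uniform neighborhood of $0$. 4. There is $r>0$ such that $\|T(Z)\|<1$ for all $n$ and all $n\times n$ tuples $Z$ with $\|Z\|<r$. 5. There is $r>0$ such that for all $n$ and all $n\times n$ tuples $Z$ with $\|Z\|<r$ the block operator below is invertible and $$f(Z)=\operatorname{Re}g(Z)+\begin{bmatrix}v^+(Z)\\ v^-(Z)\end{bmatrix}^*\begin{bmatrix}1&-T(Z)\\-T(Z)^*&1\end{bmatrix}^{-1}\begin{bmatrix}v^+(Z)\\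 v^-(Z)\end{bmatrix}.$$ 6. Let $\hat{\mathcal H}^+,\hat{\mathcal H}^-$ be Hilbert spaces, let $\hat g,\hat v^+,\hat T$ be analytic and $\hat v^-$ coanalytic nc power series, with coefficients in $\mathcal B(\mathcal K)$, $\mathcal B(\mathcal K,\hat{\mathcal H}^+)$, $\mathcal B(\hat{\mathcal H}^-,\hat{\mathcal H}^+)$ and $\mathcal B(\mathcal K,\hat{\mathcal H}^-)$ respectively. Suppose that for each $n$ their expansions into homogeneous parts converge for all $n\times n$ tuples $Z$ near $0$, that $\hat T,\hat v^+,\hat v^-$ vanish at $0$, and that for each $n$ the formula in 5 holds for all $n\times n$ tuples $Z$ near $0$ with $\hat g,\hat v^\pm,\hat T$ in place of $g,v^\pm,T$. Then $\hat g=g+iC$ for a constant self-adjoint $C\in\mathcal B(\mathcal K)$, and there are closed subspaces $\mathcal L^\pm\subseteq\hat{\mathcal H}^\pm$, unitaries $U^\pm:\mathcal H^\pm\oplus\mathcal L^\pm\to\hat{\mathcal H}^\pm$ and an analytic nc power series $J$, with coefficients in $\mathcal B(\mathcal L^-,\mathcal L^+)$, vanishing at $0$ and convergent near $0$ for each $n$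 (in the same sense), such that $$\hat v^+=U^+(v^+\oplus0),\qquad \hat v^-=U^-(v^-\oplus0),\qquad \hat T=U^+(T\oplus J)(U^-)^*$$ coefficient by coefficient. -/

import Mathlib

open scoped Matrix.Norms.L2Operator Topology

universe u v

noncomputable section

namespace NCPsh

/-! ### Words, matrix tuples and noncommutative power series -/

/-- The letters are `z_i` (`Sum.inl i`) and `z_i^*` (`Sum.inr i`) for `i < d`. -/
abbrev Letter (d : ℕ) : Type := Fin d ⊕ Fin d

/-- Words in the letters `z_i`, `z_i^*`. -/
abbrev Word (d : ℕ) : Type := List (Letter d)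

variable {d n : ℕ}

/-- The formal adjoint `α^*` of a word: reverse the order and exchange `z_i` with `z_i^*`. -/
def Word.adj (α : Word d) : Word d := (α.map Sum.swap).reverse

/-- Words in the letters `z_i` only. -/
def Word.IsAnalytic (α : Word d) : Prop := ∀ l ∈ α, l.isLeft = true

/-- Words in the letters `z_i^*` only. -/
def Word.IsCoanalytic (α : Word d) : Prop := ∀ l ∈ α, l.isRight = true

/-- Words of the form `z_i β`. -/
def Word.StartsAnalytic (α : Word d) : Prop := ∃ (i : Fin d) (β : Word d), α = Sum.inl i :: β

/-- Words of the form `z_i^* β`. -/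
def Word.StartsCoanalytic (α : Word d) : Prop := ∃ (i : Fin d) (β : Word d), α = Sum.inr i :: β

/-- `d`-tuples of complex `n × n` matrices. With the operator norm on matrices, `‖Z‖ < r` says that
`‖Z i‖ < r` for all `i` (for `r > 0`). The union over all `n` of the balls `‖Z‖ < r` is a uniformly
open free set, and every uniformly open free set containing `0` contains one of these. -/
abbrev MatTuple (d n : ℕ) : Type := Fin d → Matrix (Fin n) (Fin n) ℂ

/-- The value `Z^α` of a word at a tuple of matrices. -/
def wordEval (Z : MatTuple d n) (α : Word d) : Matrix (Fin n) (Fin n) ℂ :=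
  (α.map (Sum.elim Z fun i => (Z i).conjTranspose)).prod

section Operators

variable {E F : Type*} [NormedAddCommGroup E] [InnerProductSpace ℂ E]
  [NormedAddCommGroup F] [InnerProductSpace ℂ F]

/-- The Hilbert space `ℂⁿ ⊗ E`, that is, the orthogonal sum of `n` copies of `E`. -/
abbrev Amp (n : ℕ) (E : Type*) : Type _ := PiLp 2 fun _ : Fin n => E

/-- The operator `A ⊗ a : ℂⁿ ⊗ E → ℂⁿ ⊗ F`, `((A ⊗ a) x)_i = ∑ j, A i j • a (x_j)`. -/
def tens (A : Matrix (Fin n) (Fin n) ℂ) (a : E →L[ℂ] F) : Amp n E →L[ℂ] Amp n F :=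
  (PiLp.continuousLinearEquiv 2 ℂ fun _ : Fin n => F).symm.toContinuousLinearMap ∘L
    (ContinuousLinearMap.pi fun i =>
      ∑ j, A i j • (a ∘L (ContinuousLinearMap.proj j : (Fin n → E) →L[ℂ] E))) ∘L
    (PiLp.continuousLinearEquiv 2 ℂ fun _ : Fin n => E).toContinuousLinearMap

/-- The homogeneous part `∑_{|α| = k} a_α Z^α` of degree `k`. -/
def homPart (a : Word d → E →L[ℂ] F) (k : ℕ) (Z : MatTuple d n) : Amp n E →L[ℂ] Amp n F :=
  ∑ α : Fin k → Letter d, tens (wordEval Z (List.ofFn α)) (a (List.ofFn α))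

/-- The value at `Z` of the noncommutative power series with coefficients `a`, as the sum of its
homogeneous parts. (Where the series is summable over all words this is the sum over all words.) -/
def ncEval (a : Word d → E →L[ℂ] F) (Z : MatTuple d n) : Amp n E →L[ℂ] Amp n F :=
  ∑' k, homPart a k Z

/-- The series converges (unconditionally, over all words) at every point of the uniform
neighborhood `‖Z‖ < r` of `0`, in all matrix sizes. -/
def ConvergesOnBall (a : Word d → E →L[ℂ] F) (r : ℝ) : Prop :=
  ∀ (n : ℕ) (Z : MatTuple d n), ‖Z‖ < r → Summable fun α : Word d => tens (wordEval Z α) (a α)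

/-- In every matrix size, the expansion into homogeneous parts converges near `0`; the size of the
neighborhood may depend on the matrix size. -/
def ConvergesNearZero (a : Word d → E →L[ℂ] F) : Prop :=
  ∀ n : ℕ, ∀ᶠ Z : MatTuple d n in 𝓝 0, Summable fun k => homPart a k Z

/-- Only analytic words occur. -/
def IsAnalyticSeries (a : Word d → E →L[ℂ] F) : Prop := ∀ α, a α ≠ 0 → α.IsAnalytic

/-- Only coanalytic words occur. -/
def IsCoanalyticSeries (a : Word d → E →L[ℂ] F) : Prop := ∀ α, a α ≠ 0 → α.IsCoanalytic

end Operators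

/-! ### Plurisubharmonicity -/

section Psh

variable {K : Type*} [NormedAddCommGroup K] [InnerProductSpace ℂ K] [CompleteSpace K]

/-- The complex Hessian `∂²/∂z̄∂z f(Z + zH)` at `z = 0`, i.e. a quarter of the Laplacian in `z`. -/
def complexHessian (f : MatTuple d n → (Amp n K →L[ℂ] Amp n K)) (Z H : MatTuple d n) :
    Amp n K →L[ℂ] Amp n K :=
  (4 : ℝ)⁻¹ • Laplacian.laplacian (fun z : ℂ => f (Z + z • H)) 0

/-- In every matrix size, for `Z` near `0`, the value `f(Z)` is self-adjoint and the complex Hessian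
of `f` at `Z` is positive semidefinite in all directions. The neighborhood of `0` may depend on the
matrix size. -/
def PlurisubharmonicNearZero (f : ∀ n : ℕ, MatTuple d n → (Amp n K →L[ℂ] Amp n K)) : Prop :=
  ∀ n : ℕ, ∀ᶠ Z : MatTuple d n in 𝓝 0,
    IsSelfAdjoint (f n Z) ∧ ∀ H : MatTuple d n, (complexHessian (f n) Z H).IsPositive

end Psh

/-! ### The Hankel-type matrices, their Hilbert spaces, and the coefficients of the realization -/

section Construction

variable {K : Type*} [NormedAddCommGroup K] [InnerProductSpace ℂ K]

/-- The block matrix `C⁺ = [c_{α^* β}]` with `α`, `β` running over the words `z_i α'`. -/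
def Cplus (c : Word d → K →L[ℂ] K) :
    Matrix {α : Word d // α.StartsAnalytic} {α : Word d // α.StartsAnalytic} (K →L[ℂ] K) :=
  .of fun α β => c (α.1.adj ++ β.1)

/-- The block matrix `C⁻ = [c_{α^* β}]` with `α`, `β` running over the words `z_i^* α'`. -/
def Cminus (c : Word d → K →L[ℂ] K) :
    Matrix {α : Word d // α.StartsCoanalytic} {α : Word d // α.StartsCoanalytic} (K →L[ℂ] K) :=
  .of fun α β => c (α.1.adj ++ β.1)

variable [CompleteSpace K]

/-- The Hilbert space `H⁺`: the completion of the finite combinations of the symbols `[α ⊗ w]`, with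
`α` a word `z_i α'`, for the inner product with `⟨[β ⊗ w], [α ⊗ u]⟩ = ⟨c_{α^* β} w, u⟩`. -/
abbrev Hplus (c : Word d → K →L[ℂ] K) [Fact (Cplus c).PosSemidef] : Type _ :=
  RKHS.OfKernel (Cplus c)

/-- The Hilbert space `H⁻`: the same with `α` a word `z_i^* α'`. -/
abbrev Hminus (c : Word d → K →L[ℂ] K) [Fact (Cminus c).PosSemidef] : Type _ :=
  RKHS.OfKernel (Cminus c)

open Classical in
/-- The map `w ↦ [α ⊗ w]` into `H⁺`, for a word `α = z_i α'` (and `0` for all other words). -/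
def vecPlus (c : Word d → K →L[ℂ] K) [Fact (Cplus c).PosSemidef] (α : Word d) :
    K →L[ℂ] Hplus c :=
  if h : α.StartsAnalytic then RKHS.kerFun (Hplus c) (⟨α, h⟩ : {α : Word d // α.StartsAnalytic})
  else 0

open Classical in
/-- The map `w ↦ [α ⊗ w]` into `H⁻`, for a word `α = z_i^* α'` (and `0` for all other words). -/
def vecMinus (c : Word d → K →L[ℂ] K) [Fact (Cminus c).PosSemidef] (α : Word d) :
    K →L[ℂ] Hminus c :=
  if h : α.StartsCoanalytic then
    RKHS.kerFun (Hminus c) (⟨α, h⟩ : {α : Word d // α.StartsCoanalytic})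
  else 0

/-- The family of bounded operators `T_α : H⁻ → H⁺`, `T_α [β ⊗ w] = [αβ ⊗ w]`, for nonempty analytic
words `α`, extended by `0` to all other words. -/
def IsShiftFamily (c : Word d → K →L[ℂ] K) [Fact (Cplus c).PosSemidef] [Fact (Cminus c).PosSemidef]
    (T : Word d → Hminus c →L[ℂ] Hplus c) : Prop :=
  (∀ α : Word d, α.IsAnalytic → α ≠ [] → ∀ β : Word d, β.StartsCoanalytic → ∀ w : K,
    T α (vecMinus c β w) = vecPlus c (α ++ β) w) ∧
  ∀ α : Word d, ¬(α.IsAnalytic ∧ α ≠ []) → T α = 0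

open Classical in
/-- The coefficients of `v⁺(Z) = ∑ Q_α Z^α`, over nonempty analytic `α`, with `Q_α w = [α ⊗ w]`. -/
def vplusCoeff (c : Word d → K →L[ℂ] K) [Fact (Cplus c).PosSemidef] (α : Word d) :
    K →L[ℂ] Hplus c :=
  if α.IsAnalytic ∧ α ≠ [] then vecPlus c α else 0

open Classical in
/-- The coefficients of `v⁻(Z) = ∑ Q_{α^*} Z^{α^*}`, over nonempty analytic `α`, i.e. over the
nonempty coanalytic words `α^*`. -/
def vminusCoeff (c : Word d → K →L[ℂ] K) [Fact (Cminus c).PosSemidef] (α : Word d) :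
    K →L[ℂ] Hminus c :=
  if α.IsCoanalytic ∧ α ≠ [] then vecMinus c α else 0

open Classical in
/-- The coefficients of `g(Z) = c_0 + 2 ∑ c_α Z^α`, over nonempty analytic `α`. -/
def gCoeff (c : Word d → K →L[ℂ] K) (α : Word d) : K →L[ℂ] K :=
  if α = [] then c [] else if α.IsAnalytic then (2 : ℂ) • c α else 0

end Construction

/-! ### The realization formula -/

section Realization

variable {E F G : Type*} [NormedAddCommGroup E] [InnerProductSpace ℂ E]
  [NormedAddCommGroup F] [InnerProductSpace ℂ F] [NormedAddCommGroup G] [InnerProductSpace ℂ G]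

/-- The column operator `[v; w]`. -/
def col (v : E →L[ℂ] F) (w : E →L[ℂ] G) : E →L[ℂ] WithLp 2 (F × G) :=
  (WithLp.prodContinuousLinearEquiv 2 ℂ F G).symm.toContinuousLinearMap ∘L v.prod w

variable [CompleteSpace E] [CompleteSpace F] [CompleteSpace G]

/-- The block operator `[[1, -T], [-T^*, 1]]` on `F ⊕ G`, for `T : G → F`. -/
def blockOp (T : G →L[ℂ] F) : WithLp 2 (F × G) →L[ℂ] WithLp 2 (F × G) :=
  col (WithLp.fstL 2 ℂ F G - T ∘L WithLp.sndL 2 ℂ F G)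
    (WithLp.sndL 2 ℂ F G - T.adjoint ∘L WithLp.fstL 2 ℂ F G)

/-- `Re g + [v; w]^* [[1, -T], [-T^*, 1]]⁻¹ [v; w]`. -/
def realize (g : E →L[ℂ] E) (v : E →L[ℂ] F) (w : E →L[ℂ] G) (T : G →L[ℂ] F) : E →L[ℂ] E :=
  (2 : ℂ)⁻¹ • (g + g.adjoint) + (col v w).adjoint ∘L Ring.inverse (blockOp T) ∘L col v w

end Realization

end NCPsh

end

open NCPsh

noncomputable section

namespace NCPsh

variable {d n : ℕ}

/-! ### Words -/

/-! Evaluating the series at a scalar point of size one forces `‖c α‖ ≤ M * R ^ |α|`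
(`ConvergesOnBall.growthBound`), and this bound controls every later convergence in all matrix sizes
at once. A series is determined by its values near `0` (`eq_of_hasSum_homPart`), because creation
and annihilation matrices on truncated Fock spaces separate words. Self-adjoint values therefore
give `c α^* = (c α)^*`.

Positivity (`gram_nonneg`). The complex Hessian is the sum over all words with one analytic and one
coanalytic letter replaced by the direction (`GrowthBound.hasSum_complexHessian`). Given words `σ i`
whose first letters have the same type, take one Fock space per index and one extra dimension. The
base point creates and annihilates letters, and the direction hops from the state holding the tail
of `σ i` to the extra dimension and back. A closed walk from the vacuum of copy `i` to the vacuum of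
copy `j` through both hops has length at least `|σ j| + |σ i|`, and the only walk of that length
spells `(σ j)^* σ i` (`wordHess_vac`). Scaling the base point by `t`, weighting the vacuum `i` by `t
^ (-|σ i|)` and letting `t → 0` leaves exactly the Gram sum of `C±`. Only one matrix size is used
for each finite family, so neighborhoods depending on the size do no harm.

Boundedness (`norm_synth_shiftVec_le`). Shifting by `α^* α` is formally the positive operator `T_α^*
T_α` on `H⁻`. Its moments satisfy `a_m ^ 2 ≤ a_0 a_{2m}` by Cauchy-Schwarz and grow at most like `R
^ (2|α|m)`, so doubling `m` repeatedly gives `a_1 ≤ a_0 R ^ (2|α|)`, that is, `‖T_α‖ ≤ R ^ |α|`.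

Realization. Regard all `[γ ⊗ ·]` as coefficients of series `x⁺` and `x⁻`. Cutting a word after its
first block of letters of one type gives `x⁺ = v⁺ + T x⁻` and `x⁻ = v⁻ + T^* x⁺`. This is the block
linear system, so the block formula equals `Re g + (v⁺)^* x⁺ + (v⁻)^* x⁻`. In this series the pure
words come from `Re g` and the mixed words from the inner products defining `H±`
(`formalRealize_eq`).

Uniqueness. For another realization the same system has formal solutions `xp`, `xm`, convergent
along each ray near `0`, so the formula holds coefficient by coefficient (`eq_formalRealize`).
Peeling blocks off words shows that `xp`, `xm` have the Gram matrices `C±`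
(`IsFormalRealization.inner_eq`). Hence `[α ⊗ w] ↦ xp α w` and `[α ⊗ w] ↦ xm α w` extend to
isometries. They intertwine the two `T`s and their adjoints, so the orthogonal complements of their
ranges carry the junk summand `J`. -/

theorem Word.adj_append (α β : Word d) : (α ++ β).adj = β.adj ++ α.adj := by
  simp [Word.adj]

@[simp] theorem Word.adj_adj (α : Word d) : α.adj.adj = α := by
  simp [Word.adj, List.map_reverse]

@[simp] theorem Word.adj_nil : Word.adj ([] : Word d) = [] := rfl

theorem Word.adj_cons (l : Letter d) (α : Word d) : Word.adj (l :: α) = α.adj ++ [l.swap] := by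
  simp [Word.adj]

@[simp] theorem Word.length_adj (α : Word d) : α.adj.length = α.length := by
  simp [Word.adj]

theorem Word.adj_eq_nil {α : Word d} : α.adj = [] ↔ α = [] := by
  simp [Word.adj]

theorem Word.isAnalytic_adj {α : Word d} : α.adj.IsAnalytic ↔ α.IsCoanalytic := by
  simp [Word.IsAnalytic, Word.IsCoanalytic, Word.adj]

theorem Word.isCoanalytic_adj {α : Word d} : α.adj.IsCoanalytic ↔ α.IsAnalytic := by
  simp [Word.IsAnalytic, Word.IsCoanalytic, Word.adj]

/-- The value of the letters at a tuple of matrices. -/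
def letters (Z : MatTuple d n) : Letter d → Matrix (Fin n) (Fin n) ℂ :=
  Sum.elim Z fun i => (Z i).conjTranspose

theorem wordEval_nil (Z : MatTuple d n) : wordEval Z [] = 1 := rfl

theorem wordEval_cons (Z : MatTuple d n) (l : Letter d) (α : Word d) :
    wordEval Z (l :: α) = letters Z l * wordEval Z α := by
  simp [wordEval, letters]

theorem wordEval_append (Z : MatTuple d n) (α β : Word d) :
    wordEval Z (α ++ β) = wordEval Z α * wordEval Z β := by
  simp [wordEval]

theorem letters_swap (Z : MatTuple d n) (l : Letter d) :
    letters Z l.swap = (letters Z l).conjTranspose := by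
  cases l <;> simp [letters]

theorem wordEval_adj (Z : MatTuple d n) (α : Word d) :
    wordEval Z α.adj = (wordEval Z α).conjTranspose := by
  induction α with
  | nil => simp [wordEval_nil]
  | cons l α ih =>
    rw [Word.adj_cons, wordEval_append, wordEval_cons, wordEval_cons, wordEval_nil, ih, mul_one,
      letters_swap, Matrix.conjTranspose_mul]

theorem letters_smul (t : ℝ) (Z : MatTuple d n) (l : Letter d) :
    letters (t • Z) l = t • letters Z l := by
  cases l <;> simp [letters, Matrix.conjTranspose_smul]

theorem letters_add (Z W : MatTuple d n) (l : Letter d) :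
    letters (Z + W) l = letters Z l + letters W l := by
  cases l <;> simp [letters]

theorem wordEval_smul (t : ℝ) (Z : MatTuple d n) (α : Word d) :
    wordEval (t • Z) α = t ^ α.length • wordEval Z α := by
  induction α with
  | nil => simp [wordEval_nil]
  | cons l α ih =>
    rw [wordEval_cons, wordEval_cons, ih, letters_smul, smul_mul_smul_comm, List.length_cons,
      pow_succ']

theorem norm_letters_le (Z : MatTuple d n) (l : Letter d) : ‖letters Z l‖ ≤ ‖Z‖ := by
  cases l with
  | inl i => exact norm_le_pi_norm Z i
  | inr i => 
    simpa [letters, Matrix.l2_opNorm_conjTranspose] using norm_le_pi_norm Z i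

/-- An inequality only, since for `n = 0` the identity is the zero matrix. -/
theorem norm_one_matrix_le : ‖(1 : Matrix (Fin n) (Fin n) ℂ)‖ ≤ 1 := by
  rw [Matrix.cstar_norm_def, map_one]
  exact ContinuousLinearMap.norm_id_le

theorem norm_wordEval_le (Z : MatTuple d n) (α : Word d) : ‖wordEval Z α‖ ≤ ‖Z‖ ^ α.length := by
  induction α with
  | nil => simpa [wordEval_nil] using norm_one_matrix_le
  | cons l α ih =>
    rw [wordEval_cons, List.length_cons, pow_succ']
    exact (norm_mul_le _ _).trans
      (mul_le_mul (norm_letters_le Z l) ih (norm_nonneg _) (norm_nonneg _))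

/-! ### Tensor products of matrices and operators -/

section Tens

variable {E F G : Type*} [NormedAddCommGroup E] [InnerProductSpace ℂ E]
  [NormedAddCommGroup F] [InnerProductSpace ℂ F] [NormedAddCommGroup G] [InnerProductSpace ℂ G]

instance instNormedAddCommGroupAmp : NormedAddCommGroup (Amp n E →L[ℂ] Amp n F) := inferInstance
instance instNormedSpaceRealAmp : NormedSpace ℝ (Amp n E →L[ℂ] Amp n F) := inferInstance
instance instModuleRealAmp : Module ℝ (Amp n E →L[ℂ] Amp n F) := inferInstance
instance instModuleComplexAmp : Module ℂ (Amp n E →L[ℂ] Amp n F) := inferInstance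
instance instAddCommGroupAmp : AddCommGroup (Amp n E →L[ℂ] Amp n F) := inferInstance
instance instAddCommMonoidAmp : AddCommMonoid (Amp n E →L[ℂ] Amp n F) := inferInstance
instance instDistribSMulRealAmp : DistribSMul ℝ (Amp n E →L[ℂ] Amp n F) := inferInstance
instance instMulActionRealAmp : MulAction ℝ (Amp n E →L[ℂ] Amp n F) := inferInstance

theorem tens_apply (A : Matrix (Fin n) (Fin n) ℂ) (a : E →L[ℂ] F) (x : Amp n E) (i : Fin n) :
    tens A a x i = ∑ j, A i j • a (x j) := by
  simp [tens]

theorem tens_comp (A B : Matrix (Fin n) (Fin n) ℂ) (a : F →L[ℂ] G) (b : E →L[ℂ] F) :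
    tens A a ∘L tens B b = tens (A * B) (a ∘L b) := by
  ext x i
  simp only [ContinuousLinearMap.comp_apply, tens_apply, map_sum, map_smul, Matrix.mul_apply,
    Finset.sum_smul, Finset.smul_sum, smul_smul]
  exact Finset.sum_comm

theorem tens_add_left (A B : Matrix (Fin n) (Fin n) ℂ) (a : E →L[ℂ] F) :
    tens (A + B) a = tens A a + tens B a := by
  ext x i
  simp [tens_apply, add_smul, Finset.sum_add_distrib]

theorem tens_add_right (A : Matrix (Fin n) (Fin n) ℂ) (a b : E →L[ℂ] F) :
    tens A (a + b) = tens A a + tens A b := by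
  ext x i
  simp [tens_apply, Finset.sum_add_distrib]

theorem tens_smul_left (z : ℂ) (A : Matrix (Fin n) (Fin n) ℂ) (a : E →L[ℂ] F) :
    tens (z • A) a = z • tens A a := by
  ext x i
  simp [tens_apply, Finset.smul_sum, smul_smul]

theorem tens_smul_right (z : ℂ) (A : Matrix (Fin n) (Fin n) ℂ) (a : E →L[ℂ] F) :
    tens A (z • a) = z • tens A a := by
  ext x i
  simp [tens_apply, Finset.smul_sum, smul_smul, mul_comm]

theorem tens_adjoint [CompleteSpace E] [CompleteSpace F] (A : Matrix (Fin n) (Fin n) ℂ)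
    (a : E →L[ℂ] F) : (tens A a).adjoint = tens A.conjTranspose a.adjoint := by
  symm
  rw [ContinuousLinearMap.eq_adjoint_iff]
  intro x y
  simp only [PiLp.inner_apply, tens_apply, sum_inner, inner_sum, inner_smul_left, inner_smul_right,
    ContinuousLinearMap.adjoint_inner_left, Matrix.conjTranspose_apply]
  rw [Finset.sum_comm]
  simp

/-- The operator `A ⊗ a` as a linear function of `a`. -/
def tensRight (A : Matrix (Fin n) (Fin n) ℂ) : (E →L[ℂ] F) →ₗ[ℂ] (Amp n E →L[ℂ] Amp n F) where
  toFun a := tens A a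
  map_add' := tens_add_right A
  map_smul' z a := tens_smul_right z A a

/-- The operator `A ⊗ a` as a linear function of `A`. -/
def tensLeft (a : E →L[ℂ] F) : Matrix (Fin n) (Fin n) ℂ →ₗ[ℂ] (Amp n E →L[ℂ] Amp n F) where
  toFun A := tens A a
  map_add' A B := tens_add_left A B a
  map_smul' z A := tens_smul_left z A a

theorem tens_zero_right (A : Matrix (Fin n) (Fin n) ℂ) : tens A (0 : E →L[ℂ] F) = 0 :=
  (tensRight A).map_zero

theorem tens_sum_right {ι : Type*} (s : Finset ι) (A : Matrix (Fin n) (Fin n) ℂ)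
    (a : ι → E →L[ℂ] F) : tens A (∑ i ∈ s, a i) = ∑ i ∈ s, tens A (a i) :=
  map_sum (tensRight A) a s

theorem tens_real_smul_left (t : ℝ) (A : Matrix (Fin n) (Fin n) ℂ) (a : E →L[ℂ] F) :
    tens (t • A) a = t • tens A a := by
  ext x i
  simp [tens_apply, Finset.smul_sum, mul_smul]

theorem norm_tens_one_left_le (a : E →L[ℂ] F) :
    ‖tens (1 : Matrix (Fin n) (Fin n) ℂ) a‖ ≤ ‖a‖ := by
  refine ContinuousLinearMap.opNorm_le_bound _ (norm_nonneg _) fun x => ?_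
  have h : ∀ i, tens (1 : Matrix (Fin n) (Fin n) ℂ) a x i = a (x i) := fun i => by
    simp [tens_apply, Matrix.one_apply]
  refine le_of_sq_le_sq ?_ (by positivity)
  rw [PiLp.norm_sq_eq_of_L2, mul_pow, PiLp.norm_sq_eq_of_L2, Finset.mul_sum]
  refine Finset.sum_le_sum fun i _ => ?_
  rw [h, ← mul_pow]
  exact pow_le_pow_left₀ (norm_nonneg _) (a.le_opNorm _) 2

/-- The amplification `A ↦ A ⊗ 1` as a homomorphism of `C⋆`-algebras. -/
def ampHom (E : Type*) [NormedAddCommGroup E] [InnerProductSpace ℂ E] [CompleteSpace E] (n : ℕ) :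
    Matrix (Fin n) (Fin n) ℂ →⋆ₙₐ[ℂ] (Amp n E →L[ℂ] Amp n E) where
  toFun A := tens A (ContinuousLinearMap.id ℂ E)
  map_smul' z A := tens_smul_left z A _
  map_zero' := (tensLeft _).map_zero
  map_add' A B := tens_add_left A B _
  map_mul' A B := by
    rw [ContinuousLinearMap.mul_def, tens_comp, ContinuousLinearMap.id_comp]
  map_star' A := by
    rw [ContinuousLinearMap.star_eq_adjoint, tens_adjoint]
    rw [Matrix.star_eq_conjTranspose, ← ContinuousLinearMap.star_eq_adjoint]
    exact congrArg _ (star_one (E →L[ℂ] E)).symm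

theorem norm_tens_id_le [CompleteSpace E] (A : Matrix (Fin n) (Fin n) ℂ) :
    ‖tens A (ContinuousLinearMap.id ℂ E)‖ ≤ ‖A‖ :=
  NonUnitalStarAlgHom.norm_apply_le (ampHom E n) A

/-- Factor `A ⊗ a = (A ⊗ 1)(1 ⊗ a)`. The first factor is contractive in `A` because star
homomorphisms of `C⋆`-algebras are, so no constant depending on `n` appears; this is what makes all
the radii uniform. -/
theorem norm_tens_le [CompleteSpace F] (A : Matrix (Fin n) (Fin n) ℂ) (a : E →L[ℂ] F) :
    ‖tens A a‖ ≤ ‖A‖ * ‖a‖ := by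
  have : tens A a = tens A (ContinuousLinearMap.id ℂ F) ∘L tens 1 a := by
    rw [tens_comp, mul_one, ContinuousLinearMap.id_comp]
  rw [this]
  exact (ContinuousLinearMap.opNorm_comp_le _ _).trans
    (mul_le_mul (norm_tens_id_le A) (norm_tens_one_left_le a) (norm_nonneg _) (norm_nonneg _))

theorem inner_tens_apply (A : Matrix (Fin n) (Fin n) ℂ) (a : E →L[ℂ] F) (x : Amp n E)
    (y : Amp n F) :
    inner ℂ (tens A a x) y = ∑ i, ∑ j, starRingEnd ℂ (A i j) * inner ℂ (a (x j)) (y i) := by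
  simp only [PiLp.inner_apply, tens_apply, sum_inner, inner_smul_left]

end Tens

/-! ### Noncommutative power series -/

section Series

variable {E F G : Type*} [NormedAddCommGroup E] [InnerProductSpace ℂ E]
  [NormedAddCommGroup F] [InnerProductSpace ℂ F] [NormedAddCommGroup G] [InnerProductSpace ℂ G]

/-- The Cauchy product of two series. -/
def conv (a : Word d → F →L[ℂ] G) (b : Word d → E →L[ℂ] F) (γ : Word d) : E →L[ℂ] G :=
  ∑ p ∈ Finset.HasAntidiagonal.antidiagonal (List.length γ), a (γ.take p.1) ∘L b (γ.drop p.1)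

/-- The series whose values are the adjoints of the values of `a`. -/
def adjSeries [CompleteSpace E] [CompleteSpace F] (a : Word d → E →L[ℂ] F) (γ : Word d) :
    F →L[ℂ] E := (a γ.adj).adjoint

theorem homPart_smul (a : Word d → E →L[ℂ] F) (k : ℕ) (t : ℝ) (Z : MatTuple d n) :
    homPart a k (t • Z) = t ^ k • homPart a k Z := by
  simp [homPart, wordEval_smul, tens_real_smul_left, Finset.smul_sum]

theorem homPart_add (a b : Word d → E →L[ℂ] F) (k : ℕ) (Z : MatTuple d n) :
    homPart (a + b) k Z = homPart a k Z + homPart b k Z := by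
  simp [homPart, tens_add_right, Finset.sum_add_distrib]

theorem homPart_const_smul (z : ℂ) (a : Word d → E →L[ℂ] F) (k : ℕ) (Z : MatTuple d n) :
    homPart (z • a) k Z = z • homPart a k Z := by
  simp [homPart, tens_smul_right, Finset.smul_sum]

/-- For each `i + j = k`, cutting after `i` letters is a bijection from words of length `k` to pairs
of words of lengths `i` and `j`. -/
theorem homPart_conv (a : Word d → F →L[ℂ] G) (b : Word d → E →L[ℂ] F) (k : ℕ)
    (Z : MatTuple d n) :
    homPart (conv a b) k Z =
      ∑ p ∈ Finset.HasAntidiagonal.antidiagonal k, homPart a p.1 Z ∘L homPart b p.2 Z := by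
  simp only [homPart, conv, tens_sum_right, List.length_ofFn]
  rw [Finset.sum_comm]
  refine Finset.sum_congr rfl fun p hp => ?_
  obtain ⟨i, j⟩ := p
  rw [Finset.HasAntidiagonal.mem_antidiagonal] at hp
  subst hp
  simp only [ContinuousLinearMap.finsetSum_comp, ContinuousLinearMap.comp_finsetSum]
  rw [← (Fin.appendEquiv i j).sum_comp, Fintype.sum_prod_type_right]
  refine Finset.sum_congr rfl fun x _ => ?_
  refine Finset.sum_congr rfl fun y _ => ?_
  simp only [Fin.appendEquiv, Equiv.coe_fn_mk, List.ofFn_fin_append, wordEval_append]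
  rw [tens_comp, List.take_left' (by simp), List.drop_left' (by simp)]

theorem adjoint_homPart [CompleteSpace E] [CompleteSpace F] (a : Word d → E →L[ℂ] F) (k : ℕ)
    (Z : MatTuple d n) : (homPart a k Z).adjoint = homPart (adjSeries a) k Z := by
  simp only [homPart, map_sum, tens_adjoint, adjSeries]
  refine Fintype.sum_equiv (Equiv.arrowCongr Fin.revPerm (Equiv.sumComm _ _)) _ _ fun α => ?_
  have : List.ofFn (Equiv.arrowCongr Fin.revPerm (Equiv.sumComm _ _) α) =
      Word.adj (List.ofFn α) := by
    refine List.ext_getElem (by simp) fun i h1 h2 => ?_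
    simp [Word.adj, Fin.rev]
    congr 2
    ext
    simp
    omega
  rw [this, wordEval_adj, Word.adj_adj]

theorem hasSum_word {M : Type*} [AddCommGroup M] [TopologicalSpace M] [RegularSpace M]
    [ContinuousAdd M] {f : Word d → M} {x : M} (h : HasSum f x) :
    HasSum (fun k => ∑ α : Fin k → Letter d, f (List.ofFn α)) x :=
  ((List.equivSigmaTuple (α := Letter d)).symm.hasSum_iff.2 h).sigma fun _ => hasSum_fintype _

theorem hasSum_ncEval {a : Word d → E →L[ℂ] F} {Z : MatTuple d n}
    (h : Summable fun α : Word d => tens (wordEval Z α) (a α)) :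
    HasSum (fun α : Word d => tens (wordEval Z α) (a α)) (ncEval a Z) := by
  have := (hasSum_word h.hasSum).tsum_eq
  rw [ncEval]
  simp only [homPart]
  rw [this]
  exact h.hasSum

/-- There are `(2d) ^ k` words of length `k`. -/
theorem summable_word_pow {q : ℝ} (hq : 0 ≤ q) (h : 2 * d * q < 1) :
    Summable fun α : Word d => q ^ α.length := by
  rw [← (List.equivSigmaTuple (α := Letter d)).symm.summable_iff, summable_sigma_of_nonneg]
  · refine ⟨fun k => (hasSum_fintype _).summable, ?_⟩
    refine (summable_geometric_of_lt_one (by positivity) h).congr fun k => ?_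
    simp [tsum_fintype, List.equivSigmaTuple, mul_pow, ← two_mul]
  · intro x
    exact pow_nonneg hq _

/-- At most exponential growth of the coefficients. -/
def GrowthBound (a : Word d → E →L[ℂ] F) (M R : ℝ) : Prop := ∀ α, ‖a α‖ ≤ M * R ^ α.length

/-- At the one by one tuple with all entries `r / 2` every word of length `k` takes the value `(r /
2) ^ k`. The terms of a summable family are bounded, so `R = 2 / r` works. -/
theorem ConvergesOnBall.growthBound {a : Word d → E →L[ℂ] F} {r : ℝ} (hr : 0 < r)
    (h : ConvergesOnBall a r) : ∃ M R : ℝ, 0 < M ∧ 0 < R ∧ GrowthBound a M R := by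
  have hs : 0 < r / 2 := by positivity
  set Z : MatTuple d 1 := (r / 2) • fun _ => 1 with hZ
  have hZ1 : ∀ α : Word d, wordEval (fun _ => 1 : MatTuple d 1) α = 1 := by
    intro α
    induction α with
    | nil => rfl
    | cons l α ih => rw [wordEval_cons, ih, mul_one]; cases l <;> simp [letters]
  have hZn : ‖Z‖ < r := by
    rw [hZ, norm_smul, Real.norm_of_nonneg hs.le]
    have : ‖(fun _ => 1 : MatTuple d 1)‖ ≤ 1 :=
      (pi_norm_le_iff_of_nonneg zero_le_one).2 fun _ => norm_one_matrix_le
    nlinarith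
  have ht := (h 1 Z hZn).tendsto_cofinite_zero.norm
  obtain ⟨M, hM⟩ := ht.bddAbove_range_of_cofinite
  refine ⟨max M 1, (r / 2)⁻¹, by positivity, by positivity, fun α => ?_⟩
  have h1 := hM ⟨α, rfl⟩
  simp only [hZ, wordEval_smul, hZ1, tens_real_smul_left, norm_smul, norm_pow,
    Real.norm_of_nonneg hs.le] at h1
  have h2 : ‖a α‖ ≤ ‖tens (1 : Matrix (Fin 1) (Fin 1) ℂ) (a α)‖ := by
    refine ContinuousLinearMap.opNorm_le_bound _ (norm_nonneg _) fun w => ?_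
    have := (tens (1 : Matrix (Fin 1) (Fin 1) ℂ) (a α)).le_opNorm (WithLp.toLp 2 fun _ => w)
    simpa [PiLp.norm_eq_of_L2, tens_apply] using this
  rw [inv_pow, ← div_eq_mul_inv, le_div_iff₀ (by positivity), mul_comm]
  calc _ ≤ (r / 2) ^ α.length * ‖tens (1 : Matrix (Fin 1) (Fin 1) ℂ) (a α)‖ := by gcongr
    _ ≤ M := h1
    _ ≤ _ := le_max_left _ _

theorem GrowthBound.norm_tens_le [CompleteSpace F] {a : Word d → E →L[ℂ] F} {M R : ℝ}
    (h : GrowthBound a M R) (Z : MatTuple d n) (α : Word d) :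
    ‖tens (wordEval Z α) (a α)‖ ≤ M * (R * ‖Z‖) ^ α.length := by
  refine (NCPsh.norm_tens_le _ _).trans ?_
  calc _ ≤ ‖Z‖ ^ α.length * (M * R ^ α.length) :=
        mul_le_mul (norm_wordEval_le _ _) (h α) (norm_nonneg _) (by positivity)
    _ = _ := by ring

theorem GrowthBound.norm_homPart_le [CompleteSpace F] {a : Word d → E →L[ℂ] F} {M R : ℝ}
    (h : GrowthBound a M R) (Z : MatTuple d n) (k : ℕ) :
    ‖homPart a k Z‖ ≤ M * (2 * d * R * ‖Z‖) ^ k := by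
  refine (norm_sum_le_of_le _ fun α _ => h.norm_tens_le Z _).trans_eq ?_
  simp [← two_mul]
  ring

theorem GrowthBound.summable [CompleteSpace F] {a : Word d → E →L[ℂ] F} {M R : ℝ} (hR : 0 ≤ R)
    (h : GrowthBound a M R) {Z : MatTuple d n} (hZ : 2 * d * R * ‖Z‖ < 1) :
    Summable fun α : Word d => tens (wordEval Z α) (a α) :=
  .of_norm_bounded ((summable_word_pow (by positivity) (by linarith)).mul_left M)
    fun α => h.norm_tens_le Z α

theorem GrowthBound.summable_norm_homPart [CompleteSpace F] {a : Word d → E →L[ℂ] F} {M R : ℝ}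
    (hR : 0 ≤ R) (h : GrowthBound a M R) {Z : MatTuple d n} (hZ : 2 * d * R * ‖Z‖ < 1) :
    Summable fun k => ‖homPart a k Z‖ :=
  .of_nonneg_of_le (fun _ => norm_nonneg _) (fun k => h.norm_homPart_le Z k)
    ((summable_geometric_of_lt_one (by positivity) hZ).mul_left M)

theorem GrowthBound.convergesOnBall [CompleteSpace F] {a : Word d → E →L[ℂ] F} {M R r : ℝ}
    (hR : 0 ≤ R) (h : GrowthBound a M R) (hr : 2 * d * R * r < 1) : ConvergesOnBall a r :=
  fun _ Z hZ => h.summable hR (lt_of_le_of_lt (by gcongr) hr)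

end Series

/-! ### Words evaluated at families of elements of a ring, and their derivatives -/

section Ring

variable {R S : Type*} [Ring R] [Ring S]

/-- The value of a word at a family of elements of a ring. -/
def wordProd (A : Letter d → R) (α : Word d) : R := (α.map A).prod

/-- The sum of all products obtained from `wordProd A α` by replacing one letter, analytic if
`ε = true` and coanalytic if `ε = false`, by its value at `B`. -/
def wordDeriv (A B : Letter d → R) (ε : Bool) : Word d → R
  | [] => 0
  | l :: α => A l * wordDeriv A B ε α + if l.isLeft = ε then B l * wordProd A α else 0

/-- The sum of all products obtained from `wordProd A α` by replacing one analytic and one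
coanalytic letter by their values at `B`. -/
def wordHess (A B : Letter d → R) : Word d → R
  | [] => 0
  | l :: α => A l * wordHess A B α + B l * wordDeriv A B (!l.isLeft) α

@[simp] theorem wordProd_nil (A : Letter d → R) : wordProd A [] = 1 := rfl

theorem wordProd_cons (A : Letter d → R) (l : Letter d) (α : Word d) :
    wordProd A (l :: α) = A l * wordProd A α := by
  simp [wordProd]

theorem wordProd_letters (Z : MatTuple d n) : wordProd (letters Z) = wordEval Z := rfl

theorem map_wordProd (φ : R →+* S) (A : Letter d → R) (α : Word d) :
    φ (wordProd A α) = wordProd (fun l => φ (A l)) α := by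
  simp [wordProd, map_list_prod, Function.comp_def]

theorem map_wordDeriv (φ : R →+* S) (A B : Letter d → R) (ε : Bool) (α : Word d) :
    φ (wordDeriv A B ε α) = wordDeriv (fun l => φ (A l)) (fun l => φ (B l)) ε α := by
  induction α with
  | nil => simp [wordDeriv]
  | cons l α ih => simp only [wordDeriv, map_add, map_mul, ih, apply_ite φ, map_zero, map_wordProd]

theorem map_wordHess (φ : R →+* S) (A B : Letter d → R) (α : Word d) :
    φ (wordHess A B α) = wordHess (fun l => φ (A l)) (fun l => φ (B l)) α := by
  induction α with
  | nil => simp [wordHess]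
  | cons l α ih => simp only [wordHess, map_add, map_mul, ih, map_wordDeriv]

end Ring

/-! ### Matrices on truncated Fock spaces -/

section Fock

variable {ι : Type*} {N : ℕ}

/-- The index set of a truncated Fock space. -/
abbrev Fock (d N : ℕ) : Type := {s : Word d // s.length ≤ N}

instance : Finite (Fock d N) := List.finite_length_le _ _

/-- The empty word. -/
def Fock.vac : Fock d N := ⟨[], Nat.zero_le _⟩

open Classical in
/-- On copies of the truncated Fock space, indexed by `ι`, and zero on one additional dimension:
the sum of the creation operator of a letter and of the annihilation operator of its adjoint. -/
def fockMat (ι : Type*) (N : ℕ) (l : Letter d) :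
    Matrix ((ι × Fock d N) ⊕ Unit) ((ι × Fock d N) ⊕ Unit) ℂ
  | .inl x, .inl y =>
    if x.1 = y.1 ∧ (x.2.1 = l :: y.2.1 ∨ y.2.1 = l.swap :: x.2.1) then 1 else 0
  | _, _ => 0

open Classical in
/-- The operators that map the vector indexed by `(i, s)` to the additional basis vector if
`σ i = l s`. -/
def hopMat (σ : ι → Word d) (N : ℕ) (l : Letter d) :
    Matrix ((ι × Fock d N) ⊕ Unit) ((ι × Fock d N) ⊕ Unit) ℂ
  | .inr _, .inl y => if σ y.1 = l :: y.2.1 then 1 else 0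
  | .inl x, .inr _ => if σ x.1 = l.swap :: x.2.1 then 1 else 0
  | _, _ => 0

theorem fockMat_swap (l : Letter d) : fockMat ι N l.swap = (fockMat ι N l).conjTranspose := by
  ext x y
  rcases x with x | x <;> rcases y with y | y
  · have h : (x.1 = y.1 ∧ (x.2.1 = l.swap :: y.2.1 ∨ y.2.1 = l.swap.swap :: x.2.1)) ↔
        (y.1 = x.1 ∧ (y.2.1 = l :: x.2.1 ∨ x.2.1 = l.swap :: y.2.1)) := by
      rw [eq_comm, or_comm, Sum.swap_swap]
    by_cases h' : y.1 = x.1 ∧ (y.2.1 = l :: x.2.1 ∨ x.2.1 = l.swap :: y.2.1)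
    · simp only [fockMat, Matrix.conjTranspose_apply, if_pos h', if_pos (h.2 h'),
        star_one]
    · simp only [fockMat, Matrix.conjTranspose_apply, if_neg h',
        if_neg (mt h.1 h'), star_zero]
  all_goals simp [fockMat, Matrix.conjTranspose_apply]

theorem hopMat_swap (σ : ι → Word d) (l : Letter d) :
    hopMat σ N l.swap = (hopMat σ N l).conjTranspose := by
  ext x y
  rcases x with x | x <;> rcases y with y | y <;>
    simp [hopMat, Matrix.conjTranspose_apply, apply_ite]

variable [Fintype ι] [DecidableEq ι] [Fintype (Fock d N)] [DecidableEq (Fock d N)]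

/-- The Fock matrices do not couple the Fock copies with the extra dimension; only a hop can reach
it. -/
theorem wordProd_fockMat_inr (γ : Word d) (i : ι) :
    wordProd (fockMat ι N) γ (.inr ()) (.inl (i, Fock.vac)) = 0 := by
  cases γ with
  | nil => simp
  | cons l γ => simp [wordProd_cons, Matrix.mul_apply, fockMat]

theorem wordProd_fockMat_ne (γ : Word d) {i j : ι} (h : j ≠ i) (s : Fock d N) :
    wordProd (fockMat ι N) γ (.inl (j, s)) (.inl (i, Fock.vac)) = 0 := by
  induction γ generalizing s with
  | nil => simp [h]
  | cons l γ ih =>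
    simp only [wordProd_cons, Matrix.mul_apply, Fintype.sum_sum_type]
    rw [Finset.sum_eq_zero, Finset.sum_eq_zero, add_zero]
    · intro x _
      simp [fockMat]
    · rintro ⟨j', s'⟩ _
      by_cases hj : j = j'
      · subst hj; rw [ih, mul_zero]
      · simp [fockMat, hj]

/-- Each letter changes the length of the state by one. A word no longer than `s` can lead from the
vacuum to `s` only by creating at every step, and then it spells `s`. -/
theorem wordProd_fockMat_inl (γ : Word d) (i : ι) (s : Fock d N) (h : γ.length ≤ s.1.length) :
    wordProd (fockMat ι N) γ (.inl (i, s)) (.inl (i, Fock.vac)) = if s.1 = γ then 1 else 0 := by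
  induction γ generalizing s with
  | nil => simp [Matrix.one_apply, Fock.vac, Subtype.ext_iff]
  | cons l γ ih =>
    simp only [wordProd_cons, Matrix.mul_apply, Fintype.sum_sum_type]
    rw [Finset.sum_eq_zero (s := (Finset.univ : Finset Unit)) (by simp [fockMat]), add_zero]
    rw [List.length_cons] at h
    have key : ∀ y : ι × Fock d N, fockMat ι N l (.inl (i, s)) (.inl y) *
        wordProd (fockMat ι N) γ (.inl y) (.inl (i, Fock.vac)) =
        if y.1 = i ∧ y.2.1 = γ ∧ s.1 = l :: γ then 1 else 0 := by
      rintro ⟨j, s'⟩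
      by_cases hj : j = i
      swap
      · simp [hj, wordProd_fockMat_ne]
      subst hj
      by_cases h1 : s.1 = l :: s'.1
      · have : γ.length ≤ s'.1.length := by rw [h1] at h; simpa using h
        rw [ih _ this]
        simp only [fockMat, h1, true_or, and_true, true_and, if_true, one_mul, List.cons.injEq]
        simp
      -- If the last step annihilates, the state before it is longer than `s`, so the remaining word
      -- is too short to create it.
      · by_cases h2 : s'.1 = l.swap :: s.1
        · have h3 : s'.1.length = s.1.length + 1 := by rw [h2]; simp
          rw [ih _ (by omega), if_neg (by rintro rfl; omega), mul_zero, if_neg]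
          rintro ⟨-, h5, -⟩
          have h5 := congrArg List.length h5
          dsimp only at h5
          omega
        · simp only [fockMat, h1, h2, or_self, and_false, if_false, zero_mul, true_and]
          rw [if_neg]
          rintro ⟨rfl, h4⟩
          exact h1 h4
    rw [Finset.sum_congr rfl fun y _ => key y]
    by_cases hs : s.1 = l :: γ
    · have hN : γ.length ≤ N := by have := s.2; rw [hs] at this; simp at this; omega
      rw [if_pos hs, Finset.sum_eq_single (i, (⟨γ, hN⟩ : Fock d N))]
      · simp [hs]
      · rintro ⟨j, s'⟩ _ hne
        rw [if_neg]
        rintro ⟨rfl, h2, -⟩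
        exact hne (Prod.ext rfl (Subtype.ext h2))
      · simp
    · simp [hs]

variable {σ : ι → Word d}

/-- A single hop ends in the extra dimension, which the Fock matrices annihilate. Hence no Fock
component survives. -/
theorem wordDeriv_inl (ε : Bool) (γ : Word d) (i : ι) (x : ι × Fock d N) :
    wordDeriv (fockMat ι N) (hopMat σ N) ε γ (.inl x) (.inl (i, Fock.vac)) = 0 := by
  induction γ generalizing x with
  | nil => simp [wordDeriv]
  | cons l γ ih =>
    have h1 : (fockMat ι N l * wordDeriv (fockMat ι N) (hopMat σ N) ε γ) (.inl x)
        (.inl (i, Fock.vac)) = 0 := by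
      simp only [Matrix.mul_apply, Fintype.sum_sum_type, ih, mul_zero, Finset.sum_const_zero]
      simp [fockMat]
    have h2 : (hopMat σ N l * wordProd (fockMat ι N) γ) (.inl x) (.inl (i, Fock.vac)) = 0 := by
      simp only [Matrix.mul_apply, Fintype.sum_sum_type]
      simp [hopMat, wordProd_fockMat_inr]
    simp only [wordDeriv, Matrix.add_apply, h1, zero_add]
    split_ifs
    · exact h2
    · rfl

/-- The hop must be the last step, that is, the leftmost letter. The letters before it have to
create the tail of `σ i` from the vacuum, and the length bound leaves only the direct way of doing
so. -/
theorem wordDeriv_inr {ε : Bool} (γ : Word d) (i : ι) (hN : (σ i).length ≤ N)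
    (hσ : ∃ l s, σ i = l :: s ∧ l.isLeft = ε) (h : γ.length ≤ (σ i).length) :
    wordDeriv (fockMat ι N) (hopMat σ N) ε γ (.inr ()) (.inl (i, Fock.vac)) =
      if γ = σ i then 1 else 0 := by
  obtain ⟨l', s', hs', rfl⟩ := hσ
  cases γ with
  | nil => simp [wordDeriv, hs']
  | cons l γ =>
    have h1 : (fockMat ι N l * wordDeriv (fockMat ι N) (hopMat σ N) l'.isLeft γ) (.inr ())
        (.inl (i, Fock.vac)) = 0 := by
      simp only [Matrix.mul_apply, Fintype.sum_sum_type]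
      simp [fockMat]
    simp only [wordDeriv, Matrix.add_apply, h1, zero_add]
    have hlen : γ.length ≤ s'.length := by rw [hs'] at h; simpa using h
    have hN' : s'.length ≤ N := by rw [hs'] at hN; simp at hN; omega
    have h2 : (hopMat σ N l * wordProd (fockMat ι N) γ) (.inr ()) (.inl (i, Fock.vac)) =
        if l :: γ = σ i then 1 else 0 := by
      simp only [Matrix.mul_apply, Fintype.sum_sum_type]
      rw [Finset.sum_eq_zero (s := (Finset.univ : Finset Unit)) (by simp [hopMat]), add_zero,
        Finset.sum_eq_single (i, (⟨s', hN'⟩ : Fock d N))]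
      · rw [wordProd_fockMat_inl _ _ _ hlen]
        simp only [hopMat, hs', List.cons.injEq]
        by_cases ha : l' = l <;> by_cases hb : s' = γ <;> simp [ha, hb, eq_comm]
      · rintro ⟨j, s⟩ _ hne
        by_cases hj : j = i
        · subst hj
          simp only [hopMat, hs', List.cons.injEq]
          rw [if_neg, zero_mul]
          rintro ⟨-, h3⟩
          exact hne (Prod.ext rfl (Subtype.ext h3.symm))
        · rw [wordProd_fockMat_ne _ hj, mul_zero]
      · simp
    split_ifs with h3 h4 h4
    · rw [h2, if_pos h4]
    · rw [h2, if_neg h4]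
    · rw [hs'] at h4
      simp only [List.cons.injEq] at h4
      exact absurd (by rw [h4.1]) h3
    · rfl

/-- Read from right to left, a shortest walk spells `σ i` to reach the extra dimension, hops at once
to the tail of `σ j`, and annihilates letters until `s` is left; the second hop and the
annihilations spell `t^*`. Since all `σ i` start with letters of one type, the two hops use one
analytic and one coanalytic letter. General `s` is needed for the induction; the application is `s`
empty. -/
theorem wordHess_inl {ε : Bool} (hN : ∀ i, (σ i).length ≤ N)
    (hσ : ∀ i, ∃ l s, σ i = l :: s ∧ l.isLeft = ε) (γ : Word d) (i j : ι) (s : Fock d N)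
    (h : γ.length + s.1.length ≤ (σ j).length + (σ i).length) :
    wordHess (fockMat ι N) (hopMat σ N) γ (.inl (j, s)) (.inl (i, Fock.vac)) =
      open Classical in if ∃ t : Word d, t ≠ [] ∧ t ++ s.1 = σ j ∧ γ = t.adj ++ σ i then 1 else 0 := by
  classical
  induction γ generalizing s with
  | nil =>
    rw [if_neg]
    · simp [wordHess]
    · rintro ⟨t, -, -, ht⟩
      obtain ⟨l, s, hs, -⟩ := hσ i
      simp [hs] at ht
  | cons l γ ih =>
    rw [List.length_cons] at h
    have h2 : (hopMat σ N l * wordDeriv (fockMat ι N) (hopMat σ N) (!l.isLeft) γ) (.inl (j, s))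
        (.inl (i, Fock.vac)) = if σ j = l.swap :: s.1 ∧ γ = σ i then 1 else 0 := by
      simp only [Matrix.mul_apply, Fintype.sum_sum_type, wordDeriv_inl, mul_zero,
        Finset.sum_const_zero, zero_add, Finset.univ_unique, Finset.sum_singleton]
      by_cases h3 : σ j = l.swap :: s.1
      · have hl : (!l.isLeft) = ε := by
          obtain ⟨l', s', hs', rfl⟩ := hσ j
          rw [h3] at hs'
          simp only [List.cons.injEq] at hs'
          rw [← hs'.1]
          cases l <;> rfl
        rw [hl, show (default : Unit) = () from rfl, wordDeriv_inr _ _ (hN i) (hσ i)]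
        · simp [hopMat, h3]
        · have : (σ j).length = s.1.length + 1 := by rw [h3]; simp
          omega
      · simp [hopMat, h3]
    have h1 : (fockMat ι N l * wordHess (fockMat ι N) (hopMat σ N) γ) (.inl (j, s))
        (.inl (i, Fock.vac)) =
        if ∃ t : Word d, t ≠ [] ∧ t ++ (l.swap :: s.1) = σ j ∧ γ = t.adj ++ σ i then 1 else 0 := by
      simp only [Matrix.mul_apply, Fintype.sum_sum_type]
      rw [Finset.sum_eq_zero (s := (Finset.univ : Finset Unit)) (by simp [fockMat]), add_zero]
      have key : ∀ y : ι × Fock d N, fockMat ι N l (.inl (j, s)) (.inl y) *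
          wordHess (fockMat ι N) (hopMat σ N) γ (.inl y) (.inl (i, Fock.vac)) =
          if y.1 = j ∧ y.2.1 = l.swap :: s.1 ∧
            ∃ t : Word d, t ≠ [] ∧ t ++ (l.swap :: s.1) = σ j ∧ γ = t.adj ++ σ i then 1 else 0 := by
        rintro ⟨j', s'⟩
        by_cases hj : j' = j
        swap
        · simp [fockMat, hj, Ne.symm hj]
        subst hj
        by_cases h2 : s'.1 = l.swap :: s.1
        · have h3 : s'.1.length = s.1.length + 1 := by rw [h2]; simp
          rw [ih s' (by omega)]
          simp [fockMat, h2]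
        -- A final creation step would come from a shorter state `s'`, and the walk reaching `s'`
        -- would already exceed the length bound.
        · by_cases h1 : s.1 = l :: s'.1
          · have h3 : s.1.length = s'.1.length + 1 := by rw [h1]; simp
            rw [ih s' (by omega), if_neg, mul_zero, if_neg (by simp [h2])]
            rintro ⟨t, -, h4, h5⟩
            have h4 := congrArg List.length h4
            have h5 := congrArg List.length h5
            simp at h4 h5
            omega
          · simp [fockMat, h1, h2]
      rw [Finset.sum_congr rfl fun y _ => key y]
      by_cases hs : ∃ t : Word d, t ≠ [] ∧ t ++ (l.swap :: s.1) = σ j ∧ γ = t.adj ++ σ i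
      · have hN' : (l.swap :: s.1).length ≤ N := by
          obtain ⟨t, -, h4, -⟩ := hs
          have h4 := congrArg List.length h4
          have := hN j
          rw [List.length_append] at h4
          omega
        rw [if_pos hs, Finset.sum_eq_single (j, (⟨l.swap :: s.1, hN'⟩ : Fock d N))]
        · simp [hs]
        · rintro ⟨j, s'⟩ _ hne
          rw [if_neg]
          rintro ⟨rfl, h2, -⟩
          exact hne (Prod.ext rfl (Subtype.ext h2))
        · simp
      · simp [hs]
    simp only [wordHess, Matrix.add_apply, h1, h2]
    have hiff : (∃ t : Word d, t ≠ [] ∧ t ++ s.1 = σ j ∧ l :: γ = Word.adj t ++ σ i) ↔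
        ((∃ t : Word d, t ≠ [] ∧ t ++ (l.swap :: s.1) = σ j ∧ γ = Word.adj t ++ σ i) ∨
          (σ j = l.swap :: s.1 ∧ γ = σ i)) := by
      constructor
      · rintro ⟨t, h3, h4, h5⟩
        obtain ⟨t, l', rfl⟩ : ∃ t' l', t = t' ++ [l'] :=
          ⟨_, _, (List.dropLast_append_getLast h3).symm⟩
        rw [Word.adj_append] at h5
        simp only [Word.adj_cons, Word.adj_nil, List.nil_append, List.cons_append,
          List.cons.injEq] at h5
        obtain ⟨rfl, rfl⟩ := h5
        rw [List.append_assoc] at h4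
        rcases eq_or_ne t [] with rfl | ht
        · right
          simpa using h4.symm
        · left
          exact ⟨t, ht, by simpa using h4, rfl⟩
      · rintro (⟨t, h3, h4, rfl⟩ | ⟨h4, rfl⟩)
        · exact ⟨t ++ [l.swap], by simp, by simpa using h4, by simp [Word.adj_append, Word.adj_cons]⟩
        · exact ⟨[l.swap], by simp, by simpa using h4.symm, by simp [Word.adj_cons]⟩
    -- The last step is either an annihilation or the second hop, never both, so the two indicators
    -- add up to the indicator of the disjunction.
    have hex : ¬ ((∃ t : Word d, t ≠ [] ∧ t ++ (l.swap :: s.1) = σ j ∧ γ = Word.adj t ++ σ i) ∧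
          (σ j = l.swap :: s.1 ∧ γ = σ i)) := by
      rintro ⟨⟨t, h3, h4, -⟩, h5, -⟩
      rw [h5] at h4
      have h4 := congrArg List.length h4
      simp at h4
      exact h3 h4
    simp only [hiff]
    by_cases ha : ∃ t : Word d, t ≠ [] ∧ t ++ (l.swap :: s.1) = σ j ∧ γ = Word.adj t ++ σ i
    · have hb : ¬ (σ j = l.swap :: s.1 ∧ γ = σ i) := fun hb => hex ⟨ha, hb⟩
      rw [if_pos ha, if_neg hb, if_pos (Or.inl ha), add_zero]
    · rw [if_neg ha, zero_add]
      simp only [ha, false_or]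

theorem wordHess_vac {ε : Bool} (hN : ∀ i, (σ i).length ≤ N)
    (hσ : ∀ i, ∃ l s, σ i = l :: s ∧ l.isLeft = ε) (γ : Word d) (i j : ι)
    (h : γ.length ≤ (σ j).length + (σ i).length) :
    wordHess (fockMat ι N) (hopMat σ N) γ (.inl (j, Fock.vac)) (.inl (i, Fock.vac)) =
      if γ = (σ j).adj ++ σ i then 1 else 0 := by
  rw [wordHess_inl hN hσ γ i j Fock.vac (by simpa [Fock.vac] using h)]
  congr 1
  obtain ⟨l, s, hs, -⟩ := hσ j
  simp only [Fock.vac, List.append_nil, eq_iff_iff]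
  constructor
  · rintro ⟨t, -, rfl, rfl⟩
    rfl
  · rintro rfl
    exact ⟨σ j, by simp [hs], rfl, rfl⟩

end Fock

/-- The tuple of matrices with prescribed values of the letters. -/
def tupleOf {V : Type*} [Fintype V] [DecidableEq V] (e : V ≃ Fin n) (A : Letter d → Matrix V V ℂ) :
    MatTuple d n := fun i => Matrix.reindexAlgEquiv ℂ ℂ e (A (.inl i))

theorem letters_tupleOf {V : Type*} [Fintype V] [DecidableEq V] (e : V ≃ Fin n)
    {A : Letter d → Matrix V V ℂ} (hA : ∀ l, A l.swap = (A l).conjTranspose) :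
    letters (tupleOf e A) = fun l => (Matrix.reindexAlgEquiv ℂ ℂ e : _ →+* _) (A l) := by
  ext1 l
  cases l with
  | inl i => rfl
  | inr i =>
    have := hA (.inl i)
    simp only [Sum.swap_inl] at this
    rw [this]
    rfl

/-! ### Cauchy products and uniqueness of coefficients -/

section Cauchy

variable {E F G : Type*} [NormedAddCommGroup E] [NormedSpace ℂ E]
  [NormedAddCommGroup F] [NormedSpace ℂ F] [NormedAddCommGroup G] [NormedSpace ℂ G]

theorem hasSum_sum_antidiagonal_comp [CompleteSpace F] [CompleteSpace G]
    {f : ℕ → F →L[ℂ] G} {g : ℕ → E →L[ℂ] F}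
    (hf : Summable fun k => ‖f k‖) (hg : Summable fun k => ‖g k‖) :
    HasSum (fun k => ∑ p ∈ Finset.HasAntidiagonal.antidiagonal k, f p.1 ∘L g p.2)
      ((∑' k, f k) ∘L ∑' k, g k) := by
  have hs : Summable fun p : ℕ × ℕ => f p.1 ∘L g p.2 :=
    .of_norm_bounded (hf.mul_of_nonneg hg (fun _ => norm_nonneg _) fun _ => norm_nonneg _)
      fun p => ContinuousLinearMap.opNorm_comp_le _ _
  have h1 : ∑' p : ℕ × ℕ, f p.1 ∘L g p.2 = (∑' k, f k) ∘L ∑' k, g k := by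
    refine (hs.hasSum.prod_fiberwise fun i => ?_).unique
      (((ContinuousLinearMap.compL ℂ E F G).flip (∑' k, g k)).hasSum hf.of_norm.hasSum)
    exact (ContinuousLinearMap.compL ℂ E F G (f i)).hasSum hg.of_norm.hasSum
  rw [← h1]
  have h2 := (Finset.HasAntidiagonal.sigmaAntidiagonalEquivProd.hasSum_iff.2 hs.hasSum).sigma
    fun k => hasSum_fintype _
  refine h2.congr_fun fun k => ?_
  exact (Finset.sum_coe_sort (Finset.HasAntidiagonal.antidiagonal k)
    fun p => f p.1 ∘L g p.2).symm

end Cauchy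

section PowerSeries

variable {V : Type*} [NormedAddCommGroup V] [NormedSpace ℝ V]

/-- The power series in one real variable with given coefficients. -/
def powSeries (A : ℕ → V) : FormalMultilinearSeries ℝ ℝ V :=
  fun k => ContinuousMultilinearMap.mkPiRing ℝ (Fin k) (A k)

theorem coeff_powSeries (A : ℕ → V) (k : ℕ) : (powSeries A).coeff k = A k := by
  simp [powSeries, FormalMultilinearSeries.coeff]

theorem hasFPowerSeriesAt_powSeries {A : ℕ → V} {y : ℝ → V}
    (h : ∀ᶠ t in 𝓝 (0 : ℝ), HasSum (fun k => t ^ k • A k) (y t)) :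
    HasFPowerSeriesAt y (powSeries A) 0 := by
  rw [hasFPowerSeriesAt_iff]
  simpa [coeff_powSeries] using h

theorem eq_of_hasSum_pow {A B : ℕ → V} {y : ℝ → V}
    (hA : ∀ᶠ t in 𝓝 (0 : ℝ), HasSum (fun k => t ^ k • A k) (y t))
    (hB : ∀ᶠ t in 𝓝 (0 : ℝ), HasSum (fun k => t ^ k • B k) (y t)) : A = B := by
  have := (hasFPowerSeriesAt_powSeries hA).eq_formalMultilinearSeries
    (hasFPowerSeriesAt_powSeries hB)
  ext k
  rw [← coeff_powSeries A, this, coeff_powSeries]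

end PowerSeries

section Uniqueness

variable {E F : Type*} [NormedAddCommGroup E] [InnerProductSpace ℂ E]
  [NormedAddCommGroup F] [InnerProductSpace ℂ F]

/-- At the Fock matrices the entry from the vacuum to the state `s`, taken in degree `|s|`, is
nonzero only for the word `s`. Evaluating there reads off the coefficient of `s`. -/
theorem eq_of_homPart_eq {a b : Word d → E →L[ℂ] F}
    (h : ∀ (n k : ℕ) (Z : MatTuple d n), homPart a k Z = homPart b k Z) : a = b := by
  classical
  ext s w
  let _ : Fintype (Fock d s.length) := Fintype.ofFinite _
  let V := (Unit × Fock d s.length) ⊕ Unit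
  let e : V ≃ Fin (Fintype.card V) := Fintype.equivFin V
  have key : ∀ c : Word d → E →L[ℂ] F,
      homPart c s.length (tupleOf e (fockMat Unit s.length))
        (WithLp.toLp 2 (Pi.single (e (.inl ((), Fock.vac))) w))
        (e (.inl ((), ⟨s, le_rfl⟩))) = c s w := by
    intro c
    simp only [homPart, sum_apply, WithLp.ofLp_sum, Finset.sum_apply,
      tens_apply]
    have hw : ∀ γ : Word d, wordEval (tupleOf e (fockMat Unit s.length)) γ =
        Matrix.reindexAlgEquiv ℂ ℂ e (wordProd (fockMat Unit s.length) γ) := fun γ => by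
      rw [← wordProd_letters, letters_tupleOf e fockMat_swap, ← map_wordProd]
      rfl
    have h1 : ∀ α : Fin s.length → Letter d,
        (∑ j, wordEval (tupleOf e (fockMat Unit s.length)) (List.ofFn α)
          (e (.inl ((), ⟨s, le_rfl⟩))) j •
          c (List.ofFn α) ((WithLp.toLp 2 (Pi.single (e (.inl ((), Fock.vac))) w) :
            Amp (Fintype.card V) E) j)) =
        if α = s.get then c s w else 0 := by
      intro α
      rw [Finset.sum_eq_single (e (.inl ((), Fock.vac)))]
      · rw [hw]
        simp only [Matrix.coe_reindexAlgEquiv, Matrix.reindex_apply, Matrix.submatrix_apply,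
          Equiv.symm_apply_apply, Pi.single_eq_same]
        rw [wordProd_fockMat_inl _ _ _ (by simp)]
        by_cases hα : α = s.get
        · have : List.ofFn α = s := by rw [hα, List.ofFn_get]
          simp [hα]
        · rw [if_neg hα, if_neg, zero_smul]
          intro hs
          apply hα
          apply List.ofFn_injective
          rw [← hs, List.ofFn_get]
      · intro j _ hj
        simp [Pi.single_eq_of_ne hj]
      · simp
    rw [Finset.sum_congr rfl fun α _ => h1 α]
    simp
  rw [← key a, ← key b, h]

/-- On a ray `t • Z` the homogeneous parts are the coefficients of a power series in the real
variable `t`, so they are determined by its values near `0`. Agreement along each ray suffices, with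
no uniformity in `Z` or `n`. -/
theorem eq_of_hasSum_homPart {a b : Word d → E →L[ℂ] F}
    (h : ∀ (n : ℕ) (Z : MatTuple d n), ∀ᶠ t in 𝓝 (0 : ℝ), ∃ y,
      HasSum (fun k => homPart a k (t • Z)) y ∧ HasSum (fun k => homPart b k (t • Z)) y) :
    a = b := by
  refine eq_of_homPart_eq fun n k Z => ?_
  have h1 : ∀ᶠ t in 𝓝 (0 : ℝ), HasSum (fun k => t ^ k • homPart a k Z) (ncEval a (t • Z)) := by
    filter_upwards [h n Z] with t ⟨y, h1, _⟩
    simp only [homPart_smul] at h1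
    simpa only [ncEval, homPart_smul] using h1.summable.hasSum
  have h2 : ∀ᶠ t in 𝓝 (0 : ℝ), HasSum (fun k => t ^ k • homPart b k Z) (ncEval a (t • Z)) := by
    filter_upwards [h n Z] with t ⟨y, h1, h2⟩
    rw [ncEval, h1.tsum_eq]
    simpa only [homPart_smul] using h2
  exact congrFun (eq_of_hasSum_pow h1 h2) k

end Uniqueness

/-! ### Evaluating the realization formula -/

section Realization

variable {E F G : Type*} [NormedAddCommGroup E] [InnerProductSpace ℂ E]
  [NormedAddCommGroup F] [InnerProductSpace ℂ F] [NormedAddCommGroup G] [InnerProductSpace ℂ G]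

theorem hasSum_homPart_conv [CompleteSpace F] [CompleteSpace G] {a : Word d → F →L[ℂ] G}
    {b : Word d → E →L[ℂ] F} {Z : MatTuple d n} (ha : Summable fun k => ‖homPart a k Z‖)
    (hb : Summable fun k => ‖homPart b k Z‖) :
    HasSum (fun k => homPart (conv a b) k Z) (ncEval a Z ∘L ncEval b Z) := by
  have := hasSum_sum_antidiagonal_comp ha hb
  simp only [homPart_conv]
  exact this

theorem hasSum_homPart [CompleteSpace F] {a : Word d → E →L[ℂ] F} {Z : MatTuple d n}
    (h : Summable fun k => ‖homPart a k Z‖) : HasSum (fun k => homPart a k Z) (ncEval a Z) :=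
  h.of_norm.hasSum

theorem col_apply (v : E →L[ℂ] F) (w : E →L[ℂ] G) (x : E) :
    col v w x = WithLp.toLp 2 (v x, w x) := rfl

variable [CompleteSpace E] [CompleteSpace F]

theorem norm_homPart_adjSeries (a : Word d → E →L[ℂ] F) (k : ℕ) (Z : MatTuple d n) :
    ‖homPart (adjSeries a) k Z‖ = ‖homPart a k Z‖ := by
  rw [← adjoint_homPart]
  exact LinearIsometryEquiv.norm_map _ _

theorem hasSum_homPart_adjSeries {a : Word d → E →L[ℂ] F} {Z : MatTuple d n}
    {y : Amp n E →L[ℂ] Amp n F}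
    (h : HasSum (fun k => homPart a k Z) y) :
    HasSum (fun k => homPart (adjSeries a) k Z) y.adjoint := by
  simp only [← adjoint_homPart]
  exact h.map (ContinuousLinearMap.adjoint (𝕜 := ℂ) (E := Amp n E) (F := Amp n F))
    (LinearIsometryEquiv.continuous _)

theorem ncEval_adjSeries {a : Word d → E →L[ℂ] F} {Z : MatTuple d n}
    (h : Summable fun k => ‖homPart a k Z‖) :
    ncEval (adjSeries a) Z = (ncEval a Z).adjoint :=
  (hasSum_homPart_adjSeries (hasSum_homPart h)).tsum_eq

variable [CompleteSpace G]

/-- The series `Re g + (v⁺)^* x⁺ + (v⁻)^* x⁻`. -/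
def formalRealize (g : Word d → E →L[ℂ] E) (vp xp : Word d → E →L[ℂ] F)
    (vm xm : Word d → E →L[ℂ] G) : Word d → E →L[ℂ] E :=
  (2 : ℂ)⁻¹ • (g + adjSeries g) + (conv (adjSeries vp) xp + conv (adjSeries vm) xm)

theorem adjoint_col_comp_col (v x : E →L[ℂ] F) (w y : E →L[ℂ] G) :
    (col v w).adjoint ∘L col x y = v.adjoint ∘L x + w.adjoint ∘L y := by
  ext e
  refine ext_inner_right ℂ fun e' => ?_
  simp [ContinuousLinearMap.adjoint_inner_left, inner_add_left, col_apply,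
    WithLp.prod_inner_apply]

theorem blockOp_apply (T : G →L[ℂ] F) (z : WithLp 2 (F × G)) :
    blockOp T z = WithLp.toLp 2 (z.fst - T z.snd, z.snd - T.adjoint z.fst) := rfl

/-- The two equations say that the column `[x; y]` solves the block system with right side `[v; w]`.
The inverse is thereby evaluated without being expanded. -/
theorem realize_eq {g : E →L[ℂ] E} {v x : E →L[ℂ] F} {w y : E →L[ℂ] G} {T : G →L[ℂ] F}
    (hT : IsUnit (blockOp T)) (hx : x = v + T ∘L y) (hy : y = w + T.adjoint ∘L x) :
    realize g v w T = (2 : ℂ)⁻¹ • (g + g.adjoint) + (v.adjoint ∘L x + w.adjoint ∘L y) := by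
  have h1 : blockOp T ∘L col x y = col v w := by
    ext1 e
    rw [ContinuousLinearMap.comp_apply, blockOp_apply, col_apply, col_apply]
    congr 2
    · nth_rw 1 [hx]
      simp
    · nth_rw 1 [hy]
      simp
  have h2 : Ring.inverse (blockOp T) ∘L col v w = col x y := by
    rw [← h1, ← ContinuousLinearMap.comp_assoc, ← ContinuousLinearMap.mul_def,
      Ring.inverse_mul_cancel _ hT]
    rfl
  rw [realize, h2, adjoint_col_comp_col]

/-- The off-diagonal part, with entries `T` and `T^*`, has norm at most `‖T‖`; a Neumann series
inverts the rest. -/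
theorem isUnit_blockOp {T : G →L[ℂ] F} (h : ‖T‖ < 1) : IsUnit (blockOp T) := by
  have h1 : blockOp T = 1 - (1 - blockOp T) := by abel
  rw [h1]
  refine isUnit_one_sub_of_norm_lt_one (lt_of_le_of_lt ?_ h)
  refine ContinuousLinearMap.opNorm_le_bound _ (norm_nonneg _) fun z => ?_
  have h2 : (1 - blockOp T) z = WithLp.toLp 2 (T z.snd, T.adjoint z.fst) := by
    rw [sub_apply, blockOp_apply]
    simp only [WithLp.ext_iff]
    ext <;> simp
  rw [h2]
  refine le_of_sq_le_sq ?_ (by positivity)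
  rw [mul_pow, WithLp.prod_norm_sq_eq_of_L2, WithLp.prod_norm_sq_eq_of_L2]
  have h3 := T.le_opNorm z.snd
  have h4 := T.adjoint.le_opNorm z.fst
  rw [LinearIsometryEquiv.norm_map] at h4
  have h5 := pow_le_pow_left₀ (norm_nonneg _) h3 2
  have h6 := pow_le_pow_left₀ (norm_nonneg _) h4 2
  simp only [mul_pow] at h5 h6
  change ‖T z.snd‖ ^ 2 + ‖T.adjoint z.fst‖ ^ 2 ≤ _
  linarith

theorem hasSum_homPart_formalRealize {g : Word d → E →L[ℂ] E} {vp xp : Word d → E →L[ℂ] F}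
    {vm xm : Word d → E →L[ℂ] G} {T : Word d → G →L[ℂ] F} {Z : MatTuple d n}
    (hxp : xp = vp + conv T xm) (hxm : xm = vm + conv (adjSeries T) xp)
    (sg : Summable fun k => ‖homPart g k Z‖) (sT : Summable fun k => ‖homPart T k Z‖)
    (svp : Summable fun k => ‖homPart vp k Z‖) (svm : Summable fun k => ‖homPart vm k Z‖)
    (sxp : Summable fun k => ‖homPart xp k Z‖) (sxm : Summable fun k => ‖homPart xm k Z‖)
    (hT : IsUnit (blockOp (ncEval T Z))) :
    HasSum (fun k => homPart (formalRealize g vp xp vm xm) k Z)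
      (realize (ncEval g Z) (ncEval vp Z) (ncEval vm Z) (ncEval T Z)) := by
  have aT : Summable fun k => ‖homPart (adjSeries T) k Z‖ := by
    simpa only [norm_homPart_adjSeries] using sT
  have avp : Summable fun k => ‖homPart (adjSeries vp) k Z‖ := by
    simpa only [norm_homPart_adjSeries] using svp
  have avm : Summable fun k => ‖homPart (adjSeries vm) k Z‖ := by
    simpa only [norm_homPart_adjSeries] using svm
  have h1 : ncEval xp Z = ncEval vp Z + ncEval T Z ∘L ncEval xm Z := by
    have := (hasSum_homPart svp).add (hasSum_homPart_conv sT sxm)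
    simp only [← homPart_add, ← hxp] at this
    exact this.tsum_eq
  have h2 : ncEval xm Z = ncEval vm Z + (ncEval T Z).adjoint ∘L ncEval xp Z := by
    have := (hasSum_homPart svm).add (hasSum_homPart_conv aT sxp)
    simp only [← homPart_add, ← hxm] at this
    rw [← ncEval_adjSeries sT]
    exact this.tsum_eq
  rw [realize_eq hT h1 h2, ← ncEval_adjSeries svp, ← ncEval_adjSeries svm]
  have h3 := (((hasSum_homPart sg).add (hasSum_homPart_adjSeries (hasSum_homPart sg))).const_smul
    (2 : ℂ)⁻¹).add ((hasSum_homPart_conv avp sxp).add (hasSum_homPart_conv avm sxm))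
  simpa only [formalRealize, homPart_add, homPart_const_smul] using h3

end Realization

/-! ### Analyticity and the complex Hessian of a noncommutative power series -/

section Analytic

variable {E F : Type*} [NormedAddCommGroup E] [InnerProductSpace ℂ E]
  [NormedAddCommGroup F] [InnerProductSpace ℂ F] [CompleteSpace F]

/-- The value of a letter, as a real linear function of the tuple of matrices. -/
def lettersCLM (n : ℕ) (l : Letter d) : MatTuple d n →L[ℝ] Matrix (Fin n) (Fin n) ℂ :=
  LinearMap.mkContinuous
    { toFun := fun Z => letters Z l
      map_add' := fun Z W => letters_add Z W l
      map_smul' := fun t Z => letters_smul t Z l } 1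
    fun Z => by simpa using norm_letters_le Z l

theorem lettersCLM_apply (l : Letter d) (Z : MatTuple d n) : lettersCLM n l Z = letters Z l := rfl

/-- The operator `A ⊗ a` as a bounded real linear function of `A`. -/
def tensCLM (n : ℕ) (a : E →L[ℂ] F) :
    Matrix (Fin n) (Fin n) ℂ →L[ℝ] (Amp n E →L[ℂ] Amp n F) :=
  LinearMap.mkContinuous
    { toFun := fun A => tens A a
      map_add' := fun A B => tens_add_left A B a
      map_smul' := fun t A => tens_real_smul_left t A a } ‖a‖
    fun A => by simpa [mul_comm] using norm_tens_le A a

theorem tensCLM_apply (a : E →L[ℂ] F) (A : Matrix (Fin n) (Fin n) ℂ) :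
    tensCLM n a A = tens A a := rfl

/-- The real multilinear map whose restriction to the diagonal is the homogeneous part of
degree `k`. -/
def homMulti (a : Word d → E →L[ℂ] F) (n : ℕ) :
    FormalMultilinearSeries ℝ (MatTuple d n) (Amp n E →L[ℂ] Amp n F) := fun k =>
  ∑ α : Fin k → Letter d, (tensCLM n (a (List.ofFn α))).compContinuousMultilinearMap
    ((ContinuousMultilinearMap.mkPiAlgebraFin ℝ k (Matrix (Fin n) (Fin n) ℂ)).compContinuousLinearMap
      fun i => lettersCLM n (α i))

theorem homMulti_apply (a : Word d → E →L[ℂ] F) (k : ℕ) (m : Fin k → MatTuple d n) :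
    homMulti a n k m = ∑ α : Fin k → Letter d,
      tens (List.ofFn fun i => letters (m i) (α i)).prod (a (List.ofFn α)) := by
  simp [homMulti, tensCLM_apply, lettersCLM_apply]

theorem homMulti_diag (a : Word d → E →L[ℂ] F) (k : ℕ) (Z : MatTuple d n) :
    (homMulti a n k fun _ => Z) = homPart a k Z := by
  rw [homMulti_apply, homPart]
  refine Finset.sum_congr rfl fun α _ => ?_
  rw [← wordProd_letters, wordProd, List.map_ofFn]
  rfl

theorem norm_prod_ofFn_letters_le {k : ℕ} (m : Fin k → MatTuple d n) (α : Fin k → Letter d) :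
    ‖(List.ofFn fun i => letters (m i) (α i)).prod‖ ≤ ∏ i, ‖m i‖ := by
  have h := (ContinuousMultilinearMap.mkPiAlgebraFin ℝ k (Matrix (Fin n) (Fin n) ℂ)).le_opNorm
    fun i => letters (m i) (α i)
  rw [ContinuousMultilinearMap.mkPiAlgebraFin_apply] at h
  refine h.trans ?_
  have h1 : ‖ContinuousMultilinearMap.mkPiAlgebraFin ℝ k (Matrix (Fin n) (Fin n) ℂ)‖ ≤ 1 :=
    ContinuousMultilinearMap.norm_mkPiAlgebraFin_le.trans (max_le le_rfl norm_one_matrix_le)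
  calc _ ≤ 1 * ∏ i, ‖letters (m i) (α i)‖ := by gcongr
    _ ≤ _ := by
      rw [one_mul]
      exact Finset.prod_le_prod (fun _ _ => norm_nonneg _) fun i _ => norm_letters_le _ _

theorem GrowthBound.norm_homMulti_le {a : Word d → E →L[ℂ] F} {M R : ℝ} (hM : 0 ≤ M)
    (hR : 0 ≤ R) (h : GrowthBound a M R) (k : ℕ) : ‖homMulti a n k‖ ≤ M * (2 * d * R) ^ k := by
  refine ContinuousMultilinearMap.opNorm_le_bound (by positivity) fun m => ?_
  rw [homMulti_apply]
  have h1 : ∀ α : Fin k → Letter d, ‖tens (List.ofFn fun i => letters (m i) (α i)).prod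
      (a (List.ofFn α))‖ ≤ (∏ i, ‖m i‖) * (M * R ^ k) := fun α => by
    refine (NCPsh.norm_tens_le _ _).trans (mul_le_mul (norm_prod_ofFn_letters_le m α) ?_
      (norm_nonneg _) (Finset.prod_nonneg fun _ _ => norm_nonneg _))
    simpa using h (List.ofFn α)
  refine (norm_sum_le_of_le _ fun α _ => h1 α).trans_eq ?_
  simp [← two_mul]
  ring

/-- Real analyticity of the value function lets the Laplacian in the definition of the Hessian be
read off from Taylor coefficients. -/
theorem GrowthBound.hasFPowerSeriesOnBall {a : Word d → E →L[ℂ] F} {M R : ℝ} (hM : 0 ≤ M)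
    (hR : 0 ≤ R) (h : GrowthBound a M R) {r : NNReal} (hr : 0 < r) (hr1 : 2 * d * R * r < 1) :
    HasFPowerSeriesOnBall (fun Z : MatTuple d n => ncEval a Z) (homMulti a n) 0 r where
  r_le := by
    refine FormalMultilinearSeries.le_radius_of_bound _ M fun k => ?_
    calc _ ≤ M * (2 * d * R) ^ k * r ^ k := by gcongr; exact h.norm_homMulti_le hM hR k
      _ = M * (2 * d * R * r) ^ k := by ring
      _ ≤ M * 1 := by gcongr; exact pow_le_one₀ (by positivity) hr1.le
      _ = M := mul_one M
  r_pos := by simpa using hr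
  hasSum := by
    intro y hy
    simp only [zero_add, homMulti_diag]
    have hy' : ‖y‖ < r := by simpa using hy
    refine hasSum_homPart (h.summable_norm_homPart hR (lt_of_le_of_lt ?_ hr1))
    gcongr

end Analytic

/-! ### Taylor coefficients of words along real lines -/

section Taylor

variable {A : Type*} [Ring A]

/-- The coefficient of `t ^ m` in the value of a word at `X + t Y`. -/
def wordTaylor (X Y : Letter d → A) : ℕ → Word d → A
  | 0, [] => 1
  | _ + 1, [] => 0
  | 0, l :: α => X l * wordTaylor X Y 0 α
  | m + 1, l :: α => X l * wordTaylor X Y (m + 1) α + Y l * wordTaylor X Y m α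

theorem wordTaylor_zero (X Y : Letter d → A) (α : Word d) :
    wordTaylor X Y 0 α = wordProd X α := by
  induction α with
  | nil => rfl
  | cons l α ih => rw [wordTaylor, ih, wordProd_cons]

theorem wordTaylor_one (X Y : Letter d → A) (α : Word d) :
    wordTaylor X Y 1 α = wordDeriv X Y true α + wordDeriv X Y false α := by
  induction α with
  | nil => simp [wordTaylor, wordDeriv]
  | cons l α ih =>
    cases l <;> simp [wordTaylor, wordDeriv, ih, wordTaylor_zero, mul_add] <;> abel

theorem wordTaylor_one_I [Algebra ℂ A] (X : Letter d → A) {Y Y' : Letter d → A}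
    (h : ∀ l, Y' l = (if l.isLeft then Complex.I else -Complex.I) • Y l) (α : Word d) :
    wordTaylor X Y' 1 α = Complex.I • wordDeriv X Y true α - Complex.I • wordDeriv X Y false α := by
  induction α with
  | nil => simp [wordTaylor, wordDeriv]
  | cons l α ih =>
    cases l <;> simp [wordTaylor, wordDeriv, ih, wordTaylor_zero, mul_sub, h] <;> abel

/-- Multiplying the direction by `I` multiplies a replaced pair of letters by `I * I = -1` or `(-I)
* (-I) = -1` if they have the same type, and by `I * (-I) = 1` if they are mixed. In the sum the
pairs of equal type cancel and the mixed ones double. -/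
theorem wordTaylor_two_add [Algebra ℂ A] (X : Letter d → A) {Y Y' : Letter d → A}
    (h : ∀ l, Y' l = (if l.isLeft then Complex.I else -Complex.I) • Y l) (α : Word d) :
    wordTaylor X Y 2 α + wordTaylor X Y' 2 α = (2 : ℂ) • wordHess X Y α := by
  induction α with
  | nil => simp [wordTaylor, wordHess]
  | cons l α ih =>
    rw [wordHess, smul_add, ← mul_smul_comm, ← ih]
    cases l <;> simp [wordTaylor, wordTaylor_one_I X h, wordTaylor_one, mul_sub, mul_add,
      smul_smul, two_smul, h] <;> abel

theorem hasSum_wordTaylor {A : Type*} [NormedRing A] [NormedAlgebra ℝ A] (X Y : Letter d → A)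
    (t : ℝ) (α : Word d) :
    HasSum (fun m => t ^ m • wordTaylor X Y m α) (wordProd (fun l => X l + t • Y l) α) := by
  induction α with
  | nil =>
    refine (hasSum_ite_eq (0 : ℕ) (1 : A)).congr_fun fun m => ?_
    cases m <;> simp [wordTaylor]
  | cons l α ih =>
    have h1 := ih.mul_left (X l)
    have h2 : HasSum (fun m => t ^ m • (match m with
        | 0 => 0
        | m + 1 => Y l * wordTaylor X Y m α)) (t • (Y l * wordProd (fun l => X l + t • Y l) α)) := by
      rw [← hasSum_nat_add_iff' 1]
      simp only [Finset.range_one, Finset.sum_singleton, smul_zero, sub_zero]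
      refine ((ih.mul_left (Y l)).const_smul t).congr_fun fun m => ?_
      rw [mul_smul_comm, smul_smul, pow_succ']
    rw [wordProd_cons, add_mul, smul_mul_assoc]
    refine (h1.add h2).congr_fun fun m => ?_
    cases m with
    | zero => simp [wordTaylor]
    | succ m => simp [wordTaylor, smul_add]

theorem norm_wordTaylor_le {A : Type*} [NormedRing A] (h1 : ‖(1 : A)‖ ≤ 1) {X Y : Letter d → A}
    {ρ : ℝ} (hX : ∀ l, ‖X l‖ ≤ ρ) (hY : ∀ l, ‖Y l‖ ≤ ρ) (m : ℕ) (α : Word d) :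
    ‖wordTaylor X Y m α‖ ≤ α.length.choose m * ρ ^ α.length := by
  induction α generalizing m with
  | nil => cases m <;> simp [wordTaylor, h1]
  | cons l α ih =>
    have hρ : 0 ≤ ρ := (norm_nonneg _).trans (hX l)
    have hle : ∀ (x y : A) (b : ℝ), ‖x‖ ≤ ρ → ‖y‖ ≤ b → ‖x * y‖ ≤ ρ * b := fun x y b hx hy =>
      (norm_mul_le _ _).trans (mul_le_mul hx hy (norm_nonneg _) hρ)
    cases m with
    | zero =>
      refine (hle _ _ _ (hX l) (ih 0)).trans_eq ?_
      simp [pow_succ']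
    | succ m =>
      refine (norm_add_le_of_le (hle _ _ _ (hX l) (ih (m + 1))) (hle _ _ _ (hY l) (ih m))).trans_eq
        ?_
      rw [List.length_cons, Nat.choose_succ_succ, pow_succ']
      push_cast
      ring

end Taylor

/-! ### The complex Hessian of a series as a sum over words -/

section Hessian

variable {E F : Type*} [NormedAddCommGroup E] [InnerProductSpace ℂ E]
  [NormedAddCommGroup F] [InnerProductSpace ℂ F] [CompleteSpace F]

/-- The term of order `m` of a word of length `k` contains `k.choose m` products, and these numbers
add up to `2 ^ k`. This is the reason for the extra factor `2` in `hρ`. Absolute summability in both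
indices allows summing by words or by order. -/
theorem GrowthBound.summable_taylor {a : Word d → E →L[ℂ] F} {M R ρ : ℝ} (hM : 0 ≤ M)
    (hR : 0 ≤ R) (h : GrowthBound a M R) (hρ : 2 * d * (2 * R * ρ) < 1) {Z W : MatTuple d n}
    (hZ : ‖Z‖ ≤ ρ) (hW : ‖W‖ ≤ ρ) {t : ℝ} (ht : |t| ≤ 1) :
    Summable fun p : Word d × ℕ =>
      t ^ p.2 • tens (wordTaylor (letters Z) (letters W) p.2 p.1) (a p.1) := by
  have hρ0 : 0 ≤ ρ := (norm_nonneg _).trans hZ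
  have hb : Summable fun p : Word d × ℕ =>
      (p.1.length.choose p.2 : ℝ) * (M * (R * ρ) ^ p.1.length) := by
    rw [summable_prod_of_nonneg fun _ => by positivity]
    have hsum : ∀ α : Word d, HasSum (fun m => (α.length.choose m : ℝ) *
        (M * (R * ρ) ^ α.length)) (M * (2 * R * ρ) ^ α.length) := fun α => by
      have hz : ∀ m ∉ Finset.range (α.length + 1), (α.length.choose m : ℝ) = 0 := fun m hm => by
        rw [Nat.choose_eq_zero_of_lt (by have := Finset.mem_range.not.1 hm; omega), Nat.cast_zero]
      have : HasSum _ _ := hasSum_sum_of_ne_finset_zero hz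
      rw [← Nat.cast_sum, Nat.sum_range_choose] at this
      have h2 := this.mul_right (M * (R * ρ) ^ α.length)
      push_cast at h2
      rwa [show (2 : ℝ) ^ α.length * (M * (R * ρ) ^ α.length) = M * (2 * R * ρ) ^ α.length by
        ring] at h2
    refine ⟨fun α => (hsum α).summable, ?_⟩
    simp only [fun α => (hsum α).tsum_eq]
    exact (summable_word_pow (by positivity) hρ).mul_left M
  refine .of_norm_bounded hb fun p => ?_
  rw [norm_smul, norm_pow, Real.norm_eq_abs]
  have h2 := norm_wordTaylor_le norm_one_matrix_le (fun l => (norm_letters_le Z l).trans hZ)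
    (fun l => (norm_letters_le W l).trans hW) p.2 p.1
  calc _ ≤ 1 * ((p.1.length.choose p.2 * ρ ^ p.1.length) * (M * R ^ p.1.length)) := by
        refine mul_le_mul (pow_le_one₀ (abs_nonneg _) ht) ?_ (norm_nonneg _) zero_le_one
        exact (NCPsh.norm_tens_le _ _).trans (mul_le_mul h2 (h p.1) (norm_nonneg _) (by positivity))
    _ = _ := by ring

/-- The coefficient of `t ^ m` in the value of a series at `Z + t W`. -/
def ncTaylor (a : Word d → E →L[ℂ] F) (Z W : MatTuple d n) (m : ℕ) : Amp n E →L[ℂ] Amp n F :=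
  ∑' α : Word d, tens (wordTaylor (letters Z) (letters W) m α) (a α)

theorem GrowthBound.hasSum_ncTaylor {a : Word d → E →L[ℂ] F} {M R ρ : ℝ} (hM : 0 ≤ M)
    (hR : 0 ≤ R) (h : GrowthBound a M R) (hρ : 2 * d * (2 * R * ρ) < 1) {Z W : MatTuple d n}
    (hZ : ‖Z‖ ≤ ρ) (hW : ‖W‖ ≤ ρ) (m : ℕ) :
    HasSum (fun α : Word d => tens (wordTaylor (letters Z) (letters W) m α) (a α))
      (ncTaylor a Z W m) := by
  have := ((h.summable_taylor hM hR hρ hZ hW (t := 1) (by simp)).prod_symm).prod_factor m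
  simp only [Prod.snd_swap, Prod.fst_swap, one_pow, one_smul] at this
  exact this.hasSum

theorem GrowthBound.hasSum_pow_ncTaylor {a : Word d → E →L[ℂ] F} {M R ρ : ℝ} (hM : 0 ≤ M)
    (hR : 0 ≤ R) (h : GrowthBound a M R) (hρ : 2 * d * (2 * R * ρ) < 1) {Z W : MatTuple d n}
    (hZ : ‖Z‖ ≤ ρ) (hW : ‖W‖ ≤ ρ) {t : ℝ} (ht : |t| ≤ 1) :
    HasSum (fun m => t ^ m • ncTaylor a Z W m) (ncEval a (Z + t • W)) := by
  have hs := h.summable_taylor hM hR hρ hZ hW ht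
  have h1 : HasSum (fun α : Word d => tens (wordEval (Z + t • W) α) (a α))
      (∑' p : Word d × ℕ, t ^ p.2 • tens (wordTaylor (letters Z) (letters W) p.2 p.1) (a p.1)) := by
    refine hs.hasSum.prod_fiberwise fun α => ?_
    have := (tensCLM n (a α)).hasSum (hasSum_wordTaylor (letters Z) (letters W) t α)
    simp only [map_smul, tensCLM_apply] at this
    rw [← wordProd_letters, show letters (Z + t • W) = fun l => letters Z l + t • letters W l from
      funext fun l => by rw [letters_add, letters_smul]]
    exact this
  have h2 : ∑' p : Word d × ℕ, t ^ p.2 • tens (wordTaylor (letters Z) (letters W) p.2 p.1)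
      (a p.1) = ncEval a (Z + t • W) := h1.unique (hasSum_ncEval h1.summable)
  rw [← h2]
  have h3 := ((Equiv.prodComm ℕ (Word d)).hasSum_iff.2 hs.hasSum)
  refine h3.prod_fiberwise fun m => ?_
  exact (h.hasSum_ncTaylor hM hR hρ hZ hW m).const_smul _

variable {K : Type*} [NormedAddCommGroup K] [InnerProductSpace ℂ K] [CompleteSpace K]

theorem letters_I_smul (H : MatTuple d n) : letters (Complex.I • H) =
    fun l => (if l.isLeft then Complex.I else -Complex.I) • letters H l := by
  ext1 l
  cases l <;> simp [letters, Matrix.conjTranspose_smul]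

/-- The second-order coefficients along `H` and `I • H` can be computed word by word;
`wordTaylor_two_add` combines them into the mixed second derivative of each word. -/
theorem GrowthBound.hasSum_complexHessian {c : Word d → K →L[ℂ] K} {M R ρ : ℝ} (hM : 0 ≤ M)
    (hR : 0 ≤ R) (h : GrowthBound c M R) (hρ0 : 0 < ρ) (hρ : 2 * d * (2 * R * ρ) < 1)
    {Z H : MatTuple d n} (hZ : ‖Z‖ < ρ) (hH : ‖H‖ ≤ ρ) :
    HasSum (fun α : Word d => tens (wordHess (letters Z) (letters H) α) (c α))
      (complexHessian (fun Z : MatTuple d n => ncEval c Z) Z H) := by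
  have hR' : 2 * d * R * ρ < 1 := by
    have : 0 ≤ 2 * d * R * ρ := by positivity
    linarith
  have hana : AnalyticAt ℝ (fun Z : MatTuple d n => ncEval c Z) Z := by
    lift ρ to NNReal using hρ0.le
    refine (h.hasFPowerSeriesOnBall hM hR (by exact_mod_cast hρ0) hR').analyticAt_of_mem ?_
    simpa using hZ
  have hlin : AnalyticAt ℝ (fun z : ℂ => Z + z • H) 0 :=
    analyticAt_const.add
      (((ContinuousLinearMap.toSpanSingleton ℂ H).restrictScalars ℝ).analyticAt 0)
  have hana' : AnalyticAt ℝ (fun z : ℂ => ncEval c (Z + z • H)) 0 := by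
    refine AnalyticAt.fun_comp (g := fun Z : MatTuple d n => ncEval c Z) ?_ hlin
    simpa using hana
  obtain ⟨q, r, hq⟩ := hana'
  -- Both sides are the coefficient of `t ^ 2` in `t ↦ f(Z + t u H)`, and power series in one real
  -- variable are unique.
  have key : ∀ u : ℂ, ‖u‖ = 1 → q 2 (fun _ => u) = ncTaylor c Z (u • H) 2 := by
    intro u hu
    have h1 : ∀ᶠ t in 𝓝 (0 : ℝ), HasSum (fun k => t ^ k • q k fun _ => u)
        (ncEval c (Z + t • (u • H))) := by
      have hb := Metric.eball_mem_nhds (0 : ℂ) hq.r_pos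
      have hcont : Filter.Tendsto (fun t : ℝ => t • u) (𝓝 0) (𝓝 0) := by
        have : Continuous fun t : ℝ => t • u := by fun_prop
        simpa using this.tendsto 0
      filter_upwards [hcont hb] with t ht
      have := hq.hasSum ht
      rw [zero_add, smul_assoc] at this
      refine this.congr_fun fun k => ?_
      have := (q k).map_smul_univ (fun _ => t) (fun _ => u)
      simpa using this.symm
    have h2 : ∀ᶠ t in 𝓝 (0 : ℝ), HasSum (fun k => t ^ k • ncTaylor c Z (u • H) k)
        (ncEval c (Z + t • (u • H))) := by
      filter_upwards [Metric.closedBall_mem_nhds (0 : ℝ) one_pos] with t ht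
      refine h.hasSum_pow_ncTaylor hM hR hρ hZ.le ?_ (by simpa using ht)
      rw [norm_smul, hu, one_mul]
      exact hH
    exact congrFun (eq_of_hasSum_pow h1 h2) 2
  have hvec : ∀ u : ℂ, ![u, u] = fun _ => u := fun u => by ext i; fin_cases i <;> rfl
  -- The Laplacian adds the second derivatives in the directions `1` and `I`, each equal to `2!`
  -- times a quadratic coefficient; with the quarter this leaves `1 / 2`.
  have h3 : complexHessian (fun Z : MatTuple d n => ncEval c Z) Z H =
      (2 : ℂ)⁻¹ • (ncTaylor c Z H 2 + ncTaylor c Z (Complex.I • H) 2) := by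
    have k1 := key 1 (by simp)
    rw [one_smul] at k1
    rw [complexHessian, InnerProductSpace.laplacian_eq_iteratedFDeriv_complexPlane]
    simp only [hvec, ← hq.factorial_smul, k1, key Complex.I (by simp)]
    rw [← smul_add, ← Nat.cast_smul_eq_nsmul ℝ, smul_smul, ← Complex.coe_smul]
    congr 1
    norm_num
  have h4 := ((h.hasSum_ncTaylor hM hR hρ hZ.le hH 2).add
    (h.hasSum_ncTaylor hM hR hρ hZ.le (W := Complex.I • H)
      (by rw [norm_smul, Complex.norm_I, one_mul]; exact hH) 2)).const_smul (2 : ℂ)⁻¹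
  rw [← h3] at h4
  refine h4.congr_fun fun α => ?_
  rw [← tens_add_left, wordTaylor_two_add _ (fun l => congrFun (letters_I_smul H) l),
    ← tens_smul_left, smul_smul]
  norm_num

end Hessian

/-! ### Positivity of the Hankel-type matrices -/

/-! ### Homogeneity and size of the derivatives of words -/

section Scaling

variable {A : Type*} [Ring A] [Algebra ℝ A]

theorem wordProd_smul (X : Letter d → A) (t : ℝ) (α : Word d) :
    wordProd (fun l => t • X l) α = t ^ α.length • wordProd X α := by
  induction α with
  | nil => simp
  | cons l α ih =>
    rw [wordProd_cons, wordProd_cons, ih, smul_mul_smul_comm, List.length_cons, pow_succ']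

/-- The factor `t` on the left avoids the exponent `|α| - 1`, which would be truncated at the empty
word. The factor `t ^ 2` in `wordHess_smul` has the same purpose. -/
theorem wordDeriv_smul (X Y : Letter d → A) (t h : ℝ) (ε : Bool) (α : Word d) :
    t • wordDeriv (fun l => t • X l) (fun l => h • Y l) ε α =
      (t ^ α.length * h) • wordDeriv X Y ε α := by
  induction α with
  | nil => simp [wordDeriv]
  | cons l α ih =>
    simp only [wordDeriv, smul_add, smul_mul_assoc, ← mul_smul_comm t, ih]
    split_ifs
    · rw [wordProd_smul]
      simp only [smul_smul, mul_smul_comm, List.length_cons]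
      congr 2 <;> ring
    · simp only [smul_smul, mul_smul_comm, List.length_cons, smul_zero, add_zero]
      congr 1
      ring

theorem wordHess_smul (X Y : Letter d → A) (t h : ℝ) (α : Word d) :
    t ^ 2 • wordHess (fun l => t • X l) (fun l => h • Y l) α =
      (t ^ α.length * h ^ 2) • wordHess X Y α := by
  induction α with
  | nil => simp [wordHess]
  | cons l α ih =>
    have h1 := congrArg (t • ·) (wordDeriv_smul X Y t h (!l.isLeft) α)
    simp only [smul_smul, ← sq] at h1
    rw [wordHess, wordHess, smul_add, ← mul_smul_comm (t ^ 2) (t • X l),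
      ← mul_smul_comm (t ^ 2) (h • Y l), ih, h1, smul_mul_smul_comm, smul_mul_smul_comm, smul_add,
      List.length_cons]
    congr 2 <;> ring

theorem norm_wordProd_le {A : Type*} [NormedRing A] (h1 : ‖(1 : A)‖ ≤ 1) {X : Letter d → A}
    {ρ : ℝ} (hX : ∀ l, ‖X l‖ ≤ ρ) (α : Word d) : ‖wordProd X α‖ ≤ ρ ^ α.length := by
  simpa [wordTaylor_zero] using norm_wordTaylor_le h1 hX hX 0 α

theorem norm_wordDeriv_le {A : Type*} [NormedRing A] (h1 : ‖(1 : A)‖ ≤ 1) {X Y : Letter d → A}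
    {ρ : ℝ} (hX : ∀ l, ‖X l‖ ≤ ρ) (hY : ∀ l, ‖Y l‖ ≤ ρ) (ε : Bool) (α : Word d) :
    ‖wordDeriv X Y ε α‖ ≤ (2 * ρ) ^ α.length := by
  induction α with
  | nil => simp [wordDeriv]
  | cons l α ih =>
    have hρ : 0 ≤ ρ := (norm_nonneg _).trans (hX l)
    have h2 : ‖X l * wordDeriv X Y ε α‖ ≤ ρ * (2 * ρ) ^ α.length :=
      (norm_mul_le _ _).trans (mul_le_mul (hX l) ih (norm_nonneg _) hρ)
    have h3 : ‖(if l.isLeft = ε then Y l * wordProd X α else 0)‖ ≤ ρ * (2 * ρ) ^ α.length := by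
      split_ifs
      · refine (norm_mul_le _ _).trans (mul_le_mul (hY l) ?_ (norm_nonneg _) hρ)
        refine (norm_wordProd_le h1 hX α).trans ?_
        gcongr
        linarith
      · rw [norm_zero]; positivity
    refine (norm_add_le_of_le h2 h3).trans_eq ?_
    rw [List.length_cons]
    ring

theorem norm_wordHess_le {A : Type*} [NormedRing A] (h1 : ‖(1 : A)‖ ≤ 1) {X Y : Letter d → A}
    {ρ : ℝ} (hX : ∀ l, ‖X l‖ ≤ ρ) (hY : ∀ l, ‖Y l‖ ≤ ρ) (α : Word d) :
    ‖wordHess X Y α‖ ≤ (3 * ρ) ^ α.length := by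
  induction α with
  | nil => simp [wordHess]
  | cons l α ih =>
    have hρ : 0 ≤ ρ := (norm_nonneg _).trans (hX l)
    have h2 : ‖X l * wordHess X Y α‖ ≤ ρ * (3 * ρ) ^ α.length :=
      (norm_mul_le _ _).trans (mul_le_mul (hX l) ih (norm_nonneg _) hρ)
    have h3 : ‖Y l * wordDeriv X Y (!l.isLeft) α‖ ≤ ρ * (3 * ρ) ^ α.length := by
      refine (norm_mul_le _ _).trans (mul_le_mul (hY l) ?_ (norm_nonneg _) hρ)
      refine (norm_wordDeriv_le h1 hX hY _ α).trans ?_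
      gcongr
      norm_num
    refine (norm_add_le_of_le h2 h3).trans ?_
    have : 0 ≤ ρ * (3 * ρ) ^ α.length := by positivity
    rw [List.length_cons, pow_succ']
    linarith

end Scaling

section Positivity

variable {K : Type*} [NormedAddCommGroup K] [InnerProductSpace ℂ K]

/-- The vector `e_k ⊗ w`. -/
def basisVec (k : Fin n) (w : K) : Amp n K := WithLp.toLp 2 (Pi.single k w)

theorem inner_tens_basisVec (A : Matrix (Fin n) (Fin n) ℂ) (a : K →L[ℂ] K) (k l : Fin n)
    (w u : K) : inner ℂ (tens A a (basisVec k w)) (basisVec l u) =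
      starRingEnd ℂ (A l k) * inner ℂ (a w) u := by
  rw [inner_tens_apply, Finset.sum_eq_single l, Finset.sum_eq_single k]
  · simp [basisVec]
  · intro j _ hj
    simp [basisVec, hj]
  · simp
  · intro j _ hj
    simp [basisVec, hj]
  · simp

theorem exists_norm_apply_le (i j : Fin n) :
    ∃ C : ℝ, 0 ≤ C ∧ ∀ A : Matrix (Fin n) (Fin n) ℂ, ‖A i j‖ ≤ C * ‖A‖ := by
  let L : Matrix (Fin n) (Fin n) ℂ →ₗ[ℂ] ℂ :=
    { toFun := fun A => A i j
      map_add' := fun _ _ => rfl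
      map_smul' := fun _ _ => rfl }
  exact ⟨‖L.toContinuousLinearMap‖, norm_nonneg _, fun A => L.toContinuousLinearMap.le_opNorm A⟩

variable [CompleteSpace K]

-- The Hessian form is evaluated at the base point `t • Z`, with `Z` the Fock matrices, in the
-- direction of the hops, on the sum of the vectors `t ^ (-|σ i|) e_i ⊗ w i`, with `e_i` the vacuum
-- of copy `i`. After normalization the word `γ` carries the factor `t ^ (|γ| - |σ j| - |σ i|)`.
-- Shorter words contribute nothing, words of the critical length give the Gram sum, and longer ones
-- vanish as `t → 0`.
set_option maxHeartbeats 1600000 in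
theorem gram_nonneg {c : Word d → K →L[ℂ] K} {M R : ℝ} (hM : 0 < M) (hR : 0 < R)
    (hc : GrowthBound c M R)
    (hpsh : PlurisubharmonicNearZero fun (n : ℕ) (Z : MatTuple d n) => ncEval c Z)
    {ι : Type*} [Fintype ι] (σ : ι → Word d) (ε : Bool)
    (hσ : ∀ i, ∃ l s, σ i = l :: s ∧ l.isLeft = ε) (w : ι → K) :
    0 ≤ (∑ i, ∑ j, inner ℂ (c ((σ j).adj ++ σ i) (w i)) (w j)).re := by
  classical
  let N := Finset.univ.sup fun i => (σ i).length
  have hN : ∀ i, (σ i).length ≤ N := fun i =>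
    Finset.le_sup (f := fun i => (σ i).length) (Finset.mem_univ i)
  let _ : Fintype (Fock d N) := Fintype.ofFinite _
  let V := (ι × Fock d N) ⊕ Unit
  let e : V ≃ Fin (Fintype.card V) := Fintype.equivFin V
  let Z := tupleOf e (fockMat (d := d) ι N)
  let H := tupleOf e (hopMat (d := d) σ N)
  let k : ι → Fin (Fintype.card V) := fun i => e (.inl (i, Fock.vac))
  let X := fun γ : Word d => wordHess (letters Z) (letters H) γ
  have hX : ∀ (γ : Word d) (i j : ι), γ.length ≤ (σ j).length + (σ i).length →
      X γ (k j) (k i) = if γ = (σ j).adj ++ σ i then 1 else 0 := fun γ i j h => by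
    have : X γ = Matrix.reindexAlgEquiv ℂ ℂ e (wordHess (fockMat ι N) (hopMat σ N) γ) := by
      simp only [X, Z, H]
      rw [letters_tupleOf e fockMat_swap, letters_tupleOf e (hopMat_swap σ), ← map_wordHess]
      rfl
    rw [this]
    simp only [k, Matrix.coe_reindexAlgEquiv, Matrix.reindex_apply, Matrix.submatrix_apply,
      Equiv.symm_apply_apply]
    exact wordHess_vac hN hσ γ i j h
  -- the rescaled Hessian
  let ρ : ℝ := (4 * d * R + 1)⁻¹
  have hρ0 : 0 < ρ := by positivity
  have hρ : 2 * d * (2 * R * ρ) < 1 := by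
    have : 2 * d * (2 * R * ρ) = (4 * d * R) / (4 * d * R + 1) := by simp only [ρ]; ring
    rw [this, div_lt_one (by positivity)]
    linarith
  -- The Hessian is quadratic in the direction. The hops are scaled into the ball where its
  -- expansion converges, and the factor `h ^ 2` is divided out later.
  let h : ℝ := ρ / (‖H‖ + 1)
  have hh : 0 < h := by positivity
  have hhH : ‖h • H‖ ≤ ρ := by
    rw [norm_smul, Real.norm_of_nonneg hh.le, div_mul_eq_mul_div, div_le_iff₀ (by positivity)]
    nlinarith [norm_nonneg H]
  -- The subtraction in the exponent is truncated. This is harmless, since for `|γ| < |σ j| + |σ i|`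
  -- the entry of `X γ` is zero. The truncated form is defined and continuous at `t = 0`.
  let term : ℝ → Word d → ℂ := fun t γ => ∑ i, ∑ j,
    ((t ^ (γ.length - ((σ j).length + (σ i).length)) : ℝ) : ℂ) *
      (starRingEnd ℂ (X γ (k j) (k i)) * inner ℂ (c γ (w i)) (w j))
  have hterm : ∀ t : ℝ, 0 < t → ∀ γ : Word d, ∀ v : Amp (Fintype.card V) K,
      v = ∑ i, ((t ^ (σ i).length : ℝ)⁻¹ : ℂ) • basisVec (k i) (w i) →
      term t γ = ((t ^ 2 / h ^ 2 : ℝ) : ℂ) * inner ℂ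
        (tens (wordHess (letters (t • Z)) (letters (h • H)) γ) (c γ) v) v := by
    intro t ht γ v hv
    have h1 : wordHess (letters (t • Z)) (letters (h • H)) γ =
        ((t ^ γ.length * h ^ 2 / t ^ 2 : ℝ) : ℂ) • X γ := by
      have := wordHess_smul (letters Z) (letters H) t h γ
      rw [show letters (t • Z) = fun l => t • letters Z l from funext (letters_smul t Z),
        show letters (h • H) = fun l => h • letters H l from funext (letters_smul h H),
        Complex.coe_smul, div_eq_inv_mul, mul_smul, ← this, smul_smul,
        inv_mul_cancel₀ (by positivity), one_smul]
    rw [h1, tens_smul_left, hv]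
    simp only [FunLike.coe_smul, Pi.smul_apply, map_sum, map_smul, sum_inner, inner_sum,
      inner_smul_left, inner_smul_right, inner_tens_basisVec, Finset.mul_sum, term,
      Complex.conj_ofReal, map_inv₀]
    rw [Finset.sum_comm]
    refine Finset.sum_congr rfl fun j _ => Finset.sum_congr rfl fun i _ => ?_
    by_cases hle : (σ j).length + (σ i).length ≤ γ.length
    · have h2 : t ^ (γ.length - ((σ j).length + (σ i).length)) =
          t ^ γ.length * (t ^ (σ i).length)⁻¹ * (t ^ (σ j).length)⁻¹ := by
        rw [pow_sub₀ _ ht.ne' hle, pow_add, mul_inv]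
        ring
      rw [h2]
      have ht' : (t : ℂ) ≠ 0 := by exact_mod_cast ht.ne'
      have hh' : (h : ℂ) ≠ 0 := by exact_mod_cast hh.ne'
      push_cast
      field_simp
    · rw [hX γ i j (by omega), if_neg]
      · simp
      · rintro rfl
        simp at hle
  have hev : ∀ᶠ t in 𝓝[>] (0 : ℝ), 0 ≤ ∑' γ, (term t γ).re := by
    have hlim : Filter.Tendsto (fun t : ℝ => t • Z) (𝓝[>] 0) (𝓝 0) := by
      have : Continuous fun t : ℝ => t • Z := by fun_prop
      simpa using (this.tendsto 0).mono_left nhdsWithin_le_nhds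
    have hball : ∀ᶠ Y : MatTuple d (Fintype.card V) in 𝓝 0, ‖Y‖ < ρ := by
      filter_upwards [Metric.ball_mem_nhds (0 : MatTuple d (Fintype.card V)) hρ0] with Y hY
      exact mem_ball_zero_iff.1 hY
    filter_upwards [hlim.eventually (hpsh _), hlim.eventually hball, self_mem_nhdsWithin]
      with t ht1 ht2 ht
    have ht0 : 0 < t := ht
    have hpos := ht1.2 (h • H)
    let v : Amp (Fintype.card V) K := ∑ i, ((t ^ (σ i).length : ℝ)⁻¹ : ℂ) • basisVec (k i) (w i)
    have hs := hc.hasSum_complexHessian hM.le hR.le hρ0 hρ ht2 hhH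
    have hs1 := ((innerSL ℂ v).restrictScalars ℝ).hasSum
      (((ContinuousLinearMap.apply ℂ (Amp (Fintype.card V) K) v).restrictScalars ℝ).hasSum hs)
    have hs2 := (Complex.reCLM.hasSum hs1).mul_left (t ^ 2 / h ^ 2)
    have hs3 : HasSum (fun γ => (term t γ).re) (t ^ 2 / h ^ 2 *
        (inner ℂ v (complexHessian (fun Z : MatTuple d (Fintype.card V) => ncEval c Z)
          (t • Z) (h • H) v)).re) := by
      refine hs2.congr_fun fun γ => ?_
      rw [hterm t ht0 γ v rfl, Complex.re_ofReal_mul]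
      exact congrArg _ (inner_re_symm (𝕜 := ℂ) _ _)
    rw [hs3.tsum_eq]
    have := hpos.2 v
    rw [ContinuousLinearMap.reApplyInnerSelf_apply, inner_re_symm] at this
    exact mul_nonneg (by positivity) this
  -- Dominated convergence over words. For `t < t₁ ≤ 1` the factor `t ^ (|γ| - |σ j| - |σ i|)` is at
  -- most `t₁ ^ |γ|` times a constant, and `t₁` is chosen so that this beats the number of words,
  -- the growth of `c`, and the factor `(3s) ^ |γ|` from the Hessian of a word.
  have hlim : Filter.Tendsto (fun t => ∑' γ, (term t γ).re) (𝓝[>] 0)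
      (𝓝 (∑' γ, (term 0 γ).re)) := by
    let s : ℝ := ‖Z‖ + ‖H‖
    have hs0 : 0 ≤ s := by positivity
    have hZs : ∀ l, ‖letters Z l‖ ≤ s := fun l =>
      (norm_letters_le Z l).trans (le_add_of_nonneg_right (norm_nonneg _))
    have hHs : ∀ l, ‖letters H l‖ ≤ s := fun l =>
      (norm_letters_le H l).trans (le_add_of_nonneg_left (norm_nonneg _))
    let t₁ : ℝ := (1 + 2 * d * (3 * s * R))⁻¹
    have ht₁ : 0 < t₁ := by positivity
    have ht₁' : t₁ ≤ 1 := inv_le_one_of_one_le₀ (by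
      have : 0 ≤ 2 * d * (3 * s * R) := by positivity
      linarith)
    have hsmall : 2 * d * (t₁ * (3 * s * R)) < 1 := by
      have : 2 * d * (t₁ * (3 * s * R)) = (2 * d * (3 * s * R)) / (1 + 2 * d * (3 * s * R)) := by
        simp only [t₁]; ring
      rw [this, div_lt_one (by positivity)]
      linarith
    choose C hC0 hC using fun i j : ι => exists_norm_apply_le (k j) (k i)
    let B : ℝ := ∑ i, ∑ j, (t₁ ^ ((σ j).length + (σ i).length))⁻¹ * (C i j * (M * ‖w i‖ * ‖w j‖))
    have hsum : Summable fun γ : Word d => B * (t₁ * (3 * s * R)) ^ γ.length :=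
      (summable_word_pow (by positivity) hsmall).mul_left B
    refine tendsto_tsum_of_dominated_convergence hsum (fun γ => ?_) ?_
    · have : Continuous fun t => (term t γ).re := by
        simp only [term]
        fun_prop
      exact (this.tendsto 0).mono_left nhdsWithin_le_nhds
    · filter_upwards [Ioo_mem_nhdsGT ht₁] with t ht γ
      refine (Complex.abs_re_le_norm _).trans ?_
      simp only [term, B, Finset.sum_mul]
      refine norm_sum_le_of_le _ fun i _ => norm_sum_le_of_le _ fun j _ => ?_
      have h1 : t ^ (γ.length - ((σ j).length + (σ i).length)) ≤
          (t₁ ^ ((σ j).length + (σ i).length))⁻¹ * t₁ ^ γ.length := by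
        refine (pow_le_pow_left₀ ht.1.le ht.2.le _).trans ?_
        rw [inv_mul_eq_div, le_div_iff₀ (by positivity), ← pow_add]
        exact pow_le_pow_of_le_one ht₁.le ht₁' (by omega)
      have h2 : ‖X γ (k j) (k i)‖ ≤ C i j * (3 * s) ^ γ.length :=
        (hC i j _).trans (mul_le_mul_of_nonneg_left
          (norm_wordHess_le norm_one_matrix_le hZs hHs γ) (hC0 i j))
      have h3 : ‖inner ℂ (c γ (w i)) (w j)‖ ≤ M * R ^ γ.length * ‖w i‖ * ‖w j‖ :=
        (norm_inner_le_norm _ _).trans (mul_le_mul_of_nonneg_right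
          ((c γ).le_of_opNorm_le (hc γ) _) (norm_nonneg _))
      rw [norm_mul, norm_mul, Complex.norm_real, Real.norm_of_nonneg (pow_nonneg ht.1.le _),
        RCLike.norm_conj]
      calc _ ≤ ((t₁ ^ ((σ j).length + (σ i).length))⁻¹ * t₁ ^ γ.length) *
            ((C i j * (3 * s) ^ γ.length) * (M * R ^ γ.length * ‖w i‖ * ‖w j‖)) := by
            have := hC0 i j
            gcongr
        _ = _ := by
            rw [mul_pow t₁, mul_pow (3 * s)]
            ring
  -- At `t = 0` the powers with positive exponent vanish and `0 ^ 0 = 1`, so for each pair only the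
  -- word `(σ j)^* σ i` remains.
  have hzero : ∑' γ, (term 0 γ).re =
      (∑ i, ∑ j, inner ℂ (c ((σ j).adj ++ σ i) (w i)) (w j)).re := by
    have h0 : ∀ γ, (term 0 γ).re = ∑ i, ∑ j,
        if γ = (σ j).adj ++ σ i then (inner ℂ (c ((σ j).adj ++ σ i) (w i)) (w j)).re else 0 := by
      intro γ
      simp only [term, Complex.re_sum]
      refine Finset.sum_congr rfl fun i _ => Finset.sum_congr rfl fun j _ => ?_
      by_cases hle : γ.length ≤ (σ j).length + (σ i).length
      · rw [hX γ i j hle, Nat.sub_eq_zero_of_le hle]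
        split_ifs with hγ
        · rw [← hγ]; simp
        · simp
      · rw [zero_pow (by omega), if_neg]
        · simp
        · rintro rfl
          simp at hle
    simp only [h0, Complex.re_sum]
    exact (hasSum_sum fun i _ => hasSum_sum fun j _ => hasSum_ite_eq _ _).tsum_eq
  rw [← hzero]
  exact ge_of_tendsto hlim hev

end Positivity

/-! ### The Hilbert spaces -/

section Synth

variable {K : Type*} [NormedAddCommGroup K] [InnerProductSpace ℂ K]

/-- The linear combinations of the ranges of a family of operators. -/
def synth {X H : Type*} [NormedAddCommGroup H] [InnerProductSpace ℂ H] (v : X → K →L[ℂ] H) :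
    (X →₀ K) →ₗ[ℂ] H :=
  Finsupp.lsum ℂ fun x => (v x).toLinearMap

variable {X H H' : Type*} [NormedAddCommGroup H] [InnerProductSpace ℂ H]
  [NormedAddCommGroup H'] [InnerProductSpace ℂ H'] {v : X → K →L[ℂ] H}

theorem synth_apply (v : X → K →L[ℂ] H) (x : X →₀ K) : synth v x = x.sum fun i w => v i w := rfl

@[simp] theorem synth_single (v : X → K →L[ℂ] H) (i : X) (w : K) :
    synth v (Finsupp.single i w) = v i w := by
  simp [synth_apply]

theorem inner_synth (v v' : X → K →L[ℂ] H) (x : X →₀ K) :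
    inner ℂ (synth v x) (synth v' x) =
      ∑ i ∈ x.support, ∑ j ∈ x.support, inner ℂ (v i (x i)) (v' j (x j)) := by
  simp only [synth_apply, Finsupp.sum, sum_inner, inner_sum]
  exact Finset.sum_comm

theorem ext_of_denseRange_synth (hv : DenseRange (synth v)) {f g : H →L[ℂ] H'}
    (h : ∀ i w, f (v i w) = g (v i w)) : f = g := by
  have h1 : f.toLinearMap ∘ₗ synth v = g.toLinearMap ∘ₗ synth v :=
    Finsupp.lhom_ext fun i w => by simpa using h i w
  ext x
  exact congrFun (hv.equalizer f.continuous g.continuous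
    (funext fun y => LinearMap.congr_fun h1 y)) x

/-- Vectors in the Hilbert spaces below are identified by testing against the symbols `[β ⊗ w]`. -/
theorem eq_of_inner_eq (hv : DenseRange (synth v)) {x y : H}
    (h : ∀ i w, (inner ℂ x (v i w) : ℂ) = inner ℂ y (v i w)) : x = y :=
  (innerSL_inj (𝕜 := ℂ)).1 (ext_of_denseRange_synth hv h)

end Synth

section Hilbert

variable {K : Type*} [NormedAddCommGroup K] [InnerProductSpace ℂ K] [CompleteSpace K]

theorem eventually_smul_of_eventually {p : MatTuple d n → Prop} (h : ∀ᶠ Z in 𝓝 0, p Z)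
    (Z : MatTuple d n) : ∀ᶠ t in 𝓝 (0 : ℝ), p (t • Z) := by
  have : Continuous fun t : ℝ => t • Z := by fun_prop
  have h0 := this.tendsto 0
  rw [zero_smul] at h0
  exact h0.eventually h

theorem eventually_mul_norm_lt_one (q : ℝ) : ∀ᶠ Z : MatTuple d n in 𝓝 0, q * ‖Z‖ < 1 := by
  have : Continuous fun Z : MatTuple d n => q * ‖Z‖ := by fun_prop
  have h0 := this.tendsto 0
  rw [norm_zero, mul_zero] at h0
  exact h0.eventually (gt_mem_nhds one_pos)

/-- The values are self-adjoint near `0`, so `c` and its adjoint series have the same values along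
every ray near `0`, hence the same coefficients. -/
theorem adjSeries_eq_self {c : Word d → K →L[ℂ] K} {M R : ℝ} (hR : 0 ≤ R)
    (hc : GrowthBound c M R)
    (hpsh : PlurisubharmonicNearZero fun (n : ℕ) (Z : MatTuple d n) => ncEval c Z) :
    adjSeries c = c := by
  refine eq_of_hasSum_homPart fun n Z => ?_
  filter_upwards [eventually_smul_of_eventually (hpsh n) Z,
    eventually_smul_of_eventually (eventually_mul_norm_lt_one (2 * d * R)) Z] with t h1 h2
  have h3 := hasSum_homPart (hc.summable_norm_homPart hR h2)
  refine ⟨_, ?_, h3⟩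
  have h4 := hasSum_homPart_adjSeries h3
  rwa [h1.1.adjoint_eq] at h4

theorem apply_adj {c : Word d → K →L[ℂ] K} (hc : adjSeries c = c) (α : Word d) :
    c α.adj = (c α).adjoint := by
  conv_lhs => rw [← hc]
  rw [adjSeries, Word.adj_adj]

theorem posSemidef_of_gram_nonneg {c : Word d → K →L[ℂ] K} (hself : adjSeries c = c)
    {p : Word d → Prop} (h : ∀ (s : Finset {α // p α}) (w : s → K),
      0 ≤ (∑ i, ∑ j, inner ℂ (c (j.1.1.adj ++ i.1.1) (w i)) (w j)).re) :
    (Matrix.of fun α β : {α // p α} => c (α.1.adj ++ β.1)).PosSemidef := by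
  have htfae := RKHS.posSemidef_tfae (𝕜 := ℂ)
    (K := Matrix.of fun α β : {α // p α} => c (α.1.adj ++ β.1))
  have h02 := htfae.out 0 2
  rw [h02]
  refine ⟨?_, fun vv => ?_⟩
  · ext1 α β
    rw [Matrix.conjTranspose_apply, Matrix.of_apply, Matrix.of_apply,
      ContinuousLinearMap.star_eq_adjoint, ← apply_adj hself, Word.adj_append, Word.adj_adj]
  · have := h vv.support fun i => vv i
    simp only [Finsupp.sum, Matrix.of_apply]
    rw [← Finset.sum_coe_sort vv.support]
    simp only [← Finset.sum_coe_sort vv.support (fun x' => inner ℂ (c (x'.1.adj ++ _) _) (vv x'))]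
    exact this

theorem posSemidef_Cplus {c : Word d → K →L[ℂ] K} {M R : ℝ} (hM : 0 < M) (hR : 0 < R)
    (hc : GrowthBound c M R)
    (hpsh : PlurisubharmonicNearZero fun (n : ℕ) (Z : MatTuple d n) => ncEval c Z) :
    (Cplus c).PosSemidef :=
  posSemidef_of_gram_nonneg (adjSeries_eq_self hR.le hc hpsh) fun s w =>
    gram_nonneg hM hR hc hpsh (fun i : s => i.1.1) true
      (fun i => by obtain ⟨j, β, h⟩ := i.1.2; exact ⟨_, _, h, rfl⟩) w

theorem posSemidef_Cminus {c : Word d → K →L[ℂ] K} {M R : ℝ} (hM : 0 < M) (hR : 0 < R)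
    (hc : GrowthBound c M R)
    (hpsh : PlurisubharmonicNearZero fun (n : ℕ) (Z : MatTuple d n) => ncEval c Z) :
    (Cminus c).PosSemidef :=
  posSemidef_of_gram_nonneg (adjSeries_eq_self hR.le hc hpsh) fun s w =>
    gram_nonneg hM hR hc hpsh (fun i : s => i.1.1) false
      (fun i => by obtain ⟨j, β, h⟩ := i.1.2; exact ⟨_, _, h, rfl⟩) w

variable (c : Word d → K →L[ℂ] K)

section Plus

variable [Fact (Cplus c).PosSemidef]

theorem vecPlus_of_not {α : Word d} (h : ¬α.StartsAnalytic) : vecPlus c α = 0 := dif_neg h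

theorem inner_vecPlus {α β : Word d} (hα : α.StartsAnalytic) (hβ : β.StartsAnalytic) (w u : K) :
    inner ℂ (vecPlus c β w) (vecPlus c α u) = inner ℂ (c (α.adj ++ β) w) u := by
  rw [vecPlus, vecPlus, dif_pos hα, dif_pos hβ, RKHS.inner_kerFun, RKHS.kerFun_apply,
    RKHS.OfKernel.kernel_ofKernel]
  rfl

theorem denseRange_synth_vecPlus : DenseRange (synth (vecPlus c)) := by
  have h := RKHS.kerFun_dense (𝕜 := ℂ) (H := Hplus c)
  rw [← Submodule.dense_iff_topologicalClosure_eq_top] at h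
  rw [DenseRange, ← LinearMap.coe_range]
  refine h.mono (Submodule.span_le.2 ?_)
  rintro _ ⟨⟨α, hα⟩, w, rfl⟩
  exact ⟨Finsupp.single α w, by rw [synth_single, vecPlus, dif_pos hα]⟩

end Plus

section Minus

variable [Fact (Cminus c).PosSemidef]

theorem vecMinus_of_not {α : Word d} (h : ¬α.StartsCoanalytic) : vecMinus c α = 0 := dif_neg h

theorem inner_vecMinus {α β : Word d} (hα : α.StartsCoanalytic) (hβ : β.StartsCoanalytic)
    (w u : K) : inner ℂ (vecMinus c β w) (vecMinus c α u) = inner ℂ (c (α.adj ++ β) w) u := by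
  rw [vecMinus, vecMinus, dif_pos hα, dif_pos hβ, RKHS.inner_kerFun, RKHS.kerFun_apply,
    RKHS.OfKernel.kernel_ofKernel]
  rfl

theorem denseRange_synth_vecMinus : DenseRange (synth (vecMinus c)) := by
  have h := RKHS.kerFun_dense (𝕜 := ℂ) (H := Hminus c)
  rw [← Submodule.dense_iff_topologicalClosure_eq_top] at h
  rw [DenseRange, ← LinearMap.coe_range]
  refine h.mono (Submodule.span_le.2 ?_)
  rintro _ ⟨⟨α, hα⟩, w, rfl⟩
  exact ⟨Finsupp.single α w, by rw [synth_single, vecMinus, dif_pos hα]⟩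

end Minus

end Hilbert

/-! ### The shift operators -/

section Words

variable {α β : Word d}

theorem Word.IsAnalytic.startsAnalytic_append (h : α.IsAnalytic) (h' : α ≠ []) (β : Word d) :
    (α ++ β : Word d).StartsAnalytic := by
  cases α with
  | nil => exact absurd rfl h'
  | cons l α =>
    have := h l List.mem_cons_self
    rcases l with i | i
    · exact ⟨i, α ++ β, rfl⟩
    · simp at this

theorem Word.IsCoanalytic.startsCoanalytic_append (h : α.IsCoanalytic) (h' : α ≠ [])
    (β : Word d) : (α ++ β : Word d).StartsCoanalytic := by
  cases α with
  | nil => exact absurd rfl h'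
  | cons l α =>
    have := h l List.mem_cons_self
    rcases l with i | i
    · simp at this
    · exact ⟨i, α ++ β, rfl⟩

/-- The word `(α^* α)^m`. -/
def Word.sqPow (α : Word d) (m : ℕ) : Word d := (List.replicate m (α.adj ++ α)).flatten

theorem Word.length_sqPow (α : Word d) (m : ℕ) : (α.sqPow m).length = 2 * α.length * m := by
  simp [Word.sqPow, Word.length_adj]
  ring

theorem Word.sqPow_add (α : Word d) (m k : ℕ) : α.sqPow (m + k) = α.sqPow m ++ α.sqPow k := by
  simp only [Word.sqPow, List.replicate_add, List.flatten_append]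

theorem Word.adj_sqPow (α : Word d) (m : ℕ) : (α.sqPow m).adj = α.sqPow m := by
  induction m with
  | zero => rfl
  | succ m ih =>
    have h1 : α.sqPow 1 = α.adj ++ α := by simp [Word.sqPow]
    rw [Word.sqPow_add, Word.adj_append, ih, h1, Word.adj_append, Word.adj_adj, ← h1,
      ← Word.sqPow_add, ← Word.sqPow_add, add_comm]

theorem Word.startsCoanalytic_sqPow_append (h : α.IsAnalytic) (h' : α ≠ []) (m : ℕ)
    (hβ : β.StartsCoanalytic) : (α.sqPow m ++ β : Word d).StartsCoanalytic := by
  cases m with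
  | zero => exact hβ
  | succ m =>
    rw [add_comm, Word.sqPow_add, show α.sqPow 1 = α.adj ++ α by simp [Word.sqPow],
      List.append_assoc, List.append_assoc]
    exact Word.IsCoanalytic.startsCoanalytic_append (Word.isCoanalytic_adj.2 h)
      (mt Word.adj_eq_nil.1 h') _

end Words

/-- Iterating the hypothesis gives `(b 0 / a) ^ (2 ^ k) ≤ b k / a ≤ (D / a) q ^ (2 ^ k)`. The powers
of `b 0 / (a q)` then stay bounded, so this ratio is at most one and the constant `D` disappears. -/
theorem le_mul_of_sq_le {a q D : ℝ} {b : ℕ → ℝ} (hq : 0 < q) (ha : 0 ≤ a) (hb : ∀ k, 0 ≤ b k)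
    (h : ∀ k, b k ^ 2 ≤ a * b (k + 1)) (hD : ∀ k, b k ≤ D * q ^ (2 ^ k)) : b 0 ≤ a * q := by
  rcases ha.eq_or_lt with rfl | ha
  · have := h 0
    nlinarith [hb 0]
  have h1 : ∀ k, (b 0 / a) ^ (2 ^ k) ≤ b k / a := by
    intro k
    induction k with
    | zero => simp
    | succ k ih =>
      rw [pow_succ, pow_mul]
      refine (pow_le_pow_left₀ (pow_nonneg (div_nonneg (hb 0) ha.le) _) ih 2).trans ?_
      rw [div_pow, div_le_div_iff₀ (by positivity) ha]
      nlinarith [h k]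
  by_contra! hlt
  have h2 : 1 < b 0 / (a * q) := (one_lt_div (by positivity)).2 hlt
  obtain ⟨m, hm⟩ := pow_unbounded_of_one_lt (D / a) h2
  have h3 : (b 0 / (a * q)) ^ (2 ^ m) ≤ D / a := by
    rw [← div_div, div_pow, div_le_iff₀ (by positivity), div_mul_eq_mul_div]
    exact (h1 m).trans (div_le_div_of_nonneg_right (hD m) ha.le)
  exact absurd (hm.trans_le ((pow_le_pow_right₀ h2.le (Nat.lt_two_pow_self).le).trans h3))
    (lt_irrefl _)

section Shift

variable {K : Type*} [NormedAddCommGroup K] [InnerProductSpace ℂ K] [CompleteSpace K]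
  (c : Word d → K →L[ℂ] K) [Fact (Cplus c).PosSemidef] [Fact (Cminus c).PosSemidef]

open Classical in
/-- The vectors `[αβ ⊗ w]` for `β` starting with a coanalytic letter. -/
def shiftVec (α β : Word d) : K →L[ℂ] Hplus c :=
  if β.StartsCoanalytic then vecPlus c (α ++ β) else 0

-- This estimate makes `[β ⊗ w] ↦ [αβ ⊗ w]` well defined and bounded on `H⁻`. It is proved on finite
-- combinations, before any operator is available, with the words `(α^* α)^m β` in place of powers
-- of `T_α^* T_α`.
open Classical in
theorem norm_synth_shiftVec_le {M R : ℝ} (hM : 0 < M) (hR : 0 < R) (hc : GrowthBound c M R)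
    {α : Word d} (hα : α.IsAnalytic) (hα' : α ≠ []) (x : Word d →₀ K) :
    ‖synth (shiftVec c α) x‖ ≤ R ^ α.length * ‖synth (vecMinus c) x‖ := by
  let v : ℕ → Word d → K →L[ℂ] Hminus c := fun m β =>
    if β.StartsCoanalytic then vecMinus c (α.sqPow m ++ β) else 0
  have hv0 : v 0 = vecMinus c := by
    ext1 β
    simp only [v]
    split_ifs with h
    · rfl
    · rw [vecMinus_of_not c h]
  -- The moments `⟨(T_α^* T_α)^m x, x⟩`, written through the coefficients `c`. Since `(α^* α)^m` is
  -- its own adjoint, the inner product of `v m` and `v k` depends on `m + k` only.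
  let a : ℕ → ℂ := fun m => ∑ i ∈ x.support, ∑ j ∈ x.support,
    if i.StartsCoanalytic ∧ j.StartsCoanalytic then
      inner ℂ (c (j.adj ++ (α.sqPow m ++ i)) (x i)) (x j) else 0
  have hinner : ∀ m k, inner ℂ (synth (v m) x) (synth (v k) x) = a (k + m) := by
    intro m k
    rw [inner_synth]
    refine Finset.sum_congr rfl fun i _ => Finset.sum_congr rfl fun j _ => ?_
    by_cases hi : i.StartsCoanalytic
    swap
    · simp [v, hi]
    by_cases hj : j.StartsCoanalytic
    swap
    · simp [v, hj]
    simp only [v, hi, hj, if_true, and_self]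
    rw [inner_vecMinus c (Word.startsCoanalytic_sqPow_append hα hα' _ hj)
      (Word.startsCoanalytic_sqPow_append hα hα' _ hi), Word.adj_append, Word.adj_sqPow,
      Word.sqPow_add, List.append_assoc, List.append_assoc]
  have hone : (‖synth (shiftVec c α) x‖ ^ 2 : ℝ) = ‖a 1‖ := by
    have : inner ℂ (synth (shiftVec c α) x) (synth (shiftVec c α) x) = a 1 := by
      rw [inner_synth]
      refine Finset.sum_congr rfl fun i _ => Finset.sum_congr rfl fun j _ => ?_
      by_cases hi : i.StartsCoanalytic
      swap
      · simp [shiftVec, hi]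
      by_cases hj : j.StartsCoanalytic
      swap
      · simp [shiftVec, hj]
      simp only [shiftVec, hi, hj, if_true, and_self]
      rw [inner_vecPlus c (hα.startsAnalytic_append hα' _) (hα.startsAnalytic_append hα' _),
        Word.adj_append]
      simp [Word.sqPow]
    rw [← this, inner_self_eq_norm_sq_to_K]
    simp
  let D : ℝ := ∑ i ∈ x.support, ∑ j ∈ x.support, M * R ^ (j.length + i.length) * ‖x i‖ * ‖x j‖
  have hbound : ∀ m, ‖a m‖ ≤ D * (R ^ (2 * α.length)) ^ m := by
    intro m
    simp only [a, D, Finset.sum_mul]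
    refine norm_sum_le_of_le _ fun i _ => norm_sum_le_of_le _ fun j _ => ?_
    split_ifs
    · refine (norm_inner_le_norm _ _).trans ((mul_le_mul_of_nonneg_right
        ((c _).le_of_opNorm_le (hc _) _) (norm_nonneg _)).trans_eq ?_)
      simp only [List.length_append, Word.length_adj, Word.length_sqPow]
      rw [← pow_mul]
      ring
    · rw [norm_zero]
      positivity
  have hpos : ∀ m, ‖synth (v m) x‖ ^ 2 = ‖a (m + m)‖ := by
    intro m
    rw [← hinner, inner_self_eq_norm_sq_to_K]
    simp
  have hcs : ∀ m, ‖a m‖ ^ 2 ≤ ‖a 0‖ * ‖a (m + m)‖ := by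
    intro m
    have h1 := norm_inner_le_norm (𝕜 := ℂ) (synth (v 0) x) (synth (v m) x)
    rw [hinner, add_zero] at h1
    calc ‖a m‖ ^ 2 ≤ (‖synth (v 0) x‖ * ‖synth (v m) x‖) ^ 2 := by gcongr
      _ = _ := by rw [mul_pow, hpos, hpos]
  -- Cauchy-Schwarz is used along the moments of orders `1, 2, 4, …`. The constant `D` depends on
  -- `x` but does not enter the conclusion.
  have key := le_mul_of_sq_le (a := ‖a 0‖) (q := R ^ (2 * α.length)) (D := D)
    (b := fun k => ‖a (2 ^ k)‖) (by positivity) (norm_nonneg _) (fun _ => norm_nonneg _)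
    (fun k => by rw [pow_succ 2, mul_two]; exact hcs _) (fun k => hbound _)
  simp only [pow_zero] at key
  rw [← hone, ← add_zero 0, ← hpos, hv0, mul_comm 2, pow_mul, ← mul_pow, mul_comm] at key
  exact le_of_sq_le_sq key (by positivity)

open Classical in
/-- The operators `T_α`. -/
def shiftCoeff (α : Word d) : Hminus c →L[ℂ] Hplus c :=
  if α.IsAnalytic ∧ α ≠ [] then (synth (shiftVec c α)).extendOfNorm (synth (vecMinus c)) else 0

theorem isShiftFamily_shiftCoeff {M R : ℝ} (hM : 0 < M) (hR : 0 < R) (hc : GrowthBound c M R) :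
    IsShiftFamily c (shiftCoeff c) := by
  refine ⟨fun α h h' β hβ w => ?_, fun α h => if_neg h⟩
  rw [shiftCoeff, if_pos ⟨h, h'⟩, ← synth_single (vecMinus c),
    LinearMap.extendOfNorm_eq (denseRange_synth_vecMinus c)
      ⟨_, norm_synth_shiftVec_le c hM hR hc h h'⟩, synth_single, shiftVec, if_pos hβ]

variable {c} {T : Word d → Hminus c →L[ℂ] Hplus c}

theorem IsShiftFamily.unique {T' : Word d → Hminus c →L[ℂ] Hplus c} (hT : IsShiftFamily c T)
    (hT' : IsShiftFamily c T') : T = T' := by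
  ext1 α
  by_cases h : α.IsAnalytic ∧ α ≠ []
  · refine ext_of_denseRange_synth (denseRange_synth_vecMinus c) fun β w => ?_
    by_cases hβ : β.StartsCoanalytic
    · rw [hT.1 α h.1 h.2 β hβ, hT'.1 α h.1 h.2 β hβ]
    · rw [vecMinus_of_not c hβ]; simp
  · rw [hT.2 α h, hT'.2 α h]

theorem IsShiftFamily.norm_le (hT : IsShiftFamily c T) {M R : ℝ} (hM : 0 < M) (hR : 0 < R)
    (hc : GrowthBound c M R) (α : Word d) : ‖T α‖ ≤ R ^ α.length := by
  rw [hT.unique (isShiftFamily_shiftCoeff c hM hR hc), shiftCoeff]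
  split_ifs with h
  · exact LinearMap.opNorm_extendOfNorm_le (denseRange_synth_vecMinus c) (by positivity)
      (norm_synth_shiftVec_le c hM hR hc h.1 h.2)
  · exact (ContinuousLinearMap.opNorm_zero (𝕜 := ℂ)).trans_le (by positivity)

/-- Against `[γ ⊗ u]` both sides give the coefficient at `γ^* α^* β`. -/
theorem IsShiftFamily.adjoint_vecPlus (hT : IsShiftFamily c T) {α β : Word d} (h : α.IsAnalytic)
    (h' : α ≠ []) (hβ : β.StartsAnalytic) (w : K) :
    (T α).adjoint (vecPlus c β w) = vecMinus c (α.adj ++ β) w := by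
  refine eq_of_inner_eq (denseRange_synth_vecMinus c) fun γ u => ?_
  by_cases hγ : γ.StartsCoanalytic
  · rw [ContinuousLinearMap.adjoint_inner_left, hT.1 α h h' γ hγ,
      inner_vecPlus c (h.startsAnalytic_append h' _) hβ,
      inner_vecMinus c hγ (Word.IsCoanalytic.startsCoanalytic_append
        (Word.isCoanalytic_adj.2 h) (mt Word.adj_eq_nil.1 h') _), Word.adj_append,
      List.append_assoc]
  · rw [vecMinus_of_not c hγ]; simp

end Shift

/-! ### Splitting words into blocks of analytic and of coanalytic letters -/

section Blocks

/-- All letters are analytic (`ε = true`), or all are coanalytic (`ε = false`). -/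
def Word.IsPure (ε : Bool) (α : Word d) : Prop := ∀ l ∈ α, l.isLeft = ε

/-- The word is nonempty, and its first letter is analytic (`ε = true`) or coanalytic
(`ε = false`). -/
def Word.Starts (ε : Bool) (α : Word d) : Prop := ∃ l β, α = l :: β ∧ l.isLeft = ε

variable {ε : Bool} {α β γ : Word d}

theorem Word.isPure_true : α.IsPure true ↔ α.IsAnalytic := Iff.rfl

theorem Word.isPure_false : α.IsPure false ↔ α.IsCoanalytic := by
  simp [Word.IsPure, Word.IsCoanalytic]

theorem Word.starts_true : α.Starts true ↔ α.StartsAnalytic := by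
  constructor
  · rintro ⟨i | i, β, rfl, h⟩
    · exact ⟨i, β, rfl⟩
    · simp at h
  · rintro ⟨i, β, rfl⟩
    exact ⟨_, β, rfl, rfl⟩

theorem Word.starts_false : α.Starts false ↔ α.StartsCoanalytic := by
  constructor
  · rintro ⟨i | i, β, rfl, h⟩
    · simp at h
    · exact ⟨i, β, rfl⟩
  · rintro ⟨i, β, rfl⟩
    exact ⟨_, β, rfl, rfl⟩

theorem Word.IsPure.starts_append (h : α.IsPure ε) (h' : α ≠ []) (β : Word d) :
    (α ++ β : Word d).Starts ε := by
  cases α with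
  | nil => exact absurd rfl h'
  | cons l α => exact ⟨l, α ++ β, rfl, h l List.mem_cons_self⟩

theorem Word.IsPure.starts (h : α.IsPure ε) (h' : α ≠ []) : α.Starts ε := by
  simpa using h.starts_append h' []

theorem Word.Starts.ne_nil (h : α.Starts ε) : α ≠ [] := by
  obtain ⟨l, β, rfl, -⟩ := h
  simp

theorem Word.Starts.not_starts (h : α.Starts ε) : ¬α.Starts (!ε) := by
  rintro ⟨l, β, rfl, h1⟩
  obtain ⟨l', β', h2, h3⟩ := h
  rw [List.cons.injEq] at h2
  rw [← h2.1, h1] at h3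
  simp at h3

theorem Word.Starts.not_isPure (h : α.Starts ε) : ¬α.IsPure (!ε) := fun h' =>
  h.not_starts (h'.starts h.ne_nil)

theorem Word.not_isPure_append (hβ : β.Starts (!ε)) : ¬(α ++ β : Word d).IsPure ε := by
  obtain ⟨l, β, rfl, h⟩ := hβ
  intro h1
  rw [h1 l (by simp)] at h
  simp at h

/-- The block `α` is the longest initial piece with letters of the first type; if it is not the
whole word, the rest starts with the other type. -/
theorem Word.Starts.isPure_or (h : γ.Starts ε) : γ.IsPure ε ∨ ∃ α β : Word d, γ = α ++ β ∧
    α.IsPure ε ∧ α ≠ [] ∧ β.Starts (!ε) := by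
  induction γ with
  | nil => exact absurd rfl h.ne_nil
  | cons l γ ih =>
    have hl : l.isLeft = ε := by
      obtain ⟨l', β, h1, h2⟩ := h
      rw [List.cons.injEq] at h1
      rw [h1.1, h2]
    cases γ with
    | nil => exact .inl (by simpa [Word.IsPure] using hl)
    | cons l' γ =>
      by_cases hl' : l'.isLeft = ε
      · rcases ih ⟨l', γ, rfl, hl'⟩ with h1 | ⟨α, β, h1, h2, h3, h4⟩
        · refine .inl fun m hm => ?_
          rcases List.mem_cons.1 hm with rfl | hm
          · exact hl
          · exact h1 m hm
        · refine .inr ⟨l :: α, β, by rw [h1, List.cons_append], fun m hm => ?_, by simp, h4⟩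
          rcases List.mem_cons.1 hm with rfl | hm
          · exact hl
          · exact h2 m hm
      · exact .inr ⟨[l], l' :: γ, rfl, by simpa [Word.IsPure] using hl, by simp, l', γ, rfl,
          by simpa [Bool.eq_not] using hl'⟩

variable {E F G : Type*} [NormedAddCommGroup E] [InnerProductSpace ℂ E]
  [NormedAddCommGroup F] [InnerProductSpace ℂ F] [NormedAddCommGroup G] [InnerProductSpace ℂ G]
  {a : Word d → F →L[ℂ] G} {b : Word d → E →L[ℂ] F}

theorem conv_eq_zero (ha : ∀ γ, a γ ≠ 0 → γ.IsPure ε) (ha0 : a [] = 0)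
    (h : ∀ α β : Word d, γ = α ++ β → α.IsPure ε → α ≠ [] → b β = 0) : conv a b γ = 0 := by
  refine Finset.sum_eq_zero fun p _ => ?_
  by_cases h1 : a (γ.take p.1) = 0
  · rw [h1, ContinuousLinearMap.zero_comp]
  · rw [h _ _ (List.take_append_drop p.1 γ).symm (ha _ h1)
      (fun h2 => h1 (by rw [h2, ha0])), ContinuousLinearMap.comp_zero]

theorem conv_eq_zero_of_not_starts (ha : ∀ γ, a γ ≠ 0 → γ.IsPure ε) (ha0 : a [] = 0)
    (h : ¬γ.Starts ε) : conv a b γ = 0 :=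
  conv_eq_zero ha ha0 fun _ β h1 h2 h3 => absurd (h1 ▸ h2.starts_append h3 β) h

theorem conv_eq_zero_of_isPure (ha : ∀ γ, a γ ≠ 0 → γ.IsPure ε) (ha0 : a [] = 0)
    (hb : ∀ γ, b γ ≠ 0 → γ.Starts (!ε)) (h : γ.IsPure ε) : conv a b γ = 0 :=
  conv_eq_zero ha ha0 fun α β h1 _ _ => by
    by_contra h4
    exact Word.not_isPure_append (α := α) (hb β h4) (h1 ▸ h)

/-- Only the cut at the end of the first block survives: an earlier cut leaves a right factor
starting with the wrong type, and a later cut puts a letter of the wrong type into the left factor.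
-/
theorem conv_append (ha : ∀ γ, a γ ≠ 0 → γ.IsPure ε) (hb : ∀ γ, b γ ≠ 0 → γ.Starts (!ε))
    (hα : α.IsPure ε) (hβ : β.Starts (!ε)) : conv a b (α ++ β) = a α ∘L b β := by
  rw [conv, Finset.sum_eq_single (α.length, β.length)]
  · simp
  · rintro ⟨i, j⟩ hp hne
    rw [Finset.HasAntidiagonal.mem_antidiagonal, List.length_append] at hp
    dsimp only at hp ⊢
    rcases lt_trichotomy i α.length with h | rfl | h
    · rw [show b ((α ++ β).drop i) = 0 from ?_, ContinuousLinearMap.comp_zero]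
      by_contra h1
      have h2 := hb _ h1
      rw [List.drop_append_of_le_length h.le] at h2
      have h3 : Word.IsPure ε (α.drop i) := fun l hl => hα l (List.mem_of_mem_drop hl)
      exact (h3.starts_append (by simpa using h) β).not_starts h2
    · exact absurd (by rw [Prod.mk.injEq]; omega) hne
    · rw [show a ((α ++ β).take i) = 0 from ?_, ContinuousLinearMap.zero_comp]
      by_contra h1
      have h2 := ha _ h1
      rw [List.take_append, List.take_of_length_le h.le] at h2
      refine Word.not_isPure_append (α := α) (β := β.take (i - α.length)) ?_ h2
      obtain ⟨l, β, rfl, hl⟩ := hβ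
      obtain ⟨k, hk⟩ := Nat.exists_eq_succ_of_ne_zero (Nat.sub_ne_zero_of_lt h)
      rw [hk]
      exact ⟨l, _, rfl, hl⟩
  · simp

variable {S : Word d → F →L[ℂ] G} {x v : Word d → E →L[ℂ] G} {y : Word d → E →L[ℂ] F}

theorem starts_of_eq_add_conv (hx : x = v + conv S y) (hS : ∀ γ, S γ ≠ 0 → γ.IsPure ε)
    (hS0 : S [] = 0) (hv : ∀ γ, v γ ≠ 0 → γ.IsPure ε) (hv0 : v [] = 0) (γ : Word d)
    (h : x γ ≠ 0) : γ.Starts ε := by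
  by_contra h1
  rw [hx, Pi.add_apply, conv_eq_zero_of_not_starts hS hS0 h1, add_zero] at h
  exact h1 ((hv _ h).starts fun h2 => h (by rw [h2, hv0]))

theorem apply_isPure_of_eq_add_conv (hx : x = v + conv S y) (hS : ∀ γ, S γ ≠ 0 → γ.IsPure ε)
    (hS0 : S [] = 0) (hy : ∀ γ, y γ ≠ 0 → γ.Starts (!ε)) (h : γ.IsPure ε) : x γ = v γ := by
  rw [hx, Pi.add_apply, conv_eq_zero_of_isPure hS hS0 hy h, add_zero]

theorem apply_append_of_eq_add_conv (hx : x = v + conv S y) (hS : ∀ γ, S γ ≠ 0 → γ.IsPure ε)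
    (hy : ∀ γ, y γ ≠ 0 → γ.Starts (!ε)) (hv : ∀ γ, v γ ≠ 0 → γ.IsPure ε)
    (hα : α.IsPure ε) (hβ : β.Starts (!ε)) : x (α ++ β) = S α ∘L y β := by
  rw [hx, Pi.add_apply, conv_append hS hy hα hβ, add_eq_right]
  by_contra h
  exact Word.not_isPure_append hβ (hv _ h)

/-- A word starting with type `ε` is either pure, where only `v` contributes, or has a unique first
block, where only the product contributes. The fixed-point equation is therefore a statement about
shifting by one block. -/
theorem eq_add_conv (hx : ∀ γ, x γ ≠ 0 → γ.Starts ε) (hS : ∀ γ, S γ ≠ 0 → γ.IsPure ε)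
    (hS0 : S [] = 0) (hv : ∀ γ, v γ ≠ 0 → γ.IsPure ε) (hv0 : v [] = 0)
    (hy : ∀ γ, y γ ≠ 0 → γ.Starts (!ε)) (hxv : ∀ γ : Word d, γ.IsPure ε → γ ≠ [] → x γ = v γ)
    (hxS : ∀ α β : Word d, α.IsPure ε → α ≠ [] → β.Starts (!ε) → x (α ++ β) = S α ∘L y β) :
    x = v + conv S y := by
  ext1 γ
  rw [Pi.add_apply]
  by_cases h : γ.Starts ε
  · rcases h.isPure_or with h1 | ⟨α, β, rfl, h2, h3, h4⟩
    · rw [hxv γ h1 h.ne_nil, conv_eq_zero_of_isPure hS hS0 hy h1, add_zero]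
    · rw [hxS α β h2 h3 h4, conv_append hS hy h2 h4, right_eq_add]
      by_contra h5
      exact Word.not_isPure_append h4 (hv _ h5)
  · rw [conv_eq_zero_of_not_starts hS hS0 h, add_zero]
    by_cases h1 : x γ = 0
    · rw [h1, eq_comm]
      by_contra h2
      exact h ((hv _ h2).starts fun h3 => h2 (by rw [h3, hv0]))
    · exact absurd (hx γ h1) h

end Blocks

section Adjoint

variable {E F : Type*} [NormedAddCommGroup E] [InnerProductSpace ℂ E] [CompleteSpace E]
  [NormedAddCommGroup F] [InnerProductSpace ℂ F] [CompleteSpace F] {a : Word d → E →L[ℂ] F}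

theorem Word.isPure_adj {ε : Bool} {α : Word d} : α.adj.IsPure (!ε) ↔ α.IsPure ε := by
  cases ε
  · rw [Bool.not_false, Word.isPure_true, Word.isPure_false, Word.isAnalytic_adj]
  · rw [Bool.not_true, Word.isPure_true, Word.isPure_false, Word.isCoanalytic_adj]

theorem adjSeries_adj (a : Word d → E →L[ℂ] F) (α : Word d) :
    adjSeries a α.adj = (a α).adjoint := by
  rw [adjSeries, Word.adj_adj]

theorem adjSeries_nil (h : a [] = 0) : adjSeries a [] = 0 := by
  rw [adjSeries, Word.adj_nil, h, map_zero]

theorem adjSeries_ne_zero {ε : Bool} (ha : ∀ γ, a γ ≠ 0 → γ.IsPure ε) (γ : Word d)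
    (h : adjSeries a γ ≠ 0) : γ.IsPure (!ε) := by
  rw [← Word.adj_adj γ, Word.isPure_adj]
  refine ha _ fun h1 => h ?_
  rw [adjSeries, h1, map_zero]

end Adjoint

/-! ### The realization -/

theorem norm_ncEval_lt_one {E F : Type*} [NormedAddCommGroup E] [InnerProductSpace ℂ E]
    [NormedAddCommGroup F] [InnerProductSpace ℂ F] {T : Word d → E →L[ℂ] F} (hT : T [] = 0)
    {Z : MatTuple d n} {A q : ℝ} (hA : 0 ≤ A) (hq : 0 ≤ q) (h : ∀ k, ‖homPart T k Z‖ ≤ A * q ^ k)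
    (hAq : (A + 1) * q < 1) : ‖ncEval T Z‖ < 1 := by
  have hq1 : q < 1 := by nlinarith
  -- The part of degree `0` vanishes, so the majorant is `A q / (1 - q)`, which is below `1` exactly
  -- when `(A + 1) q < 1`.
  have h1 := ((hasSum_geometric_of_lt_one hq hq1).sub (hasSum_ite_eq 0 (1 : ℝ))).mul_left A
  refine (tsum_of_norm_bounded h1 fun k => ?_).trans_lt ?_
  · rcases k with _ | k
    · have : homPart T 0 Z = 0 := by
        simp [homPart, hT, tens_zero_right]
      rw [this]
      simp
    · simpa using h (k + 1)
  · have h2 : 0 < 1 - q := by linarith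
    have : A * ((1 - q)⁻¹ - 1) = A * q / (1 - q) := by
      field_simp
      ring
    rw [this, div_lt_one h2]
    linarith

section Realization

variable {K : Type*} [NormedAddCommGroup K] [InnerProductSpace ℂ K] [CompleteSpace K]
  {c : Word d → K →L[ℂ] K} {M R : ℝ}

theorem GrowthBound.gCoeff (hM : 0 ≤ M) (hR : 0 ≤ R) (hc : GrowthBound c M R) :
    GrowthBound (gCoeff c) (2 * M) R := by
  intro α
  have h1 : 0 ≤ M * R ^ α.length := by positivity
  have h2 := hc α
  rw [NCPsh.gCoeff]
  split_ifs with h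
  · subst h
    linarith
  · rw [norm_smul, RCLike.norm_ofNat]
    linarith
  · rw [norm_zero]
    linarith

/-- On nonempty pure words only one of `g` and its adjoint series is nonzero, so the factor `2` in
`g` cancels the half. At the empty word both contribute `c []`, which is self-adjoint. -/
theorem adjSeries_gCoeff_add (hself : adjSeries c = c) {γ : Word d}
    (h : γ = [] ∨ γ.IsAnalytic ∨ γ.IsCoanalytic) :
    (2 : ℂ)⁻¹ • (gCoeff c γ + adjSeries (gCoeff c) γ) = c γ := by
  have h2 : (2 : ℂ)⁻¹ • (2 : ℂ) • c γ = c γ := by rw [smul_smul]; norm_num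
  by_cases h0 : γ = []
  · subst h0
    rw [adjSeries, Word.adj_nil, gCoeff, if_pos rfl]
    have h3 := apply_adj hself []
    rw [Word.adj_nil] at h3
    rw [← h3, ← two_smul ℂ, h2]
  · rw [adjSeries, gCoeff, gCoeff, if_neg h0, if_neg (mt Word.adj_eq_nil.1 h0)]
    obtain ⟨l, α, rfl⟩ := List.exists_cons_of_ne_nil h0
    rcases (h.resolve_left h0) with h | h
    · have h' : ¬(Word.adj (l :: α)).IsAnalytic := by
        rw [Word.isAnalytic_adj]
        intro h4
        have h5 := h l List.mem_cons_self
        have h6 := h4 l List.mem_cons_self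
        cases l <;> simp_all
      rw [if_pos h, if_neg h', map_zero, add_zero, h2]
    · have h' : ¬Word.IsAnalytic (l :: α) := by
        intro h4
        have h5 := h l List.mem_cons_self
        have h6 := h4 l List.mem_cons_self
        cases l <;> simp_all
      rw [if_neg h', if_pos (Word.isAnalytic_adj.2 h), map_smulₛₗ, zero_add, ← apply_adj hself,
        Word.adj_adj, Complex.conj_ofNat, h2]

theorem adjSeries_gCoeff_add_eq_zero {γ : Word d} (h0 : γ ≠ []) (h : ¬γ.IsAnalytic)
    (h' : ¬γ.IsCoanalytic) : gCoeff c γ + adjSeries (gCoeff c) γ = 0 := by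
  rw [adjSeries, gCoeff, gCoeff, if_neg h0, if_neg (mt Word.adj_eq_nil.1 h0), if_neg h,
    if_neg (by rwa [Word.isAnalytic_adj]), map_zero, add_zero]

section Plus

variable [Fact (Cplus c).PosSemidef]

/-- The squared norm of `[α ⊗ w]` is `⟨c_{α^* α} w, w⟩`, and `α^* α` has length `2|α|`. -/
theorem GrowthBound.vecPlus (hM : 0 ≤ M) (hR : 0 ≤ R) (hc : GrowthBound c M R) :
    GrowthBound (vecPlus c) √M R := by
  intro α
  refine ContinuousLinearMap.opNorm_le_bound _ (by positivity) fun w => ?_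
  by_cases h : α.StartsAnalytic
  · refine le_of_sq_le_sq ?_ (by positivity)
    have h1 : (‖NCPsh.vecPlus c α w‖ ^ 2 : ℝ) = ‖(inner ℂ (c (α.adj ++ α) w) w : ℂ)‖ := by
      rw [← inner_vecPlus c h h, inner_self_eq_norm_sq_to_K]
      simp
    rw [h1]
    refine (norm_inner_le_norm _ _).trans ((mul_le_mul_of_nonneg_right
        ((c _).le_of_opNorm_le (hc _) _) (norm_nonneg _)).trans_eq ?_)
    rw [mul_pow, mul_pow, Real.sq_sqrt hM, List.length_append, Word.length_adj]
    ring
  · rw [vecPlus_of_not c h, zero_apply, norm_zero]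
    positivity

theorem GrowthBound.vplusCoeff (hM : 0 ≤ M) (hR : 0 ≤ R) (hc : GrowthBound c M R) :
    GrowthBound (vplusCoeff c) √M R := by
  intro α
  rw [NCPsh.vplusCoeff]
  split_ifs
  · exact hc.vecPlus hM hR α
  · exact (ContinuousLinearMap.opNorm_zero (𝕜 := ℂ)).trans_le (by positivity)

theorem vecPlus_ne_zero (γ : Word d) (h : vecPlus c γ ≠ 0) : γ.Starts true := by
  rw [Word.starts_true]
  by_contra h1
  exact h (vecPlus_of_not c h1)

theorem vplusCoeff_ne_zero (γ : Word d) (h : vplusCoeff c γ ≠ 0) : γ.IsPure true := by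
  rw [Word.isPure_true]
  by_contra h1
  exact h (if_neg fun h2 => h1 h2.1)

end Plus

section Minus

variable [Fact (Cminus c).PosSemidef]

theorem GrowthBound.vecMinus (hM : 0 ≤ M) (hR : 0 ≤ R) (hc : GrowthBound c M R) :
    GrowthBound (vecMinus c) √M R := by
  intro α
  refine ContinuousLinearMap.opNorm_le_bound _ (by positivity) fun w => ?_
  by_cases h : α.StartsCoanalytic
  · refine le_of_sq_le_sq ?_ (by positivity)
    have h1 : (‖NCPsh.vecMinus c α w‖ ^ 2 : ℝ) = ‖(inner ℂ (c (α.adj ++ α) w) w : ℂ)‖ := by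
      rw [← inner_vecMinus c h h, inner_self_eq_norm_sq_to_K]
      simp
    rw [h1]
    refine (norm_inner_le_norm _ _).trans ((mul_le_mul_of_nonneg_right
        ((c _).le_of_opNorm_le (hc _) _) (norm_nonneg _)).trans_eq ?_)
    rw [mul_pow, mul_pow, Real.sq_sqrt hM, List.length_append, Word.length_adj]
    ring
  · rw [vecMinus_of_not c h, zero_apply, norm_zero]
    positivity

theorem GrowthBound.vminusCoeff (hM : 0 ≤ M) (hR : 0 ≤ R) (hc : GrowthBound c M R) :
    GrowthBound (vminusCoeff c) √M R := by
  intro α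
  rw [NCPsh.vminusCoeff]
  split_ifs
  · exact hc.vecMinus hM hR α
  · exact (ContinuousLinearMap.opNorm_zero (𝕜 := ℂ)).trans_le (by positivity)

theorem vecMinus_ne_zero (γ : Word d) (h : vecMinus c γ ≠ 0) : γ.Starts false := by
  rw [Word.starts_false]
  by_contra h1
  exact h (vecMinus_of_not c h1)

theorem vminusCoeff_ne_zero (γ : Word d) (h : vminusCoeff c γ ≠ 0) : γ.IsPure false := by
  rw [Word.isPure_false]
  by_contra h1
  exact h (if_neg fun h2 => h1 h2.1)

end Minus

variable [Fact (Cplus c).PosSemidef] [Fact (Cminus c).PosSemidef]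
  {T : Word d → Hminus c →L[ℂ] Hplus c}

/-- A mixed word splits as first block `α` and remainder `β`. Its coefficient on the left is
`Q_{α^*}^* [β ⊗ ·]`, which equals `c (α ++ β)` by the inner product of `H⁺` or `H⁻`, according to
the type of `β`. -/
theorem formalRealize_eq (hself : adjSeries c = c) :
    formalRealize (gCoeff c) (vplusCoeff c) (vecPlus c) (vminusCoeff c) (vecMinus c) = c := by
  have hvp0 : vplusCoeff c [] = 0 := if_neg fun h => h.2 rfl
  have hvm0 : vminusCoeff c [] = 0 := if_neg fun h => h.2 rfl
  have hp := adjSeries_ne_zero (vplusCoeff_ne_zero (c := c))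
  have hm := adjSeries_ne_zero (vminusCoeff_ne_zero (c := c))
  ext1 γ
  simp only [formalRealize, Pi.add_apply, Pi.smul_apply]
  by_cases h0 : γ = []
  · rw [adjSeries_gCoeff_add hself (.inl h0), conv_eq_zero_of_not_starts hp (adjSeries_nil hvp0),
      conv_eq_zero_of_not_starts hm (adjSeries_nil hvm0), add_zero, add_zero]
    all_goals exact fun h => h.ne_nil h0
  obtain ⟨l, γ', hγ⟩ := List.exists_cons_of_ne_nil h0
  rcases hl : l.isLeft with _ | _
  · have h1 : γ.Starts false := ⟨l, γ', hγ, hl⟩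
    rw [conv_eq_zero_of_not_starts hm (adjSeries_nil hvm0) h1.not_starts, add_zero]
    rcases h1.isPure_or with h2 | ⟨α, β, rfl, h2, h3, h4⟩
    · rw [adjSeries_gCoeff_add hself (.inr (.inr (Word.isPure_false.1 h2))),
        conv_eq_zero_of_isPure hp (adjSeries_nil hvp0) vecPlus_ne_zero h2, add_zero]
    · rw [adjSeries_gCoeff_add_eq_zero h0 h1.not_isPure
        (Word.isPure_false.not.1 (Word.not_isPure_append h4)), smul_zero, zero_add,
        conv_append hp vecPlus_ne_zero h2 h4, adjSeries]
      have h5 : α.adj.IsAnalytic := Word.isAnalytic_adj.2 (Word.isPure_false.1 h2)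
      have h6 : α.adj ≠ [] := mt Word.adj_eq_nil.1 h3
      refine ContinuousLinearMap.ext fun w => ext_inner_right ℂ fun u => ?_
      rw [ContinuousLinearMap.comp_apply, ContinuousLinearMap.adjoint_inner_left, vplusCoeff,
        if_pos ⟨h5, h6⟩, inner_vecPlus c (by simpa using h5.startsAnalytic_append h6 [])
        (Word.starts_true.1 h4), Word.adj_adj]
  · have h1 : γ.Starts true := ⟨l, γ', hγ, hl⟩
    rw [conv_eq_zero_of_not_starts hp (adjSeries_nil hvp0) h1.not_starts, zero_add]
    rcases h1.isPure_or with h2 | ⟨α, β, rfl, h2, h3, h4⟩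
    · rw [adjSeries_gCoeff_add hself (.inr (.inl h2)),
        conv_eq_zero_of_isPure hm (adjSeries_nil hvm0) vecMinus_ne_zero h2, add_zero]
    · rw [adjSeries_gCoeff_add_eq_zero h0 (Word.not_isPure_append (ε := true) h4)
        (Word.isPure_false.not.1 h1.not_isPure), smul_zero, zero_add,
        conv_append hm vecMinus_ne_zero h2 h4, adjSeries]
      have h5 : α.adj.IsCoanalytic := Word.isCoanalytic_adj.2 h2
      have h6 : α.adj ≠ [] := mt Word.adj_eq_nil.1 h3
      refine ContinuousLinearMap.ext fun w => ext_inner_right ℂ fun u => ?_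
      rw [ContinuousLinearMap.comp_apply, ContinuousLinearMap.adjoint_inner_left, vminusCoeff,
        if_pos ⟨h5, h6⟩, inner_vecMinus c (by simpa using h5.startsCoanalytic_append h6 [])
        (Word.starts_false.1 h4), Word.adj_adj]

namespace IsShiftFamily

theorem ne_zero (hT : IsShiftFamily c T) (γ : Word d) (h : T γ ≠ 0) : γ.IsPure true := by
  rw [Word.isPure_true]
  by_contra h1
  exact h (hT.2 _ fun h2 => h1 h2.1)

theorem apply_nil (hT : IsShiftFamily c T) : T [] = 0 := hT.2 _ fun h => h.2 rfl

theorem bddAbove (hT : IsShiftFamily c T) (hM : 0 < M) (hR : 0 < R) (hc : GrowthBound c M R) :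
    BddAbove ((fun α : Word d => ‖T α‖ ^ (1 / (α.length : ℝ))) ''
      {α | α.IsAnalytic ∧ α ≠ []}) := by
  refine ⟨R, ?_⟩
  rintro _ ⟨α, ⟨-, hα⟩, rfl⟩
  have h1 := Real.rpow_le_rpow (ContinuousLinearMap.opNorm_nonneg _) (hT.norm_le hM hR hc α)
    (z := 1 / (α.length : ℝ)) (by positivity)
  rwa [one_div, Real.pow_rpow_inv_natCast hR.le (by simpa using hα), ← one_div] at h1

theorem growthBound (hT : IsShiftFamily c T) (hM : 0 < M) (hR : 0 < R)
    (hc : GrowthBound c M R) : GrowthBound T 1 R := fun α => by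
  rw [one_mul]
  exact hT.norm_le hM hR hc α

theorem norm_ncEval_lt_one (hT : IsShiftFamily c T) (hM : 0 < M) (hR : 0 < R)
    (hc : GrowthBound c M R) {Z : MatTuple d n} (hZ : 4 * d * R * ‖Z‖ < 1) : ‖ncEval T Z‖ < 1 :=
  NCPsh.norm_ncEval_lt_one hT.apply_nil zero_le_one (by positivity)
    ((hT.growthBound hM hR hc).norm_homPart_le Z) (by linarith)

theorem vecPlus_eq (hT : IsShiftFamily c T) :
    vecPlus c = vplusCoeff c + conv T (vecMinus c) := by
  refine eq_add_conv (ε := true) vecPlus_ne_zero hT.ne_zero hT.apply_nil vplusCoeff_ne_zero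
    (if_neg fun h => h.2 rfl) vecMinus_ne_zero (fun γ h h' => (if_pos ⟨h, h'⟩).symm) ?_
  intro α β hα hα' hβ
  exact ContinuousLinearMap.ext fun w => (hT.1 α hα hα' β (Word.starts_false.1 hβ) w).symm

theorem vecMinus_eq (hT : IsShiftFamily c T) :
    vecMinus c = vminusCoeff c + conv (adjSeries T) (vecPlus c) := by
  refine eq_add_conv (ε := false) vecMinus_ne_zero (adjSeries_ne_zero hT.ne_zero)
    (adjSeries_nil hT.apply_nil) vminusCoeff_ne_zero (if_neg fun h => h.2 rfl) vecPlus_ne_zero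
    (fun γ h h' => (if_pos ⟨Word.isPure_false.1 h, h'⟩).symm) ?_
  intro α β hα hα' hβ
  refine ContinuousLinearMap.ext fun w => ?_
  have := hT.adjoint_vecPlus (Word.isAnalytic_adj.2 (Word.isPure_false.1 hα))
    (mt Word.adj_eq_nil.1 hα') (Word.starts_true.1 hβ) w
  rw [Word.adj_adj] at this
  exact this.symm

theorem isUnit_and_ncEval_eq (hT : IsShiftFamily c T) (hM : 0 < M) (hR : 0 < R)
    (hc : GrowthBound c M R) (hself : adjSeries c = c) {Z : MatTuple d n}
    (hZ : 4 * d * R * ‖Z‖ < 1) :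
    IsUnit (blockOp (ncEval T Z)) ∧ ncEval c Z = realize (ncEval (gCoeff c) Z)
      (ncEval (vplusCoeff c) Z) (ncEval (vminusCoeff c) Z) (ncEval T Z) := by
  have hZ2 : 2 * d * R * ‖Z‖ < 1 := by
    have : 0 ≤ d * R * ‖Z‖ := by positivity
    linarith
  have hu := isUnit_blockOp (hT.norm_ncEval_lt_one hM hR hc hZ)
  refine ⟨hu, ?_⟩
  have h := hasSum_homPart_formalRealize hT.vecPlus_eq hT.vecMinus_eq
    ((hc.gCoeff hM.le hR.le).summable_norm_homPart hR.le hZ2)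
    ((hT.growthBound hM hR hc).summable_norm_homPart hR.le hZ2)
    ((hc.vplusCoeff hM.le hR.le).summable_norm_homPart hR.le hZ2)
    ((hc.vminusCoeff hM.le hR.le).summable_norm_homPart hR.le hZ2)
    ((hc.vecPlus hM.le hR.le).summable_norm_homPart hR.le hZ2)
    ((hc.vecMinus hM.le hR.le).summable_norm_homPart hR.le hZ2) hu
  rw [formalRealize_eq hself] at h
  exact h.tsum_eq

end IsShiftFamily

end Realization

/-! ### Formal solutions of the realization equations -/

section Formal

variable {E F G : Type*} [NormedAddCommGroup E] [InnerProductSpace ℂ E]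
  [NormedAddCommGroup F] [InnerProductSpace ℂ F] [NormedAddCommGroup G] [InnerProductSpace ℂ G]

/-- The coefficients of the solution of `x = v + S y`, `y = w + S' x`, if `S` and `S'` vanish at
`0`. -/
def formalSolution (v : Word d → E →L[ℂ] F) (w : Word d → E →L[ℂ] G)
    (S : Word d → G →L[ℂ] F) (S' : Word d → F →L[ℂ] G) (γ : Word d) :
    (E →L[ℂ] F) × (E →L[ℂ] G) :=
  (v γ + ∑ i : Fin γ.length,
      S (γ.take (i + 1)) ∘L (formalSolution v w S S' (γ.drop (i + 1))).2,
    w γ + ∑ i : Fin γ.length,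
      S' (γ.take (i + 1)) ∘L (formalSolution v w S S' (γ.drop (i + 1))).1)
termination_by γ.length
decreasing_by all_goals (have := i.2; simp only [List.length_drop]; omega)

/-- Since the left factor vanishes at the empty word, only strictly shorter suffixes occur on the
right. This makes the system `x = v + S y`, `y = w + S' x` solvable by recursion on length. -/
theorem conv_eq_sum_fin {a : Word d → F →L[ℂ] G} (ha : a [] = 0) (b : Word d → E →L[ℂ] F)
    (γ : Word d) :
    conv a b γ = ∑ i : Fin γ.length, a (γ.take (i + 1)) ∘L b (γ.drop (i + 1)) := by
  rw [conv, Finset.Nat.sum_antidiagonal_eq_sum_range_succ_mk, Finset.sum_range_succ',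
    Finset.sum_range]
  simp [ha]

theorem exists_formalSolution (v : Word d → E →L[ℂ] F) (w : Word d → E →L[ℂ] G)
    {S : Word d → G →L[ℂ] F} {S' : Word d → F →L[ℂ] G} (hS : S [] = 0) (hS' : S' [] = 0) :
    ∃ x y, x = v + conv S y ∧ y = w + conv S' x := by
  refine ⟨fun γ => (formalSolution v w S S' γ).1, fun γ => (formalSolution v w S S' γ).2, ?_, ?_⟩
  all_goals
    ext1 γ
    rw [Pi.add_apply, conv_eq_sum_fin (by assumption), formalSolution]

/-- One step of the majorant induction for formal solutions. In degree `k ≥ 1` the sum is at most `C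
^ (k+1) * ((1 + C) ^ (k+1) - C)`, because the geometric sum telescopes. -/
theorem norm_homPart_add_conv_le {v : Word d → E →L[ℂ] F} {S : Word d → G →L[ℂ] F}
    {y : Word d → E →L[ℂ] G} (hS : S [] = 0) {Z : MatTuple d n} {C : ℝ} (hC : 0 ≤ C)
    (hv : ∀ k, ‖homPart v k Z‖ ≤ C ^ (k + 1)) (hSC : ∀ k, ‖homPart S k Z‖ ≤ C ^ (k + 1)) (k : ℕ)
    (hy : ∀ j < k, ‖homPart y j Z‖ ≤ (C * (1 + C)) ^ (j + 1)) :
    ‖homPart (v + conv S y) k Z‖ ≤ (C * (1 + C)) ^ (k + 1) := by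
  rw [homPart_add, homPart_conv]
  rcases k with _ | k
  · have : homPart S 0 Z = 0 := by simp [homPart, hS, tens_zero_right]
    simp only [Finset.Nat.antidiagonal_zero, Finset.sum_singleton, this,
      ContinuousLinearMap.zero_comp, add_zero]
    refine (hv 0).trans ?_
    rw [zero_add, pow_one, pow_one]
    nlinarith
  · have h0 : homPart S 0 Z = 0 := by simp [homPart, hS, tens_zero_right]
    rw [Finset.Nat.sum_antidiagonal_succ, h0, ContinuousLinearMap.zero_comp, zero_add]
    have h1 : ∀ p ∈ Finset.HasAntidiagonal.antidiagonal k,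
        ‖homPart S (p.1 + 1) Z ∘L homPart y p.2 Z‖ ≤ C ^ (k + 2) * (C * (1 + C) ^ (p.2 + 1)) := by
      intro p hp
      rw [Finset.HasAntidiagonal.mem_antidiagonal] at hp
      refine (ContinuousLinearMap.opNorm_comp_le _ _).trans ((mul_le_mul (hSC _)
        (hy p.2 (by omega)) (norm_nonneg _) (by positivity)).trans_eq ?_)
      rw [← hp, mul_pow]
      ring
    refine (norm_add_le_of_le (hv _) (norm_sum_le_of_le _ h1)).trans ?_
    have h2 : ∑ p ∈ Finset.HasAntidiagonal.antidiagonal k, C * (1 + C) ^ (p.2 + 1) =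
        (1 + C) ^ (k + 2) - (1 + C) := by
      clear h1 hy
      induction k with
      | zero => simp; ring
      | succ k ih =>
        rw [Finset.Nat.sum_antidiagonal_succ, ih]
        ring
    rw [← Finset.mul_sum, h2, mul_pow]
    have h3 : 0 ≤ C ^ (k + 2) * C := by positivity
    linarith

theorem norm_homPart_formalSolution_le {v x : Word d → E →L[ℂ] F} {w y : Word d → E →L[ℂ] G}
    {S : Word d → G →L[ℂ] F} {S' : Word d → F →L[ℂ] G} (hS : S [] = 0) (hS' : S' [] = 0)
    (hx : x = v + conv S y) (hy : y = w + conv S' x) {Z : MatTuple d n} {C : ℝ} (hC : 0 ≤ C)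
    (hv : ∀ k, ‖homPart v k Z‖ ≤ C ^ (k + 1)) (hw : ∀ k, ‖homPart w k Z‖ ≤ C ^ (k + 1))
    (hSC : ∀ k, ‖homPart S k Z‖ ≤ C ^ (k + 1)) (hSC' : ∀ k, ‖homPart S' k Z‖ ≤ C ^ (k + 1))
    (k : ℕ) : ‖homPart x k Z‖ ≤ (C * (1 + C)) ^ (k + 1) ∧
      ‖homPart y k Z‖ ≤ (C * (1 + C)) ^ (k + 1) := by
  induction k using Nat.strong_induction_on with
  | _ k ih =>
    constructor
    · rw [hx]
      exact norm_homPart_add_conv_le hS hC hv hSC k fun j hj => (ih j hj).2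
    · rw [hy]
      exact norm_homPart_add_conv_le hS' hC hw hSC' k fun j hj => (ih j hj).1

/-- Convergence at one point `s • Z` with `s > 0` bounds the terms, so the part of degree `k` at `Z`
is at most `A * s⁻¹ ^ k`. The exponent `k + 1` lets one constant absorb `A`, and allowing every
larger `C'` gives several series a common bound. -/
theorem ConvergesNearZero.exists_bound {a : Word d → E →L[ℂ] F} (h : ConvergesNearZero a)
    (Z : MatTuple d n) : ∃ C : ℝ, 0 ≤ C ∧ ∀ C' ≥ C, ∀ k, ‖homPart a k Z‖ ≤ C' ^ (k + 1) := by
  have h1 := (eventually_smul_of_eventually (h n) Z).filter_mono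
    (nhdsWithin_le_nhds (s := Set.Ioi 0))
  obtain ⟨s, hs, hs0⟩ := (h1.and self_mem_nhdsWithin).exists
  replace hs0 : 0 < s := hs0
  obtain ⟨A, hA⟩ := hs.tendsto_atTop_zero.norm.bddAbove_range
  have hA' : ∀ k, s ^ k * ‖homPart a k Z‖ ≤ A := fun k => by
    have := hA ⟨k, rfl⟩
    dsimp only at this
    rwa [homPart_smul, norm_smul, norm_pow, Real.norm_of_nonneg hs0.le] at this
  have hA0 : 0 ≤ A := le_trans (by positivity) (hA' 0)
  refine ⟨max A s⁻¹, by positivity, fun C' hC' k => ?_⟩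
  have h2 : A ≤ C' := (le_max_left _ _).trans hC'
  have h3 : s⁻¹ ≤ C' := (le_max_right _ _).trans hC'
  calc ‖homPart a k Z‖ = (s⁻¹) ^ k * (s ^ k * ‖homPart a k Z‖) := by
        rw [← mul_assoc, ← mul_pow, inv_mul_cancel₀ hs0.ne', one_pow, one_mul]
    _ ≤ C' ^ k * C' := by
        have h4 : 0 ≤ C' := hA0.trans h2
        exact mul_le_mul (pow_le_pow_left₀ (by positivity) h3 k) ((hA' k).trans h2) (by positivity)
          (by positivity)
    _ = _ := (pow_succ _ _).symm

theorem summable_norm_homPart_smul {a : Word d → E →L[ℂ] F} {Z : MatTuple d n} {C : ℝ}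
    (hC : 0 ≤ C) (h : ∀ k, ‖homPart a k Z‖ ≤ C ^ (k + 1)) {t : ℝ} (ht : C * |t| < 1) :
    Summable fun k => ‖homPart a k (t • Z)‖ := by
  refine .of_nonneg_of_le (fun _ => norm_nonneg _) (fun k => ?_)
    ((summable_geometric_of_lt_one (by positivity) ht).mul_left C)
  rw [homPart_smul, norm_smul, norm_pow, Real.norm_eq_abs]
  calc |t| ^ k * ‖homPart a k Z‖ ≤ |t| ^ k * C ^ (k + 1) := by
        have := h k
        gcongr
    _ = _ := by ring

variable [CompleteSpace E] [CompleteSpace F] [CompleteSpace G]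

/-- A formula that holds near `0` in every matrix size holds coefficient by coefficient. -/
theorem eq_formalRealize {c g : Word d → E →L[ℂ] E} {vp xp : Word d → E →L[ℂ] F}
    {vm xm : Word d → E →L[ℂ] G} {T : Word d → G →L[ℂ] F} (hT : T [] = 0)
    (hxp : xp = vp + conv T xm) (hxm : xm = vm + conv (adjSeries T) xp)
    (cc : ConvergesNearZero c) (cg : ConvergesNearZero g) (cvp : ConvergesNearZero vp)
    (cvm : ConvergesNearZero vm) (cT : ConvergesNearZero T)
    (h : ∀ n : ℕ, ∀ᶠ Z : MatTuple d n in 𝓝 0,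
      ncEval c Z = realize (ncEval g Z) (ncEval vp Z) (ncEval vm Z) (ncEval T Z)) :
    c = formalRealize g vp xp vm xm := by
  refine eq_of_hasSum_homPart fun n Z => ?_
  obtain ⟨Cg, hCg, hg⟩ := cg.exists_bound Z
  obtain ⟨Cp, hCp, hp⟩ := cvp.exists_bound Z
  obtain ⟨Cm, hCm, hm⟩ := cvm.exists_bound Z
  obtain ⟨CT, hCT, hTb⟩ := cT.exists_bound Z
  -- One constant for all four series at the fixed `Z`. Its dependence on `Z` and `n` is harmless,
  -- as coefficients are compared along rays.
  let C := Cg + Cp + Cm + CT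
  have hC : 0 ≤ C := by positivity
  replace hg := hg C (by simp only [C]; linarith)
  replace hp := hp C (by simp only [C]; linarith)
  replace hm := hm C (by simp only [C]; linarith)
  replace hTb := hTb C (by simp only [C]; linarith)
  have hx := norm_homPart_formalSolution_le hT (adjSeries_nil hT) hxp hxm hC hp hm hTb
    (fun k => by rw [norm_homPart_adjSeries]; exact hTb k)
  have ht : ∀ᶠ t in 𝓝 (0 : ℝ), C * (1 + C) * |t| < 1 := by
    have h1 : Continuous fun t : ℝ => C * (1 + C) * |t| := by fun_prop
    have h0 := h1.tendsto 0
    rw [abs_zero, mul_zero] at h0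
    exact h0.eventually (gt_mem_nhds one_pos)
  filter_upwards [eventually_smul_of_eventually (h n) Z,
    eventually_smul_of_eventually (cc n) Z, ht] with t ht1 ht2 ht3
  have ht4 : C * |t| < 1 := by
    have : 0 ≤ C * C * |t| := by positivity
    linarith
  have hu : ‖ncEval T (t • Z)‖ < 1 := by
    refine norm_ncEval_lt_one hT hC (q := C * |t|) (by positivity) (fun k => ?_) (by linarith)
    rw [homPart_smul, norm_smul, norm_pow, Real.norm_eq_abs]
    calc |t| ^ k * ‖homPart T k Z‖ ≤ |t| ^ k * C ^ (k + 1) := by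
          have := hTb k
          gcongr
      _ = C * (C * |t|) ^ k := by rw [mul_pow, pow_succ]; ac_rfl
  refine ⟨_, ht2.hasSum, ?_⟩
  rw [← ncEval, ht1]
  exact hasSum_homPart_formalRealize hxp hxm (summable_norm_homPart_smul hC hg ht4)
    (summable_norm_homPart_smul hC hTb ht4) (summable_norm_homPart_smul hC hp ht4)
    (summable_norm_homPart_smul hC hm ht4)
    (summable_norm_homPart_smul (by positivity) (fun k => (hx k).1) ht3)
    (summable_norm_homPart_smul (by positivity) (fun k => (hx k).2) ht3) (isUnit_blockOp hu)

end Formal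

/-! ### Uniqueness of the realization -/

section Isometry

variable {K : Type*} [NormedAddCommGroup K] [InnerProductSpace ℂ K]
  {X H H' : Type*} [NormedAddCommGroup H] [InnerProductSpace ℂ H]
  [NormedAddCommGroup H'] [InnerProductSpace ℂ H']

/-- Equal Gram matrices give equal norms of finite combinations; extend from the dense subspace. -/
theorem exists_isometry [CompleteSpace H'] {v : X → K →L[ℂ] H} {v' : X → K →L[ℂ] H'}
    (hv : DenseRange (synth v))
    (h : ∀ i j w u, inner ℂ (v i w) (v j u) = inner ℂ (v' i w) (v' j u)) :
    ∃ W : H →ₗᵢ[ℂ] H', ∀ i w, W (v i w) = v' i w := by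
  have hnorm : ∀ x, ‖synth v' x‖ = ‖synth v x‖ := fun x => by
    have h1 : (inner ℂ (synth v' x) (synth v' x) : ℂ) = inner ℂ (synth v x) (synth v x) := by
      rw [inner_synth, inner_synth]
      exact Finset.sum_congr rfl fun i _ => Finset.sum_congr rfl fun j _ => (h i j _ _).symm
    rw [norm_eq_sqrt_re_inner (𝕜 := ℂ), norm_eq_sqrt_re_inner (𝕜 := ℂ), h1]
  have hbd : ∀ x, ‖synth v' x‖ ≤ 1 * ‖synth v x‖ := fun x => by rw [one_mul, hnorm]
  let T := (synth v').extendOfNorm (synth v)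
  have hT : ∀ x, T (synth v x) = synth v' x := LinearMap.extendOfNorm_eq hv ⟨1, hbd⟩
  refine ⟨⟨T.toLinearMap, fun x => ?_⟩, fun i w => ?_⟩
  · refine hv.induction_on (p := fun x => ‖T x‖ = ‖x‖) x
      (isClosed_eq T.continuous.norm continuous_norm) fun y => ?_
    rw [hT, hnorm]
  · have := hT (Finsupp.single i w)
    rwa [synth_single, synth_single] at this

variable [CompleteSpace H]

/-- The decomposition of a Hilbert space into the range of an isometry and its orthogonal
complement. -/
theorem exists_unitary (W : H →ₗᵢ[ℂ] H') :
    ∃ U : WithLp 2 (H × (LinearMap.range W.toLinearMap)ᗮ) ≃ₗᵢ[ℂ] H',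
      ∀ x y, U (WithLp.toLp 2 (x, y)) = W x + y := by
  let L := LinearMap.range W.toLinearMap
  let f : WithLp 2 (H × Lᗮ) →ₗᵢ[ℂ] H' :=
    { toFun := fun z => W z.fst + z.snd
      map_add' := fun z z' => by simp; abel
      map_smul' := fun a z => by simp
      norm_map' := fun z => by
        have h1 : (inner ℂ (W z.fst) (z.snd : H') : ℂ) = 0 :=
          Submodule.inner_right_of_mem_orthogonal (K := L) ⟨z.fst, rfl⟩ z.snd.2
        have h2 := norm_add_sq_eq_norm_sq_add_norm_sq_of_inner_eq_zero _ _ h1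
        rw [W.norm_map, ← sq, ← sq, ← sq] at h2
        have h3 := WithLp.prod_norm_sq_eq_of_L2 z
        exact (sq_eq_sq₀ (norm_nonneg _) (norm_nonneg _)).1 (h2.trans h3.symm) }
  have hc : IsComplete (L : Set H') := by
    have : (L : Set H') = Set.range W := by ext; simp [L]
    rw [this]
    exact W.isometry.isUniformInducing.isComplete_range
  have : CompleteSpace L := hc.completeSpace_coe
  refine ⟨LinearIsometryEquiv.ofSurjective f fun z => ?_, fun x y => rfl⟩
  obtain ⟨y, ⟨x, rfl⟩, y', hy', rfl⟩ := L.exists_add_mem_mem_orthogonal z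
  exact ⟨WithLp.toLp 2 (x, ⟨y', hy'⟩), rfl⟩

end Isometry

section Compression

variable {E F E' F' : Type*} [NormedAddCommGroup E] [InnerProductSpace ℂ E]
  [NormedAddCommGroup F] [InnerProductSpace ℂ F] [NormedAddCommGroup E'] [InnerProductSpace ℂ E']
  [NormedAddCommGroup F'] [InnerProductSpace ℂ F']

theorem homPart_comp (P : F →L[ℂ] F') (a : Word d → E →L[ℂ] F) (Q : E' →L[ℂ] E) (k : ℕ)
    (Z : MatTuple d n) : homPart (fun α => P ∘L a α ∘L Q) k Z =
      tens 1 P ∘L homPart a k Z ∘L tens 1 Q := by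
  simp only [homPart, ContinuousLinearMap.finsetSum_comp, ContinuousLinearMap.comp_finsetSum,
    tens_comp, one_mul, mul_one]

theorem summable_comp_comp (P : F →L[ℂ] F') (Q : E' →L[ℂ] E) {f : ℕ → E →L[ℂ] F}
    (hf : Summable f) : Summable fun k => P ∘L f k ∘L Q :=
  (hf.mapL ((ContinuousLinearMap.compL ℂ E' E F).flip Q)).mapL
    (ContinuousLinearMap.compL ℂ E' F F' P)

theorem ConvergesNearZero.comp (P : F →L[ℂ] F') {a : Word d → E →L[ℂ] F}
    (h : ConvergesNearZero a) (Q : E' →L[ℂ] E) :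
    ConvergesNearZero fun α => P ∘L a α ∘L Q := fun n => by
  filter_upwards [h n] with Z hZ
  simp only [homPart_comp]
  exact summable_comp_comp _ _ hZ

end Compression

/-! ### Coefficients and Gram matrices of a formal realization -/

section Readout

variable {E F G : Type*} [NormedAddCommGroup E] [InnerProductSpace ℂ E] [CompleteSpace E]
  [NormedAddCommGroup F] [InnerProductSpace ℂ F] [CompleteSpace F] [NormedAddCommGroup G]
  [InnerProductSpace ℂ G] [CompleteSpace G]

theorem Word.not_isPure_mixed {ε : Bool} {α β : Word d} (hα : α.IsPure ε) (hα' : α ≠ [])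
    (hβ : β.Starts (!ε)) (δ : Bool) : ¬(α ++ β : Word d).IsPure δ := by
  by_cases h : δ = ε
  · rw [h]
    exact Word.not_isPure_append hβ
  · rw [Bool.eq_not.2 h]
    exact (hα.starts_append hα' β).not_isPure

/-- The coefficients of a formal realization at mixed words. -/
theorem formalRealize_append {ε : Bool} {g : Word d → E →L[ℂ] E} {a xa : Word d → E →L[ℂ] F}
    {b xb : Word d → E →L[ℂ] G} (hg : ∀ γ, g γ ≠ 0 → γ.IsPure true)
    (ha : ∀ γ, a γ ≠ 0 → γ.IsPure ε) (hxa : ∀ γ, xa γ ≠ 0 → γ.Starts ε)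
    (hb : ∀ γ, b γ ≠ 0 → γ.IsPure (!ε)) (hb0 : b [] = 0) {α β : Word d} (hα : α.IsPure ε)
    (hα' : α ≠ []) (hβ : β.Starts ε) :
    formalRealize g a xa b xb (α.adj ++ β) = (a α).adjoint ∘L xa β := by
  have h1 : α.adj.IsPure (!ε) := Word.isPure_adj.2 hα
  have h2 : α.adj ≠ [] := mt Word.adj_eq_nil.1 hα'
  -- A mixed word is invisible to `g` and its adjoint series, and its first letter selects one of
  -- the two products.
  have h3 : ∀ δ, ¬(α.adj ++ β : Word d).IsPure δ :=
    Word.not_isPure_mixed h1 h2 (by rwa [Bool.not_not])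
  have h4 : g (α.adj ++ β) = 0 := by
    by_contra h
    exact h3 _ (hg _ h)
  have h5 : adjSeries g (α.adj ++ β) = 0 := by
    by_contra h
    exact h3 _ (adjSeries_ne_zero hg _ h)
  have h6 : conv (adjSeries b) xb (α.adj ++ β) = 0 :=
    conv_eq_zero_of_not_starts (adjSeries_ne_zero hb) (adjSeries_nil hb0)
      (h1.starts_append h2 β).not_starts
  simp only [formalRealize, Pi.add_apply, Pi.smul_apply]
  rw [h4, h5, h6, conv_append (adjSeries_ne_zero ha) (by simpa only [Bool.not_not] using hxa) h1
    (by rwa [Bool.not_not]), adjSeries_adj]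
  simp

/-- A family of series that realizes the series `c` coefficient by coefficient. -/
structure IsFormalRealization (c g : Word d → E →L[ℂ] E) (vp xp : Word d → E →L[ℂ] F)
    (vm xm : Word d → E →L[ℂ] G) (T : Word d → G →L[ℂ] F) : Prop where
  g_pure : ∀ γ, g γ ≠ 0 → γ.IsPure true
  vp_pure : ∀ γ, vp γ ≠ 0 → γ.IsPure true
  vm_pure : ∀ γ, vm γ ≠ 0 → γ.IsPure false
  T_pure : ∀ γ, T γ ≠ 0 → γ.IsPure true
  vp_nil : vp [] = 0
  vm_nil : vm [] = 0
  T_nil : T [] = 0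
  xp_eq : xp = vp + conv T xm
  xm_eq : xm = vm + conv (adjSeries T) xp
  c_eq : c = formalRealize g vp xp vm xm

namespace IsFormalRealization

variable {c g : Word d → E →L[ℂ] E} {vp xp : Word d → E →L[ℂ] F} {vm xm : Word d → E →L[ℂ] G}
  {T : Word d → G →L[ℂ] F}

theorem xp_starts (h : IsFormalRealization c g vp xp vm xm T) : ∀ γ, xp γ ≠ 0 → γ.Starts true :=
  starts_of_eq_add_conv h.xp_eq h.T_pure h.T_nil h.vp_pure h.vp_nil

theorem xm_starts (h : IsFormalRealization c g vp xp vm xm T) :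
    ∀ γ, xm γ ≠ 0 → γ.Starts false :=
  starts_of_eq_add_conv h.xm_eq (adjSeries_ne_zero h.T_pure) (adjSeries_nil h.T_nil) h.vm_pure
    h.vm_nil

theorem xp_isPure (h : IsFormalRealization c g vp xp vm xm T) {α : Word d}
    (hα : α.IsPure true) : xp α = vp α :=
  apply_isPure_of_eq_add_conv h.xp_eq h.T_pure h.T_nil h.xm_starts hα

theorem xm_isPure (h : IsFormalRealization c g vp xp vm xm T) {α : Word d}
    (hα : α.IsPure false) : xm α = vm α :=
  apply_isPure_of_eq_add_conv h.xm_eq (adjSeries_ne_zero h.T_pure) (adjSeries_nil h.T_nil)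
    h.xp_starts hα

theorem xp_append (h : IsFormalRealization c g vp xp vm xm T) {α β : Word d}
    (hα : α.IsPure true) (hβ : β.Starts false) : xp (α ++ β) = T α ∘L xm β :=
  apply_append_of_eq_add_conv h.xp_eq h.T_pure h.xm_starts h.vp_pure hα hβ

theorem xm_append (h : IsFormalRealization c g vp xp vm xm T) {α β : Word d}
    (hα : α.IsPure false) (hβ : β.Starts true) : xm (α ++ β) = adjSeries T α ∘L xp β :=
  apply_append_of_eq_add_conv h.xm_eq (adjSeries_ne_zero h.T_pure) h.xp_starts h.vm_pure hα hβ

theorem c_append_plus (h : IsFormalRealization c g vp xp vm xm T) {α β : Word d}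
    (hα : α.IsPure true) (hα' : α ≠ []) (hβ : β.Starts true) :
    c (α.adj ++ β) = (vp α).adjoint ∘L xp β := by
  rw [h.c_eq]
  exact formalRealize_append h.g_pure h.vp_pure h.xp_starts h.vm_pure h.vm_nil hα hα' hβ

theorem c_append_minus (h : IsFormalRealization c g vp xp vm xm T) {α β : Word d}
    (hα : α.IsPure false) (hα' : α ≠ []) (hβ : β.Starts false) :
    c (α.adj ++ β) = (vm α).adjoint ∘L xm β := by
  have h1 : formalRealize g vp xp vm xm = formalRealize g vm xm vp xp := by
    rw [formalRealize, formalRealize, add_comm (conv _ xp)]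
  rw [h.c_eq, h1]
  exact formalRealize_append h.g_pure h.vm_pure h.xm_starts h.vp_pure h.vp_nil hα hα' hβ

theorem c_isPure (h : IsFormalRealization c g vp xp vm xm T) {α : Word d}
    (hα : α.IsPure true) (hα' : α ≠ []) : c α = (2 : ℂ)⁻¹ • g α := by
  have h1 : α.Starts true := hα.starts hα'
  have h2 : adjSeries g α = 0 := by
    by_contra h3
    exact h1.not_isPure (adjSeries_ne_zero h.g_pure _ h3)
  rw [h.c_eq]
  simp only [formalRealize, Pi.add_apply, Pi.smul_apply]
  rw [h2, conv_eq_zero_of_not_starts (adjSeries_ne_zero h.vp_pure) (adjSeries_nil h.vp_nil)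
    h1.not_starts, conv_eq_zero_of_isPure (ε := true) (adjSeries_ne_zero h.vm_pure)
    (adjSeries_nil h.vm_nil) h.xm_starts hα, add_zero, add_zero, add_zero]

theorem c_nil (h : IsFormalRealization c g vp xp vm xm T) :
    c [] = (2 : ℂ)⁻¹ • (g [] + (g []).adjoint) := by
  have h1 : ∀ ε, ¬Word.Starts (d := d) ε [] := fun ε h => h.ne_nil rfl
  rw [h.c_eq]
  simp only [formalRealize, Pi.add_apply, Pi.smul_apply]
  rw [conv_eq_zero_of_not_starts (adjSeries_ne_zero h.vp_pure) (adjSeries_nil h.vp_nil) (h1 _),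
    conv_eq_zero_of_not_starts (adjSeries_ne_zero h.vm_pure) (adjSeries_nil h.vm_nil) (h1 _),
    add_zero, add_zero, adjSeries, Word.adj_nil]

/-- If `α` is pure, then `xp α = vp α` and the claim is the coefficient formula. Otherwise split off
the first block `α₁`: the operator `T α₁` moves to the other side as an adjoint and extends `β` to
`α₁^* β`, an element of the other family. The two claims therefore feed each other by induction on
the length of `α`, with `β` of arbitrary length. -/
theorem inner_eq (h : IsFormalRealization c g vp xp vm xm T) (N : ℕ) :
    (∀ α β : Word d, α.length ≤ N → α.Starts true → β.Starts true → ∀ w u,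
      inner ℂ (xp β w) (xp α u) = inner ℂ (c (α.adj ++ β) w) u) ∧
    ∀ α β : Word d, α.length ≤ N → α.Starts false → β.Starts false → ∀ w u,
      inner ℂ (xm β w) (xm α u) = inner ℂ (c (α.adj ++ β) w) u := by
  induction N with
  | zero =>
    exact ⟨fun α _ h1 h2 => absurd (List.length_eq_zero_iff.1 (Nat.le_zero.1 h1)) h2.ne_nil,
      fun α _ h1 h2 => absurd (List.length_eq_zero_iff.1 (Nat.le_zero.1 h1)) h2.ne_nil⟩
  | succ N ih =>
    constructor
    · intro α β hN hα hβ w u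
      rcases hα.isPure_or with h1 | ⟨α₁, α₂, rfl, h1, h2, h3⟩
      · rw [h.xp_isPure h1, h.c_append_plus h1 hα.ne_nil hβ, ContinuousLinearMap.comp_apply,
          ContinuousLinearMap.adjoint_inner_left]
      · have h4 : α₁.adj.IsPure false := Word.isPure_adj.2 h1
        have h5 : α₁.adj ≠ [] := mt Word.adj_eq_nil.1 h2
        have h6 := List.length_pos_of_ne_nil h2
        rw [List.length_append] at hN
        rw [h.xp_append h1 h3, ContinuousLinearMap.comp_apply,
          ← ContinuousLinearMap.adjoint_inner_left, ← adjSeries_adj,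
          ← ContinuousLinearMap.comp_apply, ← h.xm_append h4 hβ,
          ih.2 α₂ _ (by omega) h3 (h4.starts_append h5 β), Word.adj_append, List.append_assoc]
    · intro α β hN hα hβ w u
      rcases hα.isPure_or with h1 | ⟨α₁, α₂, rfl, h1, h2, h3⟩
      · rw [h.xm_isPure h1, h.c_append_minus h1 hα.ne_nil hβ, ContinuousLinearMap.comp_apply,
          ContinuousLinearMap.adjoint_inner_left]
      · have h4 : α₁.adj.IsPure true := Word.isPure_adj.2 h1
        have h5 : α₁.adj ≠ [] := mt Word.adj_eq_nil.1 h2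
        have h6 := List.length_pos_of_ne_nil h2
        rw [List.length_append] at hN
        rw [h.xm_append h1 h3, ContinuousLinearMap.comp_apply, adjSeries,
          ContinuousLinearMap.adjoint_inner_right,
          ← ContinuousLinearMap.comp_apply, ← h.xp_append h4 hβ,
          ih.1 α₂ _ (by omega) h3 (h4.starts_append h5 β), Word.adj_append, List.append_assoc]

end IsFormalRealization

end Readout

section Uniqueness

variable {K : Type*} [NormedAddCommGroup K] [InnerProductSpace ℂ K] [CompleteSpace K]
  {Hp Hm : Type*} [NormedAddCommGroup Hp] [InnerProductSpace ℂ Hp] [CompleteSpace Hp]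
  [NormedAddCommGroup Hm] [InnerProductSpace ℂ Hm] [CompleteSpace Hm]
  {c g : Word d → K →L[ℂ] K} {vp xp : Word d → K →L[ℂ] Hp} {vm xm : Word d → K →L[ℂ] Hm}
  {S : Word d → Hm →L[ℂ] Hp}

theorem isFormalRealization_of_realize {vp : Word d → K →L[ℂ] Hp} {vm : Word d → K →L[ℂ] Hm}
    (cc : ConvergesNearZero c) (ag : IsAnalyticSeries g) (avp : IsAnalyticSeries vp)
    (avm : IsCoanalyticSeries vm) (aS : IsAnalyticSeries S) (vp0 : vp [] = 0) (vm0 : vm [] = 0)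
    (S0 : S [] = 0) (cg : ConvergesNearZero g) (cvp : ConvergesNearZero vp)
    (cvm : ConvergesNearZero vm) (cS : ConvergesNearZero S)
    (h : ∀ n : ℕ, ∀ᶠ Z : MatTuple d n in 𝓝 0,
      ncEval c Z = realize (ncEval g Z) (ncEval vp Z) (ncEval vm Z) (ncEval S Z)) :
    ∃ xp xm, IsFormalRealization c g vp xp vm xm S := by
  obtain ⟨xp, xm, hxp, hxm⟩ := exists_formalSolution vp vm S0 (adjSeries_nil S0)
  exact ⟨xp, xm, ag, avp, fun γ hγ => Word.isPure_false.2 (avm γ hγ), aS, vp0, vm0, S0, hxp, hxm,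
    eq_formalRealize S0 hxp hxm cc cg cvp cvm cS h⟩

theorem IsFormalRealization.exists_constant (h : IsFormalRealization c g vp xp vm xm S) :
    ∃ C : K →L[ℂ] K, IsSelfAdjoint C ∧ g [] = gCoeff c [] + Complex.I • C ∧
      ∀ α : Word d, α ≠ [] → g α = gCoeff c α := by
  -- The imaginary part of `g []`, the only datum that `Re g` does not determine.
  refine ⟨(-Complex.I * 2⁻¹) • (g [] - (g []).adjoint), ?_, ?_, fun α hα => ?_⟩
  · rw [ContinuousLinearMap.isSelfAdjoint_iff', map_smulₛₗ, map_sub,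
      ContinuousLinearMap.adjoint_adjoint, map_mul, map_neg, Complex.conj_I, map_inv₀,
      Complex.conj_ofNat, ← neg_sub (g []), smul_neg, ← neg_smul]
    congr 1
    ring
  · have h1 : Complex.I * (-Complex.I * 2⁻¹) = 2⁻¹ := by
      rw [← mul_assoc, mul_neg, Complex.I_mul_I, neg_neg, one_mul]
    rw [gCoeff, if_pos rfl, h.c_nil, smul_smul, h1, ← smul_add, add_add_sub_cancel, ← two_smul ℂ,
      smul_smul]
    norm_num
  · rw [gCoeff, if_neg hα]
    split_ifs with h1
    · rw [h.c_isPure (Word.isPure_true.2 h1) hα, smul_smul]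
      norm_num
    · by_contra h2
      exact h1 (h.g_pure α h2)

theorem IsFormalRealization.eq_zero_or (h : IsFormalRealization c g vp xp vm xm S) (α : Word d) :
    S α = 0 ∨ α.IsAnalytic ∧ α ≠ [] := by
  by_cases h0 : S α = 0
  · exact .inl h0
  · exact .inr ⟨h.T_pure α h0, fun h1 => h0 (by rw [h1, h.T_nil])⟩

theorem IsFormalRealization.exists_isometry_plus [Fact (Cplus c).PosSemidef]
    (h : IsFormalRealization c g vp xp vm xm S) :
    ∃ W : Hplus c →ₗᵢ[ℂ] Hp, ∀ α w, W (vecPlus c α w) = xp α w := by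
  refine exists_isometry (denseRange_synth_vecPlus c) fun β α w u => ?_
  have hzero : ∀ γ : Word d, ¬γ.StartsAnalytic → xp γ = 0 := fun γ hγ => by
    by_contra h1
    exact hγ (Word.starts_true.1 (h.xp_starts γ h1))
  by_cases hα : α.StartsAnalytic
  swap
  · rw [vecPlus_of_not c hα, hzero α hα]
    simp
  by_cases hβ : β.StartsAnalytic
  swap
  · rw [vecPlus_of_not c hβ, hzero β hβ]
    simp
  rw [inner_vecPlus c hα hβ, (h.inner_eq _).1 α β le_rfl (Word.starts_true.2 hα)
    (Word.starts_true.2 hβ)]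

theorem IsFormalRealization.exists_isometry_minus [Fact (Cminus c).PosSemidef]
    (h : IsFormalRealization c g vp xp vm xm S) :
    ∃ W : Hminus c →ₗᵢ[ℂ] Hm, ∀ α w, W (vecMinus c α w) = xm α w := by
  refine exists_isometry (denseRange_synth_vecMinus c) fun β α w u => ?_
  have hzero : ∀ γ : Word d, ¬γ.StartsCoanalytic → xm γ = 0 := fun γ hγ => by
    by_contra h1
    exact hγ (Word.starts_false.1 (h.xm_starts γ h1))
  by_cases hα : α.StartsCoanalytic
  swap
  · rw [vecMinus_of_not c hα, hzero α hα]
    simp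
  by_cases hβ : β.StartsCoanalytic
  swap
  · rw [vecMinus_of_not c hβ, hzero β hβ]
    simp
  rw [inner_vecMinus c hα hβ, (h.inner_eq _).2 α β le_rfl (Word.starts_false.2 hα)
    (Word.starts_false.2 hβ)]

variable [Fact (Cplus c).PosSemidef] [Fact (Cminus c).PosSemidef]
  {T : Word d → Hminus c →L[ℂ] Hplus c}

theorem IsFormalRealization.apply_isometry (h : IsFormalRealization c g vp xp vm xm S)
    (hT : IsShiftFamily c T) {Wp : Hplus c →ₗᵢ[ℂ] Hp} {Wm : Hminus c →ₗᵢ[ℂ] Hm}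
    (hp : ∀ α w, Wp (vecPlus c α w) = xp α w) (hm : ∀ α w, Wm (vecMinus c α w) = xm α w)
    (α : Word d) (x : Hminus c) : S α (Wm x) = Wp (T α x) := by
  by_cases hα : α.IsAnalytic ∧ α ≠ []
  · have : S α ∘L Wm.toContinuousLinearMap = Wp.toContinuousLinearMap ∘L T α := by
      refine ext_of_denseRange_synth (denseRange_synth_vecMinus c) fun β w => ?_
      by_cases hβ : β.StartsCoanalytic
      · have h1 := congrArg (· w) (h.xp_append hα.1 (Word.starts_false.2 hβ))
        simp only [ContinuousLinearMap.comp_apply,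
          LinearIsometry.coe_toContinuousLinearMap] at h1 ⊢
        rw [hm, hT.1 α hα.1 hα.2 β hβ, hp, h1]
      · rw [vecMinus_of_not c hβ]
        simp
    exact congrArg (· x) this
  · rw [hT.2 α hα, (h.eq_zero_or α).resolve_right hα]
    simp

/-- Together with `apply_isometry` this makes the pair of ranges reducing for `S`, so that no
off-diagonal part remains in the decomposition. -/
theorem IsFormalRealization.adjoint_apply_isometry (h : IsFormalRealization c g vp xp vm xm S)
    (hT : IsShiftFamily c T) {Wp : Hplus c →ₗᵢ[ℂ] Hp} {Wm : Hminus c →ₗᵢ[ℂ] Hm}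
    (hp : ∀ α w, Wp (vecPlus c α w) = xp α w) (hm : ∀ α w, Wm (vecMinus c α w) = xm α w)
    (α : Word d) (x : Hplus c) : (S α).adjoint (Wp x) = Wm ((T α).adjoint x) := by
  by_cases hα : α.IsAnalytic ∧ α ≠ []
  · have : (S α).adjoint ∘L Wp.toContinuousLinearMap =
        Wm.toContinuousLinearMap ∘L (T α).adjoint := by
      refine ext_of_denseRange_synth (denseRange_synth_vecPlus c) fun β w => ?_
      by_cases hβ : β.StartsAnalytic
      · have h1 := congrArg (· w) (h.xm_append (Word.isPure_adj.2 (Word.isPure_true.2 hα.1))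
          (Word.starts_true.2 hβ))
        simp only [ContinuousLinearMap.comp_apply, adjSeries_adj,
          LinearIsometry.coe_toContinuousLinearMap] at h1 ⊢
        rw [hp, hT.adjoint_vecPlus hα.1 hα.2 hβ, hm, h1]
      · rw [vecPlus_of_not c hβ]
        simp
    exact congrArg (· x) this
  · rw [hT.2 α hα, (h.eq_zero_or α).resolve_right hα]
    simp

theorem IsFormalRealization.exists_decomposition (h : IsFormalRealization c g vp xp vm xm S)
    (hS : ConvergesNearZero S) (hT : IsShiftFamily c T) :
    ∃ (Lp : Submodule ℂ Hp) (Lm : Submodule ℂ Hm)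
      (Up : WithLp 2 (Hplus c × Lp) ≃ₗᵢ[ℂ] Hp) (Um : WithLp 2 (Hminus c × Lm) ≃ₗᵢ[ℂ] Hm)
      (J : Word d → Lm →L[ℂ] Lp),
      IsAnalyticSeries J ∧ J [] = 0 ∧ ConvergesNearZero J ∧
      (∀ (α : Word d) (w : K), vp α w = Up (WithLp.toLp 2 (vplusCoeff c α w, 0))) ∧
      (∀ (α : Word d) (w : K), vm α w = Um (WithLp.toLp 2 (vminusCoeff c α w, 0))) ∧
      ∀ (α : Word d) (x : Hminus c) (y : Lm),
        S α (Um (WithLp.toLp 2 (x, y))) = Up (WithLp.toLp 2 (T α x, J α y)) := by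
  obtain ⟨Wp, hp⟩ := h.exists_isometry_plus
  obtain ⟨Wm, hm⟩ := h.exists_isometry_minus
  obtain ⟨Up, hUp⟩ := exists_unitary Wp
  obtain ⟨Um, hUm⟩ := exists_unitary Wm
  let Lp := (LinearMap.range Wp.toLinearMap)ᗮ
  let Lm := (LinearMap.range Wm.toLinearMap)ᗮ
  -- The junk series is the compression of `S` to the complements. Written as a product with fixed
  -- operators it inherits convergence from `S`.
  refine ⟨Lp, Lm, Up, Um, fun α => Lp.orthogonalProjectionOnto ∘L S α ∘L Lm.subtypeL,
    fun α hα => h.T_pure α fun h1 => hα (by dsimp only; rw [h1]; simp), by simp [h.T_nil],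
    hS.comp _ _, fun α w => ?_, fun α w => ?_, fun α x y => ?_⟩
  · rw [hUp, Submodule.coe_zero, add_zero, vplusCoeff]
    split_ifs with hα
    · rw [hp, h.xp_isPure (Word.isPure_true.2 hα.1)]
    · have : vp α = 0 := by
        by_contra h1
        exact hα ⟨h.vp_pure α h1, fun h2 => h1 (by rw [h2, h.vp_nil])⟩
      rw [this]
      simp
  · rw [hUm, Submodule.coe_zero, add_zero, vminusCoeff]
    split_ifs with hα
    · rw [hm, h.xm_isPure (Word.isPure_false.2 hα.1)]
    · have : vm α = 0 := by
        by_contra h1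
        exact hα ⟨Word.isPure_false.1 (h.vm_pure α h1), fun h2 => h1 (by rw [h2, h.vm_nil])⟩
      rw [this]
      simp
  -- The adjoint of `S α` maps the range of `Wp` into the range of `Wm`, so `S α` maps the
  -- complement of the latter into that of the former, and the projection in `J` changes nothing.
  · have hmem : S α y ∈ Lp := by
      rintro _ ⟨u, rfl⟩
      have h1 : inner ℂ (Wp u) (S α y) = 0 := by
        rw [← ContinuousLinearMap.adjoint_inner_left, h.adjoint_apply_isometry hT hp hm]
        exact Submodule.inner_right_of_mem_orthogonal
          (K := LinearMap.range Wm.toLinearMap) ⟨_, rfl⟩ y.2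
      exact h1
    rw [hUm, hUp, map_add, h.apply_isometry hT hp hm]
    congr 1
    exact (Submodule.starProjection_eq_self_iff.2 hmem).symm

end Uniqueness

end NCPsh

end


/-! ### The main theorem -/

theorem mainTheorem9 {d : ℕ} {K : Type u} [NormedAddCommGroup K] [InnerProductSpace ℂ K]
    [CompleteSpace K] (c : Word d → K →L[ℂ] K)
    (hconv : ∃ r : ℝ, 0 < r ∧ ConvergesOnBall c r)
    (hpsh : PlurisubharmonicNearZero fun (n : ℕ) (Z : MatTuple d n) => ncEval c Z) :
    ∃ (_ : Fact (Cplus c).PosSemidef) (_ : Fact (Cminus c).PosSemidef),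
      (∃! T : Word d → Hminus c →L[ℂ] Hplus c, IsShiftFamily c T) ∧
      ∀ T : Word d → Hminus c →L[ℂ] Hplus c, IsShiftFamily c T →
        -- the adjoints of the operators `T_α`
        (∀ α : Word d, α.IsAnalytic → α ≠ [] → ∀ β : Word d, β.StartsAnalytic → ∀ w : K,
          (T α).adjoint (vecPlus c β w) = vecMinus c (α.adj ++ β) w) ∧
        -- exponential growth
        BddAbove ((fun α : Word d => ‖T α‖ ^ (1 / (α.length : ℝ))) ''
          {α | α.IsAnalytic ∧ α ≠ []}) ∧
        -- convergence on a uniform neighborhood of `0`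
        (∃ r : ℝ, 0 < r ∧ ConvergesOnBall T r ∧ ConvergesOnBall (vplusCoeff c) r ∧
          ConvergesOnBall (vminusCoeff c) r ∧ ConvergesOnBall (gCoeff c) r) ∧
        -- contractivity on a uniform neighborhood of `0`
        (∃ r : ℝ, 0 < r ∧ ∀ (n : ℕ) (Z : MatTuple d n), ‖Z‖ < r → ‖ncEval T Z‖ < 1) ∧
        -- the realization formula
        (∃ r : ℝ, 0 < r ∧ ∀ (n : ℕ) (Z : MatTuple d n), ‖Z‖ < r →
          IsUnit (blockOp (ncEval T Z)) ∧
          ncEval c Z = realize (ncEval (gCoeff c) Z) (ncEval (vplusCoeff c) Z)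
            (ncEval (vminusCoeff c) Z) (ncEval T Z)) ∧
        -- uniqueness up to junk summands
        (∀ (Hp Hm : Type v) [NormedAddCommGroup Hp] [InnerProductSpace ℂ Hp] [CompleteSpace Hp]
          [NormedAddCommGroup Hm] [InnerProductSpace ℂ Hm] [CompleteSpace Hm]
          (g' : Word d → K →L[ℂ] K) (vp' : Word d → K →L[ℂ] Hp) (vm' : Word d → K →L[ℂ] Hm)
          (T' : Word d → Hm →L[ℂ] Hp),
          IsAnalyticSeries g' → IsAnalyticSeries vp' → IsCoanalyticSeries vm' →
          IsAnalyticSeries T' →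
          vp' [] = 0 → vm' [] = 0 → T' [] = 0 →
          ConvergesNearZero g' → ConvergesNearZero vp' → ConvergesNearZero vm' →
          ConvergesNearZero T' →
          (∀ n : ℕ, ∀ᶠ Z : MatTuple d n in 𝓝 0,
            ncEval c Z = realize (ncEval g' Z) (ncEval vp' Z) (ncEval vm' Z) (ncEval T' Z)) →
          (∃ C : K →L[ℂ] K, IsSelfAdjoint C ∧ g' [] = gCoeff c [] + Complex.I • C ∧
            ∀ α : Word d, α ≠ [] → g' α = gCoeff c α) ∧
          ∃ (Lp : Submodule ℂ Hp) (Lm : Submodule ℂ Hm)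
            (Up : WithLp 2 (Hplus c × Lp) ≃ₗᵢ[ℂ] Hp) (Um : WithLp 2 (Hminus c × Lm) ≃ₗᵢ[ℂ] Hm)
            (J : Word d → Lm →L[ℂ] Lp),
            IsAnalyticSeries J ∧ J [] = 0 ∧ ConvergesNearZero J ∧
            (∀ (α : Word d) (w : K), vp' α w = Up (WithLp.toLp 2 (vplusCoeff c α w, 0))) ∧
            (∀ (α : Word d) (w : K), vm' α w = Um (WithLp.toLp 2 (vminusCoeff c α w, 0))) ∧
            ∀ (α : Word d) (x : Hminus c) (y : Lm),
              T' α (Um (WithLp.toLp 2 (x, y))) = Up (WithLp.toLp 2 (T α x, J α y))) := by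
  obtain ⟨r, hr, hball⟩ := hconv
  obtain ⟨M, R, hM, hR, hc⟩ := hball.growthBound hr
  have hself := adjSeries_eq_self hR.le hc hpsh
  have : Fact (Cplus c).PosSemidef := ⟨posSemidef_Cplus hM hR hc hpsh⟩
  have : Fact (Cminus c).PosSemidef := ⟨posSemidef_Cminus hM hR hc hpsh⟩
  -- A single radius serves all the local claims: summability needs `2dR‖Z‖ < 1` and contractivity
  -- of `T(Z)` needs `4dR‖Z‖ < 1`. The summand `1` keeps the radius finite and positive when `d =
  -- 0`.
  have hr4 : 4 * d * R * (4 * d * R + 1)⁻¹ < 1 := by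
    rw [← div_eq_mul_inv, div_lt_one (by positivity)]
    linarith
  have hr2 : 2 * d * R * (4 * d * R + 1)⁻¹ < 1 := by
    have : 0 ≤ d * R * (4 * d * R + 1)⁻¹ := by positivity
    linarith
  have hr0 : 0 < (4 * d * R + 1)⁻¹ := by positivity
  have hr4' : ∀ {n : ℕ} {Z : MatTuple d n}, ‖Z‖ < (4 * d * R + 1)⁻¹ → 4 * d * R * ‖Z‖ < 1 :=
    fun hZ => lt_of_le_of_lt (by gcongr) hr4
  refine ⟨‹_›, ‹_›, ⟨shiftCoeff c, isShiftFamily_shiftCoeff c hM hR hc,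
    fun T hT => hT.unique (isShiftFamily_shiftCoeff c hM hR hc)⟩,
    fun T hT => ⟨?_, ?_, ?_, ?_, ?_, ?_⟩⟩
  · exact fun α hα hα' β hβ w => hT.adjoint_vecPlus hα hα' hβ w
  · exact hT.bddAbove hM hR hc
  · exact ⟨_, hr0, (hT.growthBound hM hR hc).convergesOnBall hR.le hr2,
      (hc.vplusCoeff hM.le hR.le).convergesOnBall hR.le hr2,
      (hc.vminusCoeff hM.le hR.le).convergesOnBall hR.le hr2,
      (hc.gCoeff hM.le hR.le).convergesOnBall hR.le hr2⟩
  · exact ⟨_, hr0, fun n Z hZ => hT.norm_ncEval_lt_one hM hR hc (hr4' hZ)⟩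
  · exact ⟨_, hr0, fun n Z hZ => hT.isUnit_and_ncEval_eq hM hR hc hself (hr4' hZ)⟩
  · intro Hp Hm _ _ _ _ _ _ g' vp' vm' T' ag avp avm aT vp0 vm0 T0 cg cvp cvm cT h
    have cc : ConvergesNearZero c := fun n => by
      filter_upwards [eventually_mul_norm_lt_one (2 * d * R)] with Z hZ
      exact (hc.summable_norm_homPart hR.le hZ).of_norm
    obtain ⟨xp, xm, hreal⟩ :=
      isFormalRealization_of_realize cc ag avp avm aT vp0 vm0 T0 cg cvp cvm cT h
    exact ⟨hreal.exists_constant, hreal.exists_decomposition cT hT⟩
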